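/- **Setting.** Let $\ell:\mathbb R\to\mathbb R^3$ be a $C^3$ curve parametrized by arc length which is a homeomorphism onto its image, with tangent $\mathbf t=\dot\ell$ and curvature $\kappa=|\ddot\ell|$. Assume that $\ell$ has a global Frenet frame, i.e. a positively oriented orthonormal triad $(\mathbf t,\mathbf n,\mathbf b)$ of $C^1$ fields, $\mathbf b=\mathbf t\times\mathbf n$, with $\dot{\mathbf t}=\kappa\mathbf n$ on all of $\mathbb R$; its torsion $\tau$ is defined by $\dot{\mathbf n}=-\kappa\mathbf t+\tau\mathbf b$. For $\beta\in C^1(\mathbb R)$ put $\mathbf N_\beta=\mathbf n\cos\beta-\mathbf b\sin\beta$ and $\mathbf B_\beta=\mathbf n\sin\beta+\mathbf b\cos\beta$. Let $\omega\subset\mathbb R^2$ be a bounded domain whose boundary is piecewise $C^2$ without cusps (near each boundary point, in suitable Cartesian coordinates centred there, $\omega$ is the region below the graph of a continuous function that is $C^2$ on each side of the point, up to the point). Let $\gamma_D\subseteq\partial\omega$ be a union of finitely many arcs, each of positive length. Suppose that the tube is bent but not twisted, that is, $\kappa\not\equiv0$ and $\tau-\dot\beta=0$, that $\|\kappa\|_\infty\,\sup_{x'\in\omega}|x'|<1$,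 and that the map $(x_1,x_2,x_3)\mapsto \ell(x_3)+x_1\mathbf N_\beta(x_3)+x_2\mathbf B_\beta(x_3)$ is injective on $Q=\omega\times\mathbb R$. For a set $\Gamma\subseteq\partial\Omega$ let $H^1_0(\Omega,\Gamma)$ denote the space of functions in $H^1(\Omega)$ that vanish on $\Gamma$, i.e. the closure in $H^1(\Omega)$ of those functions in $H^1(\Omega)$ which vanish in a neighbourhood of $\Gamma$. Let $\lambda_1$ be the lowest eigenvalue of the Laplacian $-\Delta'$ in $\omega$ with Dirichlet condition on $\gamma_D$ and Neumann condition on $\partial\omega\setminus\gamma_D$, in the weak sense, and let $\psi_1\in H^1_0(\omega,\gamma_D)$ be a corresponding real eigenfunction normalized in $L^2(\omega)$: $\int_\omega\nabla'\psi_1\cdot\nabla'\phi\,dx'=\lambda_1\int_\omega\psi_1\phi\,dx'$ for all $\phi\in H^1_0(\omega,\gamma_D)$. Put $$A_j=\int_\omega\psi_1\,\partial_j\psi_1\,dx',\qquad j=1,2 .$$ Let $g(x)=1-(x_1\cos\beta(x_3)+x_2\sin\beta(x_3))\,\kappa(x_3)$, and let $T_{\ell,\beta}$ be the operator in the weighted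 space $L^2(Q,g)$, with scalar product $(u,v)_{Q,g}=\int_Q g\,u\,\bar v\,dx$, associated with the quadratic form $$a_{\ell,\beta}[u]=\int_Q\Big[g\,\big(|\partial_1u|^2+|\partial_2u|^2\big)+g^{-1}|\partial_3u|^2\Big]dx,\qquad u\in H^1_0(Q,\gamma_D\times\mathbb R).$$ **Theorem.** Suppose there is a compact interval $I\subset\mathbb R$ such that $$\int_I\kappa(x_3)\,\big(A_1\cos\beta(x_3)+A_2\sin\beta(x_3)\big)\,dx_3<0$$ and $$\kappa(x_3)\,\big(A_1\cos\beta(x_3)+A_2\sin\beta(x_3)\big)\le0\qquad\text{for all }x_3\in\mathbb R\setminus I .$$ Then $\inf\sigma(T_{\ell,\beta})<\lambda_1$. If, moreover, $\kappa$ is compactly supported, then the discrete spectrum of $T_{\ell,\beta}$ (the isolated eigenvalues of finite multiplicity) is nonempty. -/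

import Mathlib

open MeasureTheory

noncomputable section

namespace BentTube

/-- The plane `ℝ²` containing the cross section. -/
abbrev Plane := EuclideanSpace ℝ (Fin 2)

/-- The space `ℝ³` containing the axis of the tube. -/
abbrev Space := EuclideanSpace ℝ (Fin 3)

/-! ### The cross section -/

/-- Near each of its boundary points `ω` is, in suitable Cartesian coordinates `(s, t)` centred at
that point, the region `t < f s` below the graph of a continuous function that is `C²` on each side
of the point, up to the point. So the boundary is piecewise `C²`, and the interior angles at the
corners (finitely many, by compactness) lie strictly between `0` and `2π`: there are no cusps. -/
def HasPiecewiseC2Boundary (ω : Set Plane) : Prop :=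
  ∀ p ∈ frontier ω, ∃ (e : Plane ≃ₗᵢ[ℝ] Plane) (r h : ℝ) (f : ℝ → ℝ),
    0 < r ∧ 0 < h ∧ f 0 = 0 ∧
    ContDiffOn ℝ 2 f (Set.Icc (-r) 0) ∧ ContDiffOn ℝ 2 f (Set.Icc 0 r) ∧
    ∀ s t : ℝ, |s| < r → |t| < h → (p + e !₂[s, t] ∈ ω ↔ t < f s)

/-- A bounded planar domain with piecewise `C²` boundary without cusps. -/
structure IsCrossSection (ω : Set Plane) : Prop where
  isOpen : IsOpen ω
  isConnected : IsConnected ω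
  isBounded : Bornology.IsBounded ω
  boundary : HasPiecewiseC2Boundary ω

/-- `γD` is the union of finitely many arcs (connected subsets) of the boundary of `ω`, each of
positive length. -/
def IsDirichletPart (ω γD : Set Plane) : Prop :=
  ∃ (N : ℕ) (γ : Fin N → Set Plane), γD = ⋃ i, γ i ∧
    ∀ i, γ i ⊆ frontier ω ∧ IsConnected (γ i) ∧ 0 < Measure.hausdorffMeasure 1 (γ i)

/-- `a = sup {|x'| : x' ∈ ω}`. -/
def crossRadius (ω : Set Plane) : ℝ := sSup ((fun x => ‖x‖) '' ω)

/-! ### The axis, its frames, and the tube -/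

/-- The curvature `κ = |ℓ''|` of a curve parametrized by arc length. -/
def curvature (ℓ : ℝ → Space) (z : ℝ) : ℝ := ‖deriv (deriv ℓ) z‖

/-- `ℓ` is a `C³` curve, parametrized by arc length and homeomorphic onto its image. -/
structure IsAxis (ℓ : ℝ → Space) : Prop where
  contDiff : ContDiff ℝ 3 ℓ
  arcLength : ∀ z, ‖deriv ℓ z‖ = 1
  isEmbedding : Topology.IsEmbedding ℓ

/-- `(ℓ', n, b)` is a global Frenet frame of `ℓ`: a `C¹`, positively oriented orthonormal frame with
`ℓ'' = κ n`. On straight parts of the curve, `n` is any `C¹` unit normal field. -/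
structure IsGlobalFrenetFrame (ℓ n b : ℝ → Space) : Prop where
  contDiff_normal : ContDiff ℝ 1 n
  norm_normal : ∀ z, ‖n z‖ = 1
  tangent_orthogonal : ∀ z, inner ℝ (deriv ℓ z) (n z) = 0
  deriv_tangent : ∀ z, deriv (deriv ℓ) z = curvature ℓ z • n z
  binormal : ∀ z, b z =
    WithLp.toLp 2 (crossProduct (WithLp.ofLp (deriv ℓ z)) (WithLp.ofLp (n z)))

/-- The torsion, i.e. the coefficient `τ` in the Serret-Frenet equation `n' = -κ t + τ b`. -/
def torsion (n b : ℝ → Space) (z : ℝ) : ℝ := inner ℝ (deriv n z) (b z)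

/-- `(x', x₃) ↦ ℓ(x₃) + x₁ N_β(x₃) + x₂ B_β(x₃)` with `N_β = n cos β - b sin β` and
`B_β = n sin β + b cos β`. -/
def tubeMap (ℓ n b : ℝ → Space) (β : ℝ → ℝ) (x : Plane × ℝ) : Space :=
  ℓ x.2
    + x.1 0 • (Real.cos (β x.2) • n x.2 - Real.sin (β x.2) • b x.2)
    + x.1 1 • (Real.sin (β x.2) • n x.2 + Real.cos (β x.2) • b x.2)

/-- The straight tube `Q = ω × ℝ`. -/
def straightTube (ω : Set Plane) : Set (Plane × ℝ) := ω ×ˢ Set.univ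

/-- The Dirichlet part `Γ = γD × ℝ` of the boundary of the straight tube. -/
def lateralDirichlet (γD : Set Plane) : Set (Plane × ℝ) := γD ×ˢ Set.univ

/-- The tube with axis `ℓ`, cross section `ω` and moving frame `(ℓ', N_β, B_β)` is bent but not
twisted (`κ ≢ 0` and `τ - β' = 0`), satisfies `a ‖κ‖_∞ < 1`, and does not intersect itself. -/
structure IsBentUntwistedTube (ω : Set Plane) (ℓ n b : ℝ → Space) (β : ℝ → ℝ) : Prop where
  axis : IsAxis ℓ
  frame : IsGlobalFrenetFrame ℓ n b
  contDiff_angle : ContDiff ℝ 1 β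
  bent : ∃ z, curvature ℓ z ≠ 0
  untwisted : ∀ z, torsion n b z - deriv β z = 0
  curvature_bdd : BddAbove (Set.range (curvature ℓ))
  thin : crossRadius ω * (⨆ z, curvature ℓ z) < 1
  injOn : Set.InjOn (tubeMap ℓ n b β) (straightTube ω)

/-! ### Sobolev spaces -/

section Sobolev

variable {E : Type*} [NormedAddCommGroup E] [NormedSpace ℝ E] [MeasureSpace E]
  {𝕜 : Type*} [RCLike 𝕜] {ι : Type*}

/-- `φ ∈ C_c^∞(Ω)`. -/
structure IsTestFunction (Ω : Set E) (φ : E → ℝ) : Prop where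
  contDiff : ContDiff ℝ (⊤ : ℕ∞) φ
  hasCompactSupport : HasCompactSupport φ
  tsupport_subset : tsupport φ ⊆ Ω

/-- `u` belongs to `L²(Ω)` and has the weak derivatives `p i ∈ L²(Ω)` in the directions `e i`. When
`e` is the standard basis this says that `u ∈ H¹(Ω)` and `p = ∇u`. -/
structure MemSobolev (Ω : Set E) (e : ι → E) (u : E → 𝕜) (p : ι → E → 𝕜) : Prop where
  memLp : MemLp u 2 (volume.restrict Ω)
  grad_memLp : ∀ i, MemLp (p i) 2 (volume.restrict Ω)
  weak_deriv : ∀ (i : ι) (φ : E → ℝ), IsTestFunction Ω φ →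
    ∫ x in Ω, (fderiv ℝ φ x (e i) : 𝕜) * u x = - ∫ x in Ω, (φ x : 𝕜) * p i x

/-- `u ∈ H¹_0(Ω, Γ)`, the `H¹`-functions vanishing on `Γ ⊆ ∂Ω`, and `p = ∇u`. The space is the closure
in `H¹(Ω)` of the functions in `H¹(Ω)` that vanish in a neighbourhood of `Γ`. -/
structure MemSobolevZero (Ω Γ : Set E) (e : ι → E) (u : E → 𝕜) (p : ι → E → 𝕜) : Prop
    extends MemSobolev Ω e u p where
  approx : ∀ ε : ENNReal, 0 < ε → ∃ (w : E → 𝕜) (q : ι → E → 𝕜), MemSobolev Ω e w q ∧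
    (∃ U : Set E, IsOpen U ∧ Γ ⊆ U ∧ ∀ᵐ x ∂(volume.restrict Ω), x ∈ U → w x = 0) ∧
    eLpNorm (u - w) 2 (volume.restrict Ω) < ε ∧
    ∀ i, eLpNorm (p i - q i) 2 (volume.restrict Ω) < ε

end Sobolev

/-- The coordinate directions of `ℝ²`. -/
def planeDir (i : Fin 2) : Plane := EuclideanSpace.single i 1

/-- The coordinate directions of `ℝ² × ℝ`. -/
def tubeDir : Fin 3 → Plane × ℝ := ![(planeDir 0, 0), (planeDir 1, 0), (0, 1)]

/-! ### The transverse problem -/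

/-- `ψ`, with weak gradient `dψ`, is a real eigenfunction, normalized in `L²(ω)`, of `-Δ'` on `ω` with
Dirichlet condition on `γD` and Neumann condition on the rest of the boundary; `μ` is its
eigenvalue. -/
structure IsTransverseEigenpair (ω γD : Set Plane) (μ : ℝ) (ψ : Plane → ℝ)
    (dψ : Fin 2 → Plane → ℝ) : Prop where
  mem : MemSobolevZero ω γD planeDir ψ dψ
  normalized : ∫ x in ω, ψ x ^ 2 = 1
  weak_eq : ∀ (φ : Plane → ℝ) (dφ : Fin 2 → Plane → ℝ), MemSobolevZero ω γD planeDir φ dφ →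
    ∫ x in ω, (dψ 0 x * dφ 0 x + dψ 1 x * dφ 1 x) = μ * ∫ x in ω, ψ x * φ x

/-- The eigenvalue of the eigenpair is the lowest one. -/
structure IsTransverseGroundState (ω γD : Set Plane) (lam : ℝ) (ψ : Plane → ℝ)
    (dψ : Fin 2 → Plane → ℝ) : Prop extends IsTransverseEigenpair ω γD lam ψ dψ where
  lowest : ∀ (μ : ℝ) (φ : Plane → ℝ) (dφ : Fin 2 → Plane → ℝ),
    IsTransverseEigenpair ω γD μ φ dφ → lam ≤ μ

/-- `A_j = ∫_ω ψ ∂_jψ`. -/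
def transverseMean (ω : Set Plane) (ψ : Plane → ℝ) (dψ : Fin 2 → Plane → ℝ) (j : Fin 2) : ℝ :=
  ∫ x in ω, ψ x * dψ j x

/-! ### Operators in a Hilbert space, given by their graphs -/

section Spectrum

variable {H : Type*} [NormedAddCommGroup H] [NormedSpace ℂ H]

/-- The resolvent set of the operator with graph `T`: the `z` for which `T - z` is a bijection from
the domain of `T` onto `H` with a bounded inverse `R`. -/
def resolventSet (T : Set (H × H)) : Set ℂ :=
  {z | ∃ R : H →L[ℂ] H, (∀ f, (R f, f + z • R f) ∈ T) ∧ ∀ u f, (u, f) ∈ T → R (f - z • u) = u}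

/-- The spectrum. -/
def spectrum (T : Set (H × H)) : Set ℂ := (resolventSet T)ᶜ

/-- The discrete spectrum: the isolated points of the spectrum that are eigenvalues of finite
multiplicity. -/
def discreteSpectrum (T : Set (H × H)) : Set ℂ :=
  {z | z ∈ spectrum T ∧ (∃ ε > 0, ∀ w ∈ spectrum T, dist w z < ε → w = z) ∧
    (∃ u, u ≠ 0 ∧ (u, z • u) ∈ T) ∧
    FiniteDimensional ℂ (Submodule.span ℂ {u : H | (u, z • u) ∈ T})}

end Spectrum

/-! ### The operator of the tube -/

/-- `g(x) = 1 - (x₁ cos β(x₃) + x₂ sin β(x₃)) κ(x₃)`. -/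
def weight (κ β : ℝ → ℝ) (x : Plane × ℝ) : ℝ :=
  1 - (x.1 0 * Real.cos (β x.2) + x.1 1 * Real.sin (β x.2)) * κ x.2

/-- The measure `g dx` on the straight tube. -/
def weightedMeasure (ω : Set Plane) (κ β : ℝ → ℝ) : Measure (Plane × ℝ) :=
  (volume.restrict (straightTube ω)).withDensity fun x => ENNReal.ofReal (weight κ β x)

/-- The weighted Hilbert space `L²(Q, g)` with `(u, v)_{Q,g} = ∫_Q g u v̄`. -/
abbrev WeightedL2 (ω : Set Plane) (κ β : ℝ → ℝ) : Type :=
  Lp ℂ 2 (weightedMeasure ω κ β)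

/-- The sesquilinear form
`∫_Q [g (∂₁u ∂₁v̄ + ∂₂u ∂₂v̄) + g⁻¹ ∂₃u ∂₃v̄]`, as a function of `p = ∇u` and `q = ∇v`. -/
def tubeForm (ω : Set Plane) (κ β : ℝ → ℝ) (p q : Fin 3 → Plane × ℝ → ℂ) : ℂ :=
  ∫ x in straightTube ω,
    ((weight κ β x : ℂ) * (p 0 x * star (q 0 x) + p 1 x * star (q 1 x))
      + (weight κ β x : ℂ)⁻¹ * (p 2 x * star (q 2 x)))

/-- The graph of the operator `T_{ℓ,β}` in `L²(Q, g)` associated with the form `tubeForm` on the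
domain `H¹_0(Q, Γ)`: `T u = f` when `u` is in the form domain and `a(u, v) = (f, v)_{Q,g}` for all `v`
in the form domain. The weighted `H¹` space is the unweighted one, because for
`a ‖κ‖_∞ < 1` the weight lies between two positive constants on `Q`. (Mathlib's `inner` is linear in
its second argument.) -/
def tubeOperator (ω γD : Set Plane) (κ β : ℝ → ℝ) :
    Set (WeightedL2 ω κ β × WeightedL2 ω κ β) :=
  {uf | ∃ p : Fin 3 → Plane × ℝ → ℂ,
    MemSobolevZero (straightTube ω) (lateralDirichlet γD) tubeDir (uf.1 : Plane × ℝ → ℂ) p ∧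
    ∀ (v : WeightedL2 ω κ β) (q : Fin 3 → Plane × ℝ → ℂ),
      MemSobolevZero (straightTube ω) (lateralDirichlet γD) tubeDir (v : Plane × ℝ → ℂ) q →
      tubeForm ω κ β p q = inner ℂ v uf.2}

end BentTube

end

/-! Let `V` be the form domain with the norm `‖U‖² = a[U] + ‖U‖²` and `J` its inclusion in the
weighted `L²`. Then `R = J J†` is the resolvent at `-1` of the operator, and `‖R‖ = ‖J‖²` is the
supremum of `‖J U‖² / ‖U‖²`. The number `‖R‖⁻¹ - 1` always lies in the spectrum, so both conclusions
reduce to statements about `R`.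

Spectrum below `λ₁`. The trial function is `ψ₁(x') φ(x₃)`. For fixed `x₃` the weight `g` is affine
in `x'` with gradient `-κ (cos β, sin β)`, so `g ψ₁` is admissible in the weak equation for `ψ₁`.
This gives `∫ g |∇'ψ₁|² - λ₁ ∫ g ψ₁² = κ (A₁ cos β + A₂ sin β)` (`transverse_weighted_energy`). The
energy of the trial function minus `λ₁` times its mass is therefore at most the integral of `φ²`
against this density plus a multiple of `∫ φ'²`. A stretched cutoff makes the second term as small
as desired while the first stays below the negative integral over the compact interval
(`exists_cutoff`).

Discreteness. Where `κ = 0` the tube is a straight product, and there the transverse energy is at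
least `λ₁` times the mass (`tube_eLpNorm_le`). Hence `(1 + λ₁) ‖J U‖² ≤ ‖U‖² + q(U)`, where `q` is a
multiple of the mass over the support of `κ` (`mass_le`). When this support is compact, Rellich's
theorem makes `q` tend to zero along bounded weakly null sequences (`tendsto_massOver`). Together
with `(1 + λ₁) ‖R‖ > 1`, this says that `R - ‖R‖` has no singular sequence
(`tendsto_zero_of_weaklyNull`), so `‖R‖` is an isolated eigenvalue of finite multiplicity.

Two analytic facts are proved along the way. Rellich compactness comes from the cone property of the
cross section: along the directions of a cone a Sobolev function is close to its averages, and these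
are compact (`tendsto_eLpNorm_of_cone`). And `λ₁`, which is given only as the least eigenvalue, is
shown by this compactness to be the minimum of the Rayleigh quotient (`exists_minimal_eigenpair`).
The bound is carried to the tube by expanding in a Hilbert basis of the longitudinal variable. -/

set_option linter.unusedSectionVars false

open MeasureTheory

noncomputable section

namespace BentTube

/-! ### Weakly null sequences and operators without singular sequences -/

section

open Filter Topology ContinuousLinearMap

section Hilbert

variable {𝕜 : Type*} [RCLike 𝕜]
  {H : Type*} [NormedAddCommGroup H] [InnerProductSpace 𝕜 H] [CompleteSpace H]
  {V : Type*} [NormedAddCommGroup V] [InnerProductSpace 𝕜 V] [CompleteSpace V]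

/-- The sequence converges weakly to zero. -/
def WeaklyNull (𝕜 : Type*) [RCLike 𝕜] {H : Type*} [NormedAddCommGroup H] [InnerProductSpace 𝕜 H]
    (f : ℕ → H) : Prop :=
  ∀ y : H, Tendsto (fun n => inner 𝕜 y (f n)) atTop (𝓝 0)

theorem WeaklyNull.map {f : ℕ → H} (hf : WeaklyNull 𝕜 f) (A : H →L[𝕜] V) :
    WeaklyNull 𝕜 fun n => A (f n) := fun y => by
  simpa only [adjoint_inner_left] using hf (adjoint A y)

/-- Sequential Banach–Alaoglu in the dual of a separable Hilbert space, transported by the Riesz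
isomorphism. -/
theorem exists_subseq_weaklyNull [TopologicalSpace.SeparableSpace H] (f : ℕ → H) (C : ℝ)
    (hf : ∀ n, ‖f n‖ ≤ C) :
    ∃ (g : H) (φ : ℕ → ℕ), StrictMono φ ∧ WeaklyNull 𝕜 fun n => f (φ n) - g := by
  have hc := WeakDual.isSeqCompact_closedBall 𝕜 H 0 C
  obtain ⟨a, -, φ, hφ, ha⟩ := hc
    (x := fun n => StrongDual.toWeakDual (InnerProductSpace.toDual 𝕜 H (f n)))
    (fun n => by
      simp only [Set.mem_preimage, mem_closedBall_zero_iff]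
      exact ((InnerProductSpace.toDual 𝕜 H).norm_map (f n)).trans_le (hf n))
  refine ⟨(InnerProductSpace.toDual 𝕜 H).symm (WeakDual.toStrongDual a), φ, hφ, fun y => ?_⟩
  have h1 : Tendsto (fun n => inner 𝕜 (f (φ n)) y) atTop (𝓝 (a y)) :=
    ((WeakDual.eval_continuous y).tendsto a).comp ha
  have h2 : a y = inner 𝕜 ((InnerProductSpace.toDual 𝕜 H).symm (WeakDual.toStrongDual a)) y := by
    rw [InnerProductSpace.toDual_symm_apply]; rfl
  -- The Riesz map puts `f n` in the conjugate-linear slot, so the limit has to be conjugated.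
  have h3 : Tendsto (fun n => star (inner 𝕜 (f (φ n)) y) - star (a y)) atTop (𝓝 0) := by
    simpa using (h1.star).sub_const (star (a y))
  refine h3.congr fun n => ?_
  rw [inner_sub_right, h2]
  simp only [RCLike.star_def, inner_conj_symm]

/-- A bounded operator is weakly continuous, so the weak limit `g` of a subsequence satisfies `B g =
0`, and `hB` applies to the differences with `g`. The hypothesis `hB`, which recurs below, is the
Weyl criterion: no singular sequence of `B` at `0`. -/
theorem exists_subseq_tendsto_of_proper [TopologicalSpace.SeparableSpace H] {B : H →L[𝕜] H}
    (hB : ∀ (f : ℕ → H) (C : ℝ), (∀ n, ‖f n‖ ≤ C) → WeaklyNull 𝕜 f →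
      Tendsto (fun n => B (f n)) atTop (𝓝 0) → Tendsto f atTop (𝓝 0))
    (f : ℕ → H) (C : ℝ) (hf : ∀ n, ‖f n‖ ≤ C) (h0 : Tendsto (fun n => B (f n)) atTop (𝓝 0)) :
    ∃ (g : H) (φ : ℕ → ℕ), StrictMono φ ∧ Tendsto (fun n => f (φ n)) atTop (𝓝 g) ∧ B g = 0 := by
  obtain ⟨g, φ, hφ, hw⟩ := exists_subseq_weaklyNull (𝕜 := 𝕜) f C hf
  have h0' : Tendsto (fun n => B (f (φ n))) atTop (𝓝 0) := h0.comp hφ.tendsto_atTop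
  have hg : B g = 0 := by
    refine ext_inner_left 𝕜 fun y => ?_
    have h1 := hw.map B y
    have h2 : Tendsto (fun n => inner 𝕜 y (B (f (φ n))) - inner 𝕜 y (B (f (φ n) - g))) atTop
        (𝓝 (inner 𝕜 y (0 : H) - 0)) := (tendsto_const_nhds.inner h0').sub h1
    have h3 : (fun n => inner 𝕜 y (B (f (φ n))) - inner 𝕜 y (B (f (φ n) - g)))
        = fun _ => inner 𝕜 y (B g) := by
      funext n; rw [map_sub, inner_sub_right]; ring
    rw [h3, sub_zero] at h2
    exact tendsto_nhds_unique tendsto_const_nhds h2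
  refine ⟨g, φ, hφ, ?_, hg⟩
  have := hB (fun n => f (φ n) - g) (C + ‖g‖)
    (fun n => (norm_sub_le _ _).trans (by gcongr; exact hf _)) hw
    (by simpa [hg] using h0')
  simpa using this.add_const g

/-- The closed unit ball of the kernel is sequentially compact, so Riesz's theorem applies. -/
theorem finiteDimensional_ker_of_proper [TopologicalSpace.SeparableSpace H] {B : H →L[𝕜] H}
    (hB : ∀ (f : ℕ → H) (C : ℝ), (∀ n, ‖f n‖ ≤ C) → WeaklyNull 𝕜 f →
      Tendsto (fun n => B (f n)) atTop (𝓝 0) → Tendsto f atTop (𝓝 0)) :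
    FiniteDimensional 𝕜 (LinearMap.ker B.toLinearMap) := by
  refine FiniteDimensional.of_isCompact_closedBall 𝕜 (r := 1) one_pos (c := 0) ?_
  refine IsSeqCompact.isCompact fun f hf => ?_
  have hf' : ∀ n, ‖(f n : H)‖ ≤ 1 := fun n => by simpa using hf n
  obtain ⟨g, φ, hφ, hg, hBg⟩ := exists_subseq_tendsto_of_proper hB (fun n => (f n : H)) 1 hf'
    (by
      have : (fun n => B (f n : H)) = fun _ => 0 := funext fun n => (f n).2
      rw [this]; exact tendsto_const_nhds)
  refine ⟨⟨g, hBg⟩, ?_, φ, hφ, ?_⟩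
  · simpa using le_of_tendsto hg.norm (Eventually.of_forall fun n => hf' (φ n))
  · exact tendsto_subtype_rng.2 hg

/-- Otherwise unit vectors orthogonal to the kernel with `B f → 0` would accumulate at a unit vector
lying both in the kernel and in its orthogonal complement. -/
theorem exists_le_norm_of_proper [TopologicalSpace.SeparableSpace H] {B : H →L[𝕜] H}
    (hB : ∀ (f : ℕ → H) (C : ℝ), (∀ n, ‖f n‖ ≤ C) → WeaklyNull 𝕜 f →
      Tendsto (fun n => B (f n)) atTop (𝓝 0) → Tendsto f atTop (𝓝 0)) :
    ∃ c : ℝ, 0 < c ∧ ∀ f ∈ (LinearMap.ker B.toLinearMap)ᗮ, c * ‖f‖ ≤ ‖B f‖ := by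
  by_contra! hcon
  have hex : ∀ n : ℕ, ∃ f ∈ (LinearMap.ker B.toLinearMap)ᗮ, ‖f‖ = 1 ∧ ‖B f‖ < 1 / ((n : ℝ) + 1) := by
    intro n
    obtain ⟨f, hf, h⟩ := hcon (1 / ((n : ℝ) + 1)) (by positivity)
    have hf0 : f ≠ 0 := by rintro rfl; simp at h
    have hn : 0 < ‖f‖ := norm_pos_iff.2 hf0
    refine ⟨((‖f‖⁻¹ : ℝ) : 𝕜) • f, Submodule.smul_mem _ _ hf, ?_, ?_⟩
    · rw [norm_smul]; simp [hn.ne']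
    · rw [map_smul, norm_smul]
      simp only [RCLike.norm_ofReal, abs_inv, abs_norm]
      rw [inv_mul_lt_iff₀ hn]; linarith
  choose f hfN hf1 hfB using hex
  obtain ⟨g, φ, hφ, hg, hBg⟩ := exists_subseq_tendsto_of_proper hB f 1 (fun n => (hf1 n).le)
    (squeeze_zero_norm (fun n => (hfB n).le) tendsto_one_div_add_atTop_nhds_zero_nat)
  have hgN : g ∈ (LinearMap.ker B.toLinearMap)ᗮ :=
    (Submodule.isClosed_orthogonal _).mem_of_tendsto hg (Eventually.of_forall fun n => hfN _)
  have hg0 : g = 0 := by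
    have := Submodule.inner_right_of_mem_orthogonal (u := g) (v := g) hBg hgN
    simpa using this
  have : Tendsto (fun n => ‖f (φ n)‖) atTop (𝓝 ‖g‖) := hg.norm
  simp only [hf1, hg0, norm_zero] at this
  exact one_ne_zero (tendsto_nhds_unique tendsto_const_nhds this)

/-- The bound for `A` gives injectivity and closed range; the bound for the adjoint shows that
nothing is orthogonal to the range. -/
theorem isUnit_of_le_norm {A : H →L[𝕜] H} {c : ℝ} (hc : 0 < c)
    (h : ∀ f, c * ‖f‖ ≤ ‖A f‖) (h' : ∀ f, c * ‖f‖ ≤ ‖adjoint A f‖) : IsUnit A := by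
  have hanti : AntilipschitzWith (Real.toNNReal c⁻¹) A :=
    A.antilipschitz_of_bound fun x => by
      rw [Real.coe_toNNReal _ (by positivity), inv_mul_eq_div, le_div_iff₀ hc, mul_comm]; exact h x
  have hclosed : IsClosed (Set.range A) :=
    hanti.isClosed_range A.uniformContinuous
  rw [ContinuousLinearMap.isUnit_iff_bijective]
  refine ⟨hanti.injective, ?_⟩
  have hperp : (LinearMap.range A.toLinearMap)ᗮ = ⊥ := by
    rw [Submodule.eq_bot_iff]
    intro y hy
    have : adjoint A y = 0 := by
      refine ext_inner_left 𝕜 fun v => ?_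
      rw [adjoint_inner_right, inner_zero_right]
      exact Submodule.inner_right_of_mem_orthogonal (LinearMap.mem_range_self A.toLinearMap v) hy
    have h2 := h' y
    rw [this, norm_zero] at h2
    exact norm_eq_zero.1 (le_antisymm (by nlinarith) (norm_nonneg y))
  have : IsClosed ((LinearMap.range A.toLinearMap : Submodule 𝕜 H) : Set H) := by
    rw [LinearMap.coe_range]; exact hclosed
  have htop : LinearMap.range A.toLinearMap = ⊤ := by
    have h3 := Submodule.topologicalClosure_eq_top_iff.2 hperp
    rwa [IsClosed.submodule_topologicalClosure_eq this] at h3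
  exact LinearMap.range_eq_top.1 htop

/-- Self-adjointness makes the kernel and its complement both invariant. On the first, `B - w` is
`-w`; on the second it is bounded below by `c - ‖w‖`. Pythagoras combines the two. -/
theorem le_norm_sub_smul {B : H →L[𝕜] H} (hsa : IsSelfAdjoint B)
    [(LinearMap.ker B.toLinearMap).HasOrthogonalProjection] {c : ℝ}
    (hB : ∀ f ∈ (LinearMap.ker B.toLinearMap)ᗮ, c * ‖f‖ ≤ ‖B f‖) (w : 𝕜) (f : H) :
    min ‖w‖ (c - ‖w‖) * ‖f‖ ≤ ‖B f - w • f‖ := by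
  set N := LinearMap.ker B.toLinearMap
  set m := min ‖w‖ (c - ‖w‖)
  rcases le_total m 0 with hm | hm
  · exact (mul_nonpos_of_nonpos_of_nonneg hm (norm_nonneg f)).trans (norm_nonneg _)
  obtain ⟨f₁, h₁, f₂, h₂, rfl⟩ := N.exists_add_mem_mem_orthogonal f
  have hB1 : B f₁ = 0 := h₁
  have hperp : B f₂ ∈ Nᗮ := by
    rw [Submodule.mem_orthogonal]
    intro y hy
    have hBy : B y = 0 := hy
    rw [← adjoint_inner_left, hsa.adjoint_eq, hBy, inner_zero_left]
  have e : B (f₁ + f₂) - w • (f₁ + f₂) = (-(w • f₁)) + (B f₂ - w • f₂) := by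
    rw [map_add, hB1, smul_add]; abel
  have o1 : inner 𝕜 f₁ f₂ = 0 := Submodule.inner_right_of_mem_orthogonal h₁ h₂
  have o2 : inner 𝕜 (-(w • f₁)) (B f₂ - w • f₂) = 0 :=
    Submodule.inner_right_of_mem_orthogonal (N.neg_mem (N.smul_mem _ h₁))
      (Nᗮ.sub_mem hperp (Nᗮ.smul_mem _ h₂))
  have p1 := norm_add_sq_eq_norm_sq_add_norm_sq_of_inner_eq_zero _ _ o1
  have p2 := norm_add_sq_eq_norm_sq_add_norm_sq_of_inner_eq_zero _ _ o2
  rw [e]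
  have q1 : m * ‖f₁‖ ≤ ‖-(w • f₁)‖ := by
    rw [norm_neg, norm_smul]; gcongr; exact min_le_left _ _
  have q2 : m * ‖f₂‖ ≤ ‖B f₂ - w • f₂‖ := by
    have := norm_sub_norm_le (B f₂) (w • f₂)
    rw [norm_smul] at this
    have h3 := hB f₂ h₂
    have h4 : m * ‖f₂‖ ≤ (c - ‖w‖) * ‖f₂‖ := by gcongr; exact min_le_right _ _
    linarith
  refine abs_le_of_sq_le_sq' ?_ (norm_nonneg _) |>.2
  have r1 := mul_self_le_mul_self (by positivity) q1
  have r2 := mul_self_le_mul_self (by positivity) q2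
  rw [sq, sq, p2]
  have r3 : m * ‖f₁ + f₂‖ * (m * ‖f₁ + f₂‖)
      = m * ‖f₁‖ * (m * ‖f₁‖) + m * ‖f₂‖ * (m * ‖f₂‖) := by linear_combination m ^ 2 * p1
  linarith

/-- This is the isolation of `0` in the spectrum: a punctured disc of regular points. The adjoint of
`B - w` is `B - w̄`, and the lower bound depends on `‖w‖` only. -/
theorem isUnit_sub_smul_of_proper [TopologicalSpace.SeparableSpace H] {B : H →L[𝕜] H}
    (hsa : IsSelfAdjoint B)
    (hB : ∀ (f : ℕ → H) (C : ℝ), (∀ n, ‖f n‖ ≤ C) → WeaklyNull 𝕜 f →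
      Tendsto (fun n => B (f n)) atTop (𝓝 0) → Tendsto f atTop (𝓝 0)) :
    ∃ c : ℝ, 0 < c ∧ ∀ w : 𝕜, w ≠ 0 → ‖w‖ < c → IsUnit (B - w • (1 : H →L[𝕜] H)) := by
  obtain ⟨c, hc, hle⟩ := exists_le_norm_of_proper hB
  have := finiteDimensional_ker_of_proper hB
  refine ⟨c, hc, fun w hw0 hwc => ?_⟩
  refine isUnit_of_le_norm (c := min ‖w‖ (c - ‖w‖))
    (lt_min (norm_pos_iff.2 hw0) (by linarith)) (fun f => ?_) (fun f => ?_)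
  · simpa using le_norm_sub_smul hsa hle w f
  · have : adjoint (B - w • (1 : H →L[𝕜] H)) = B - (starRingEnd 𝕜 w) • (1 : H →L[𝕜] H) := by
      rw [map_sub, map_smulₛₗ, hsa.adjoint_eq]
      congr 2
      exact (IsSelfAdjoint.one (H →L[𝕜] H)).adjoint_eq
    rw [this]
    simpa using le_norm_sub_smul hsa hle (starRingEnd 𝕜 w) f

end Hilbert

end

/-! ### The form resolvent `J J†` and its top spectral value -/

section

open Filter Topology ContinuousLinearMap

section Hilbert

variable {𝕜 : Type*} [RCLike 𝕜]
  {H : Type*} [NormedAddCommGroup H] [InnerProductSpace 𝕜 H] [CompleteSpace H]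
  {V : Type*} [NormedAddCommGroup V] [InnerProductSpace 𝕜 V] [CompleteSpace V]

theorem isSelfAdjoint_comp_adjoint (J : V →L[𝕜] H) : IsSelfAdjoint (J ∘L adjoint J) := by
  rw [isSelfAdjoint_iff, star_eq_adjoint, adjoint_comp, adjoint_adjoint]

theorem re_inner_comp_adjoint (J : V →L[𝕜] H) (f : H) :
    RCLike.re (inner 𝕜 f ((J ∘L adjoint J) f)) = ‖adjoint J f‖ ^ 2 := by
  rw [comp_apply, ← adjoint_inner_left, inner_self_eq_norm_sq]

theorem norm_comp_adjoint_self (J : V →L[𝕜] H) : ‖J ∘L adjoint J‖ = ‖J‖ * ‖J‖ := by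
  have := norm_adjoint_comp_self (adjoint J)
  rwa [adjoint_adjoint, LinearIsometryEquiv.norm_map] at this

/-- Because `‖J J†‖ = ‖J‖²`, the norm of the resolvent encodes the infimum of the Rayleigh quotient
`‖U‖² / ‖J U‖²`. -/
theorem norm_sq_apply_le (J : V →L[𝕜] H) (U : V) :
    ‖J U‖ ^ 2 ≤ ‖J ∘L adjoint J‖ * ‖U‖ ^ 2 := by
  rw [norm_comp_adjoint_self, ← sq, ← mul_pow]
  gcongr
  exact J.le_opNorm U

/-- Expand the square: the cross term is `⟨f, R f⟩ = ‖J† f‖²`, and `‖R f‖ ≤ ‖R‖`. Near-maximizers of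
`‖J† f‖` are thus approximate eigenvectors. -/
theorem norm_sub_smul_sq_le (J : V →L[𝕜] H) {f : H} (hf : ‖f‖ = 1) :
    ‖(J ∘L adjoint J) f - ((‖J ∘L adjoint J‖ : ℝ) : 𝕜) • f‖ ^ 2
      ≤ 2 * ‖J ∘L adjoint J‖ * (‖J ∘L adjoint J‖ - ‖adjoint J f‖ ^ 2) := by
  set R := J ∘L adjoint J with hR
  rw [@norm_sub_sq 𝕜, inner_smul_right, ← inner_conj_symm, RCLike.re_ofReal_mul, RCLike.conj_re,
    hR, re_inner_comp_adjoint, ← hR, norm_smul, hf, RCLike.norm_ofReal, abs_norm]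
  have h1 : ‖R f‖ ≤ ‖R‖ := by simpa [hf] using R.le_opNorm f
  have h2 : ‖R f‖ ^ 2 ≤ ‖R‖ ^ 2 := by gcongr
  nlinarith

theorem exists_approx_eigenvector (J : V →L[𝕜] H) (hr : 0 < ‖J ∘L adjoint J‖) :
    ∃ f : ℕ → H, (∀ n, ‖f n‖ = 1) ∧
      Tendsto (fun n => (J ∘L adjoint J) (f n) - ((‖J ∘L adjoint J‖ : ℝ) : 𝕜) • f n) atTop (𝓝 0) := by
  set R := J ∘L adjoint J with hR
  have hex : ∀ n : ℕ, ∃ f : H, ‖f‖ = 1 ∧ ‖R‖ - 1 / ((n : ℝ) + 1) ≤ ‖adjoint J f‖ ^ 2 := by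
    intro n
    have hJ : ‖R‖ = ‖adjoint J‖ * ‖adjoint J‖ := by
      rw [hR, norm_comp_adjoint_self, LinearIsometryEquiv.norm_map]
    have hJ0 : 0 < ‖adjoint J‖ := by
      by_contra! h
      have : ‖adjoint J‖ = 0 := le_antisymm h (norm_nonneg _)
      rw [this] at hJ; simp [hJ] at hr
    have hlt : Real.sqrt (max 0 (‖R‖ - 1 / ((n : ℝ) + 1))) < ‖adjoint J‖ := by
      rw [Real.sqrt_lt' hJ0, sq, ← hJ]
      refine max_lt hr (sub_lt_self _ (by positivity))
    obtain ⟨x, hx1, hx⟩ := (adjoint J).exists_lt_apply_of_lt_opNorm hlt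
    have hx0 : x ≠ 0 := by
      rintro rfl
      rw [map_zero, norm_zero] at hx
      exact absurd hx (not_lt.2 (Real.sqrt_nonneg _))
    have hn : 0 < ‖x‖ := norm_pos_iff.2 hx0
    refine ⟨((‖x‖⁻¹ : ℝ) : 𝕜) • x, ?_, ?_⟩
    · rw [norm_smul]; simp [hn.ne']
    · rw [map_smul, norm_smul, RCLike.norm_ofReal, abs_inv, abs_norm]
      have h1 : ‖adjoint J x‖ ≤ ‖x‖⁻¹ * ‖adjoint J x‖ :=
        le_mul_of_one_le_left (norm_nonneg _) ((one_le_inv₀ hn).2 hx1.le)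
      have h2 : Real.sqrt (max 0 (‖R‖ - 1 / ((n : ℝ) + 1))) ^ 2 ≤ (‖x‖⁻¹ * ‖adjoint J x‖) ^ 2 := by
        gcongr; exact hx.le.trans h1
      rw [Real.sq_sqrt (le_max_left _ _)] at h2
      exact (le_max_right _ _).trans h2
  choose f hf1 hf using hex
  refine ⟨f, hf1, ?_⟩
  rw [tendsto_zero_iff_norm_tendsto_zero]
  have hlim : Tendsto (fun n : ℕ => Real.sqrt (2 * ‖R‖ * (1 / ((n : ℝ) + 1)))) atTop (𝓝 0) := by
    have h := (tendsto_one_div_add_atTop_nhds_zero_nat (𝕜 := ℝ)).const_mul (2 * ‖R‖)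
    rw [mul_zero] at h
    have h' := (Real.continuous_sqrt.tendsto 0).comp h
    rwa [Real.sqrt_zero] at h'
  refine squeeze_zero (fun n => norm_nonneg _) (fun n => ?_) hlim
  refine Real.le_sqrt_of_sq_le ((norm_sub_smul_sq_le J (hf1 n)).trans ?_)
  gcongr
  linarith [hf n]

/-- Insert `U = J† f n` into `hle`. Since `R f n` is close to `r f n`, the left side is about `Λ r²
‖f n‖²` and `‖U‖² = ⟨f n, R f n⟩` about `r ‖f n‖²`, while `q` tends to zero because `J† f n` is
again weakly null. So `r (Λ r - 1) ‖f n‖²` tends to zero. In spectral terms, `R` has no essential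
spectrum above `1 / Λ`. -/
theorem tendsto_zero_of_weaklyNull (J : V →L[𝕜] H) {Λ r : ℝ} (hr : 0 < r) (hΛ : 1 < Λ * r)
    (q : V → ℝ)
    (hq : ∀ (U : ℕ → V) (C : ℝ), (∀ n, ‖U n‖ ≤ C) → WeaklyNull 𝕜 U →
      Tendsto (fun n => q (U n)) atTop (𝓝 0))
    (hle : ∀ U, Λ * ‖J U‖ ^ 2 ≤ ‖U‖ ^ 2 + q U)
    (f : ℕ → H) (C : ℝ) (hf : ∀ n, ‖f n‖ ≤ C) (hw : WeaklyNull 𝕜 f)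
    (h0 : Tendsto (fun n => (J ∘L adjoint J - (r : 𝕜) • (1 : H →L[𝕜] H)) (f n)) atTop (𝓝 0)) :
    Tendsto f atTop (𝓝 0) := by
  set R := J ∘L adjoint J with hR
  have hC : 0 ≤ C := (norm_nonneg _).trans (hf 0)
  have hΛ0 : 0 < Λ := by
    by_contra! h
    nlinarith
  have hq0 := hq (fun n => adjoint J (f n)) (‖adjoint J‖ * C)
    (fun n => ((adjoint J).le_opNorm _).trans (by gcongr; exact hf n)) (hw.map _)
  set δ : ℕ → ℝ := fun n => ‖(R - (r : 𝕜) • (1 : H →L[𝕜] H)) (f n)‖ with hδ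
  have hδ0 : Tendsto δ atTop (𝓝 0) := by
    rw [← norm_zero (E := H)]; exact h0.norm
  have hα : 0 < r * (Λ * r - 1) := mul_pos hr (by linarith)
  have hbound : ∀ n, ‖f n‖ ^ 2
      ≤ (r * (Λ * r - 1))⁻¹ * (δ n * C + q (adjoint J (f n)) + 2 * Λ * r * C * δ n) := by
    intro n
    rw [← div_eq_inv_mul, le_div_iff₀ hα]
    have e : R (f n) = (R - (r : 𝕜) • (1 : H →L[𝕜] H)) (f n) + (r : 𝕜) • f n := by simp
    have e0 : J (adjoint J (f n)) = R (f n) := rfl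
    have h1 : ‖adjoint J (f n)‖ ^ 2 ≤ δ n * C + r * ‖f n‖ ^ 2 := by
      rw [← re_inner_comp_adjoint, ← hR, e, inner_add_right, inner_smul_right, map_add,
        RCLike.re_ofReal_mul, inner_self_eq_norm_sq]
      have := (RCLike.re_le_norm _).trans
        (norm_inner_le_norm (𝕜 := 𝕜) (f n) ((R - (r : 𝕜) • (1 : H →L[𝕜] H)) (f n)))
      have h3 : ‖f n‖ * δ n ≤ C * δ n := by gcongr; exact hf n
      simp only [hδ] at h3 ⊢
      linarith
    have h2 : r * ‖f n‖ ≤ ‖R (f n)‖ + δ n := by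
      have h3 : (r : 𝕜) • f n = R (f n) - (R - (r : 𝕜) • (1 : H →L[𝕜] H)) (f n) := by simp
      have h4 : ‖(r : 𝕜) • f n‖ = r * ‖f n‖ := by
        rw [norm_smul, RCLike.norm_ofReal, abs_of_pos hr]
      rw [← h4, h3]
      exact norm_sub_le _ _
    have h5 : r ^ 2 * ‖f n‖ ^ 2 - 2 * r * C * δ n ≤ ‖R (f n)‖ ^ 2 := by
      have hd : 0 ≤ δ n := norm_nonneg _
      -- Squaring `r ‖f n‖ - δ n ≤ ‖R (f n)‖` needs a nonnegative left side. In the other case `r ‖f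
      -- n‖ ≤ δ n`, and the left side of the goal is already nonpositive.
      rcases le_total (δ n) (r * ‖f n‖) with hd1 | hd1
      · have h6 : (r * ‖f n‖ - δ n) ^ 2 ≤ ‖R (f n)‖ ^ 2 :=
          pow_le_pow_left₀ (by linarith) (by linarith) 2
        have h7 : r * ‖f n‖ * δ n ≤ r * C * δ n := by gcongr; exact hf n
        nlinarith
      · have h7 : r * ‖f n‖ * (r * ‖f n‖) ≤ r * C * δ n := by
          gcongr; exact hf n
        have : 0 ≤ r * C * δ n := by positivity
        nlinarith [sq_nonneg ‖R (f n)‖]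
    have h8 := hle (adjoint J (f n))
    rw [e0] at h8
    have h9 := mul_le_mul_of_nonneg_left h5 hΛ0.le
    linarith
  have hlim : Tendsto (fun n => (r * (Λ * r - 1))⁻¹ *
      (δ n * C + q (adjoint J (f n)) + 2 * Λ * r * C * δ n)) atTop (𝓝 0) := by
    have := (((hδ0.mul_const C).add hq0).add (hδ0.const_mul (2 * Λ * r * C))).const_mul
      (r * (Λ * r - 1))⁻¹
    simpa using this
  have hsq : Tendsto (fun n => ‖f n‖ ^ 2) atTop (𝓝 0) :=
    squeeze_zero (fun n => by positivity) hbound hlim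
  rw [tendsto_zero_iff_norm_tendsto_zero]
  have := (Real.continuous_sqrt.tendsto 0).comp hsq
  simpa [Function.comp_def, Real.sqrt_sq (norm_nonneg _)] using this

/-- The absence of singular sequences turns approximate eigenvectors into a genuine one. -/
theorem exists_eigenvector_norm [TopologicalSpace.SeparableSpace H] (J : V →L[𝕜] H)
    (hr : 0 < ‖J ∘L adjoint J‖)
    (hB : ∀ (f : ℕ → H) (C : ℝ), (∀ n, ‖f n‖ ≤ C) → WeaklyNull 𝕜 f →
      Tendsto (fun n => (J ∘L adjoint J - ((‖J ∘L adjoint J‖ : ℝ) : 𝕜) • (1 : H →L[𝕜] H)) (f n))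
        atTop (𝓝 0) → Tendsto f atTop (𝓝 0)) :
    ∃ g : H, ‖g‖ = 1 ∧ (J ∘L adjoint J) g = ((‖J ∘L adjoint J‖ : ℝ) : 𝕜) • g := by
  obtain ⟨f, hf1, hf⟩ := exists_approx_eigenvector J hr
  obtain ⟨g, φ, hφ, hg, hBg⟩ := exists_subseq_tendsto_of_proper hB f 1 (fun n => (hf1 n).le)
    (by simpa using hf)
  refine ⟨g, ?_, ?_⟩
  · have h := hg.norm
    simp only [hf1] at h
    exact tendsto_nhds_unique h tendsto_const_nhds
  · simpa [sub_eq_zero] using hBg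

/-- `J J†`. When `V` is a form domain with the form norm and `J` its inclusion in `H`, this is the
resolvent at `-1` of the operator associated with the form. -/
def formResolvent (J : V →L[𝕜] H) : H →L[𝕜] H := J ∘L adjoint J

theorem norm_formResolvent_pos (J : V →L[𝕜] H) {U : V} (hU : 0 < ‖J U‖ ^ 2) :
    0 < ‖formResolvent J‖ :=
  pos_of_mul_pos_left (hU.trans_le (norm_sq_apply_le J U)) (sq_nonneg _)

/-- The form `‖·‖²` of a compactly embedded space attains its minimum relative to `‖J ·‖²`. -/
theorem exists_minimizer_of_compact [TopologicalSpace.SeparableSpace H] (J : V →L[𝕜] H)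
    (hJ : ∀ (U : ℕ → V) (B : ℝ), (∀ n, ‖U n‖ ≤ B) → WeaklyNull 𝕜 U →
      Tendsto (fun n => ‖J (U n)‖) atTop (𝓝 0)) {U₀ : V} (hU₀ : 0 < ‖J U₀‖ ^ 2) :
    ∃ (r : ℝ) (U : V), 0 < r ∧ ‖J U‖ = 1 ∧
      (∀ W, inner 𝕜 W U = ((r⁻¹ : ℝ) : 𝕜) * inner 𝕜 (J W) (J U)) ∧
      ∀ W, ‖J W‖ ^ 2 ≤ r * ‖W‖ ^ 2 := by
  have hr : 0 < ‖J ∘L adjoint J‖ := norm_formResolvent_pos J hU₀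
  -- For a compact embedding the remainder may be all of `Λ ‖J ·‖²`. The inequality is then trivial
  -- for every `Λ`, and `2 / ‖J J†‖` is one value with `Λ r > 1`.
  have hB := tendsto_zero_of_weaklyNull J hr (Λ := 2 / ‖J ∘L adjoint J‖)
    (by rw [div_mul_cancel₀ _ hr.ne']; norm_num)
    (fun U => 2 / ‖J ∘L adjoint J‖ * ‖J U‖ ^ 2)
    (fun U C hU hw => by
      have := ((hJ U C hU hw).pow 2).const_mul (2 / ‖J ∘L adjoint J‖)
      simpa using this)
    (fun U => le_add_of_nonneg_left (sq_nonneg _))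
  obtain ⟨g, hg1, hg⟩ := exists_eigenvector_norm J hr hB
  have hr' : ((‖J ∘L adjoint J‖ : ℝ) : 𝕜) ≠ 0 := by exact_mod_cast hr.ne'
  -- The minimizer is `J† g`, rescaled so that `J` sends it to the eigenvector `g`.
  have hJU : J (((‖J ∘L adjoint J‖⁻¹ : ℝ) : 𝕜) • adjoint J g) = g := by
    rw [map_smul, ← ContinuousLinearMap.comp_apply, hg, smul_smul, RCLike.ofReal_inv,
      inv_mul_cancel₀ hr', one_smul]
  refine ⟨_, ((‖J ∘L adjoint J‖⁻¹ : ℝ) : 𝕜) • adjoint J g, hr,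
    by rw [hJU, hg1], fun W => ?_, norm_sq_apply_le J⟩
  rw [hJU, inner_smul_right, adjoint_inner_right]

end Hilbert

/-! ### Spectrum of an operator expressed by its resolvent at `-1` -/

section Resolvent

variable {H : Type*} [NormedAddCommGroup H] [NormedSpace ℂ H]

/-- Formally `T = R⁻¹ - 1`, so `T - z = (1 - (z + 1) R) R⁻¹` and the resolvent at `z` is `R (1 - (z
+ 1) R)⁻¹`. Only the graph relation `hT` is used, so no injectivity of `R` is needed. -/
theorem mem_resolventSet_of_isUnit {T : Set (H × H)} {R : H →L[ℂ] H}
    (hT : ∀ u f, (u, f) ∈ T ↔ u = R (u + f)) {z : ℂ} (h : IsUnit (1 - (z + 1) • R)) :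
    z ∈ resolventSet T := by
  obtain ⟨S, hS⟩ := h
  have h1 : ∀ x, (S⁻¹.val : H →L[ℂ] H) (x - (z + 1) • R x) = x := fun x => by
    have := DFunLike.congr_fun S.inv_mul x
    rw [hS] at this; simpa using this
  have h2 : ∀ x, S⁻¹.val x - (z + 1) • R (S⁻¹.val x) = x := fun x => by
    have := DFunLike.congr_fun S.mul_inv x
    rw [hS] at this; simpa using this
  refine ⟨R * S⁻¹.val, fun f => ?_, fun u f huf => ?_⟩
  · rw [hT]
    simp only [ContinuousLinearMap.mul_def, ContinuousLinearMap.comp_apply]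
    congr 1
    linear_combination (norm := module) h2 f
  · rw [hT] at huf
    simp only [ContinuousLinearMap.mul_def, ContinuousLinearMap.comp_apply]
    have e : f - z • u = (u + f) - (z + 1) • R (u + f) := by rw [← huf]; module
    rw [e, h1, ← huf]

/-- By the resolvent identity, in both orders, `1 + (z + 1) Rz` is the inverse. -/
theorem isUnit_of_mem_resolventSet {T : Set (H × H)} {R : H →L[ℂ] H}
    (hT : ∀ u f, (u, f) ∈ T ↔ u = R (u + f)) {z : ℂ} (h : z ∈ resolventSet T) :
    IsUnit (1 - (z + 1) • R) := by
  obtain ⟨Rz, h1, h2⟩ := h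
  have e1 : ∀ x, Rz x = R x + (z + 1) • R (Rz x) := fun x => by
    have := (hT _ _).1 (h1 x)
    rw [map_add, map_add, map_smul] at this
    nth_rw 1 [this]; module
  have e2 : ∀ x, Rz x = R x + (z + 1) • Rz (R x) := fun x => by
    have := h2 (R x) (x - R x) ((hT _ _).2 (by simp))
    rw [map_sub, map_sub, map_smul] at this
    linear_combination (norm := module) this
  refine ⟨⟨1 - (z + 1) • R, 1 + (z + 1) • Rz, ?_, ?_⟩, rfl⟩
  · ext x
    have := e1 x
    simp only [ContinuousLinearMap.mul_def, ContinuousLinearMap.comp_apply, sub_apply, add_apply, one_apply_eq_self, smul_apply,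
      map_add, map_smul]
    linear_combination (norm := module) (z + 1) • this
  · ext x
    have := e2 x
    simp only [ContinuousLinearMap.mul_def, ContinuousLinearMap.comp_apply, sub_apply, add_apply, one_apply_eq_self, smul_apply,
      map_sub, map_smul]
    linear_combination (norm := module) (z + 1) • this

theorem mem_spectrum_iff {T : Set (H × H)} {R : H →L[ℂ] H}
    (hT : ∀ u f, (u, f) ∈ T ↔ u = R (u + f)) {z : ℂ} :
    z ∈ spectrum T ↔ ¬ IsUnit (1 - (z + 1) • R) :=
  not_congr ⟨isUnit_of_mem_resolventSet hT, mem_resolventSet_of_isUnit hT⟩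

theorem isUnit_one_sub_smul_iff {R : H →L[ℂ] H} {w : ℂ} (hw : w ≠ 0) :
    IsUnit (1 - w • R) ↔ IsUnit (R - w⁻¹ • (1 : H →L[ℂ] H)) := by
  have : (1 - w • R) = (Units.mk0 (-w) (neg_ne_zero.2 hw)) • (R - w⁻¹ • (1 : H →L[ℂ] H)) := by
    rw [Units.smul_def, Units.val_mk0, smul_sub, smul_smul, neg_mul, mul_inv_cancel₀ hw]
    module
  rw [this, isUnit_smul_iff]

end Resolvent

/-! ### The bottom of the spectrum and discrete eigenvalues -/

section Spectral

variable {H : Type*} [NormedAddCommGroup H] [InnerProductSpace ℂ H] [CompleteSpace H]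
  {V : Type*} [NormedAddCommGroup V] [InnerProductSpace ℂ V] [CompleteSpace V]

/-- A bounded inverse would send the defects of the approximate eigenvectors, which tend to zero,
back to unit vectors. -/
theorem not_isUnit_sub_norm (J : V →L[ℂ] H) (hr : 0 < ‖formResolvent J‖) :
    ¬ IsUnit (formResolvent J - ((‖formResolvent J‖ : ℝ) : ℂ) • (1 : H →L[ℂ] H)) := by
  rw [formResolvent] at hr ⊢
  obtain ⟨f, hf1, hf⟩ := exists_approx_eigenvector J hr
  rintro ⟨S, hS⟩
  have h1 : ∀ n, f n = S⁻¹.val ((J ∘L adjoint J) (f n) - ((‖J ∘L adjoint J‖ : ℝ) : ℂ) • f n) :=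
    fun n => by
      have := DFunLike.congr_fun S.inv_mul (f n)
      rw [hS] at this; simpa using this.symm
  have h2 : Tendsto f atTop (𝓝 0) := by
    have := ((S⁻¹.val : H →L[ℂ] H).continuous.tendsto 0).comp hf
    rw [map_zero] at this
    exact this.congr fun n => (h1 n).symm
  have h3 := h2.norm
  simp only [hf1, norm_zero] at h3
  exact one_ne_zero (tendsto_nhds_unique tendsto_const_nhds h3)

/-- The spectral value `‖R‖⁻¹ - 1` of the operator whose resolvent at `-1` is `R = J J†`. -/
theorem bottom_mem_spectrum {T : Set (H × H)} (J : V →L[ℂ] H)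
    (hT : ∀ u f, (u, f) ∈ T ↔ u = (formResolvent J) (u + f)) (hr : 0 < ‖formResolvent J‖) :
    ((‖formResolvent J‖⁻¹ - 1 : ℝ) : ℂ) ∈ spectrum T := by
  have hr0 : ((‖formResolvent J‖ : ℝ) : ℂ) ≠ 0 := by exact_mod_cast hr.ne'
  rw [mem_spectrum_iff hT]
  have : ((‖formResolvent J‖⁻¹ - 1 : ℝ) : ℂ) + 1 = ((‖formResolvent J‖ : ℝ) : ℂ)⁻¹ := by
    push_cast; ring
  rw [this, isUnit_one_sub_smul_iff (inv_ne_zero hr0), inv_inv]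
  exact not_isUnit_sub_norm J hr

/-- The resolvent is nonnegative, so `1 - (s + 1) R ≥ 1` in the sense of forms when `s < -1`. -/
theorem spectrum_bddBelow {T : Set (H × H)} (J : V →L[ℂ] H)
    (hT : ∀ u f, (u, f) ∈ T ↔ u = (formResolvent J) (u + f)) :
    BddBelow {s : ℝ | (s : ℂ) ∈ spectrum T} := by
  rw [formResolvent] at hT
  refine ⟨-1, fun s hs => ?_⟩
  by_contra! hlt
  refine (mem_spectrum_iff hT).1 hs ?_
  have hw : s + 1 < 0 := by linarith
  have hsa : adjoint (1 - ((s : ℂ) + 1) • (J ∘L adjoint J)) = 1 - ((s : ℂ) + 1) • (J ∘L adjoint J) := by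
    rw [map_sub, map_smulₛₗ, (isSelfAdjoint_comp_adjoint J).adjoint_eq,
      (IsSelfAdjoint.one (H →L[ℂ] H)).adjoint_eq]
    simp
  have hle : ∀ f, 1 * ‖f‖ ≤ ‖(1 - ((s : ℂ) + 1) • (J ∘L adjoint J)) f‖ := by
    intro f
    rcases eq_or_ne f 0 with rfl | hf
    · simp
    have hn := norm_pos_iff.2 hf
    have h1 := re_inner_comp_adjoint J f
    have h2 : RCLike.re (inner ℂ f ((1 - ((s : ℂ) + 1) • (J ∘L adjoint J)) f))
        = ‖f‖ ^ 2 - (s + 1) * ‖adjoint J f‖ ^ 2 := by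
      rw [← h1, sub_apply, smul_apply, one_apply_eq_self, inner_sub_right, inner_smul_right, map_sub,
        inner_self_eq_norm_sq]
      have : (s : ℂ) + 1 = ((s + 1 : ℝ) : ℂ) := by push_cast; rfl
      rw [this]
      congr 1
      exact RCLike.re_ofReal_mul (K := ℂ) _ _
    have h3 := (RCLike.re_le_norm _).trans
      (norm_inner_le_norm (𝕜 := ℂ) f ((1 - ((s : ℂ) + 1) • (J ∘L adjoint J)) f))
    rw [h2] at h3
    have h4 : 0 ≤ -(s + 1) * ‖adjoint J f‖ ^ 2 := mul_nonneg (by linarith) (by positivity)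
    have h5 : ‖f‖ * ‖f‖ ≤ ‖f‖ * ‖(1 - ((s : ℂ) + 1) • (J ∘L adjoint J)) f‖ := by nlinarith
    simpa using le_of_mul_le_mul_left h5 hn
  exact isUnit_of_le_norm one_pos hle (by rw [hsa]; exact hle)

/-- The trial vector forces `‖R‖ > 1 / (1 + lam)`, so the spectral point `‖R‖⁻¹ - 1` lies below
`lam`. The first conclusion is kept because the discreteness criterion needs it again. -/
theorem exists_isGLB_spectrum_lt {T : Set (H × H)} (J : V →L[ℂ] H)
    (hT : ∀ u f, (u, f) ∈ T ↔ u = (formResolvent J) (u + f)) {lam : ℝ} (hlam : 0 ≤ lam)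
    {U : V} (hU : ‖U‖ ^ 2 < (1 + lam) * ‖J U‖ ^ 2) :
    1 < (1 + lam) * ‖formResolvent J‖ ∧
      ∃ m : ℝ, IsGLB {s : ℝ | (s : ℂ) ∈ spectrum T} m ∧ m < lam := by
  have h1 : ‖J U‖ ^ 2 ≤ ‖formResolvent J‖ * ‖U‖ ^ 2 := norm_sq_apply_le J U
  have hlam' : 0 < 1 + lam := by linarith
  have hJU : 0 < ‖J U‖ ^ 2 := by
    by_contra! h
    nlinarith [sq_nonneg ‖U‖]
  have hr1 : 1 < (1 + lam) * ‖formResolvent J‖ := by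
    by_contra! h
    have h2 : (1 + lam) * ‖J U‖ ^ 2 ≤ (1 + lam) * (‖formResolvent J‖ * ‖U‖ ^ 2) := by gcongr
    have h3 : (1 + lam) * ‖formResolvent J‖ * ‖U‖ ^ 2 ≤ 1 * ‖U‖ ^ 2 := by gcongr
    nlinarith
  have hr : 0 < ‖formResolvent J‖ := by
    by_contra! h
    nlinarith
  refine ⟨hr1, _, isGLB_csInf ⟨_, bottom_mem_spectrum J hT hr⟩ (spectrum_bddBelow J hT), ?_⟩
  refine (csInf_le (spectrum_bddBelow J hT) (bottom_mem_spectrum J hT hr)).trans_lt ?_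
  have : ‖formResolvent J‖⁻¹ < 1 + lam := by
    rw [inv_lt_iff_one_lt_mul₀ hr]; linarith
  linarith

/-- The element is `‖R‖⁻¹ - 1`. The map `z ↦ (z + 1)⁻¹ - ‖R‖` takes a punctured neighbourhood of it
into the punctured disc where `R - ‖R‖ - w` is invertible, and its eigenspace is the
finite-dimensional kernel of `R - ‖R‖`. -/
theorem discreteSpectrum_nonempty [TopologicalSpace.SeparableSpace H] {T : Set (H × H)}
    (J : V →L[ℂ] H) (hT : ∀ u f, (u, f) ∈ T ↔ u = (formResolvent J) (u + f)) {Λ : ℝ}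
    (hr : 0 < ‖formResolvent J‖) (hΛ : 1 < Λ * ‖formResolvent J‖)
    (q : V → ℝ)
    (hq : ∀ (U : ℕ → V) (C : ℝ), (∀ n, ‖U n‖ ≤ C) → WeaklyNull ℂ U →
      Tendsto (fun n => q (U n)) atTop (𝓝 0))
    (hle : ∀ U, Λ * ‖J U‖ ^ 2 ≤ ‖U‖ ^ 2 + q U) :
    (discreteSpectrum T).Nonempty := by
  have hbot := bottom_mem_spectrum J hT hr
  rw [formResolvent] at hT hr hΛ hbot
  have hB := tendsto_zero_of_weaklyNull J hr hΛ q hq hle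
  have hsa : IsSelfAdjoint (J ∘L adjoint J - ((‖J ∘L adjoint J‖ : ℝ) : ℂ) • (1 : H →L[ℂ] H)) :=
    (isSelfAdjoint_comp_adjoint J).sub
      (IsSelfAdjoint.smul (by simp [isSelfAdjoint_iff]) (IsSelfAdjoint.one _))
  obtain ⟨c, hc, hiso⟩ := isUnit_sub_smul_of_proper hsa hB
  obtain ⟨g, hg1, hg⟩ := exists_eigenvector_norm J hr hB
  have hfin := finiteDimensional_ker_of_proper hB
  set R := J ∘L adjoint J with hR
  set r := ‖R‖
  have hr0 : (r : ℂ) ≠ 0 := by exact_mod_cast hr.ne'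
  have hz : ((r⁻¹ - 1 : ℝ) : ℂ) + 1 = (r : ℂ)⁻¹ := by push_cast; ring
  have heig : ∀ u, (u, ((r⁻¹ - 1 : ℝ) : ℂ) • u) ∈ T ↔ R u = (r : ℂ) • u := fun u => by
    have e : u + ((r⁻¹ - 1 : ℝ) : ℂ) • u = (r : ℂ)⁻¹ • u := by rw [← hz]; module
    rw [hT, e, map_smul]
    constructor
    · intro h; nth_rw 2 [h]; rw [smul_smul, mul_inv_cancel₀ hr0, one_smul]
    · intro h; rw [h, smul_smul, inv_mul_cancel₀ hr0, one_smul]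
  refine ⟨((r⁻¹ - 1 : ℝ) : ℂ), hbot, ?_, ⟨g, by rintro rfl; simp at hg1, (heig g).2 hg⟩, ?_⟩
  · have hcont : Tendsto (fun z : ℂ => (z + 1)⁻¹ - r) (𝓝 ((r⁻¹ - 1 : ℝ) : ℂ)) (𝓝 0) := by
      have h1 : ContinuousAt (fun z : ℂ => (z + 1)⁻¹ - r) ((r⁻¹ - 1 : ℝ) : ℂ) := by
        refine ContinuousAt.sub (ContinuousAt.inv₀ (by fun_prop) ?_) continuousAt_const
        rw [hz]; exact inv_ne_zero hr0
      have h2 := h1.tendsto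
      rwa [hz, inv_inv, sub_self] at h2
    have hne : ∀ᶠ z : ℂ in 𝓝 ((r⁻¹ - 1 : ℝ) : ℂ), z + 1 ≠ 0 := by
      refine ContinuousAt.eventually_ne (by fun_prop) ?_
      rw [hz]; exact inv_ne_zero hr0
    have hev := (hcont.eventually (Metric.ball_mem_nhds 0 hc)).and hne
    obtain ⟨ε, hε, hball⟩ := Metric.eventually_nhds_iff.1 hev
    refine ⟨ε, hε, fun w hw hd => ?_⟩
    obtain ⟨h1, h2⟩ := hball hd
    rw [mem_spectrum_iff hT, isUnit_one_sub_smul_iff h2] at hw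
    by_contra hwz
    refine hw ?_
    have h3 := hiso ((w + 1)⁻¹ - r) (fun h => hwz ?_) (by simpa using h1)
    · rw [sub_smul, sub_sub_sub_cancel_right] at h3
      · exact h3
    · have h4 : w + 1 = (r : ℂ)⁻¹ := by rw [← inv_inv (w + 1), sub_eq_zero.1 h]
      rw [← hz] at h4
      exact add_right_cancel h4
  · have hspan : Submodule.span ℂ {u : H | (u, ((r⁻¹ - 1 : ℝ) : ℂ) • u) ∈ T}
        ≤ LinearMap.ker (R - (r : ℂ) • (1 : H →L[ℂ] H)).toLinearMap := by
      rw [Submodule.span_le]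
      intro u hu
      have := (heig u).1 hu
      simp [this]
    exact Submodule.finiteDimensional_of_le hspan

end Spectral

end

/-! ### `L²` estimates and calculus in the Sobolev spaces -/

section

open Filter Topology
open scoped ENNReal

section Lebesgue

variable {α : Type*} [MeasurableSpace α] {μ : Measure α} {𝕜 : Type*} [RCLike 𝕜]

theorem integrable_mul_of_memLp {f g : α → 𝕜} (hf : MemLp f 2 μ) (hg : MemLp g 2 μ) :
    Integrable (fun x => f x * g x) μ :=
  hf.integrable_mul (p := 2) (q := 2) hg

theorem enorm_integral_mul_le {f g : α → 𝕜} (hf : AEStronglyMeasurable f μ)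
    (hg : AEStronglyMeasurable g μ) :
    ‖∫ x, f x * g x ∂μ‖ₑ ≤ eLpNorm f 2 μ * eLpNorm g 2 μ := by
  refine (enorm_integral_le_lintegral_enorm _).trans ?_
  rw [← eLpNorm_one_eq_lintegral_enorm]
  have h : eLpNorm (f • g) 1 μ ≤ eLpNorm f 2 μ * eLpNorm g 2 μ :=
    eLpNorm_smul_le_mul_eLpNorm (p := 2) (q := 2) (r := 1) hg hf
  rw [smul_eq_mul] at h
  exact h

theorem eLpNorm_two_sq {ε : Type*} [ENorm ε] (f : α → ε) :
    eLpNorm f 2 μ ^ 2 = ∫⁻ x, ‖f x‖ₑ ^ 2 ∂μ := by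
  rw [eLpNorm_eq_lintegral_rpow_enorm_toReal two_ne_zero ENNReal.ofNat_ne_top, ← ENNReal.rpow_natCast,
    ← ENNReal.rpow_mul]
  simp

theorem eLpNorm_clm_comp_le {𝕜' : Type*} [RCLike 𝕜'] (L : 𝕜 →L[ℝ] 𝕜') (f : α → 𝕜) :
    eLpNorm (fun x => L (f x)) 2 μ ≤ ‖L‖ₑ * eLpNorm f 2 μ := by
  have := eLpNorm_le_nnreal_smul_eLpNorm_of_ae_le_mul (μ := μ) (f := fun x => L (f x)) (g := f)
    (c := ‖L‖₊) (Eventually.of_forall fun x => by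
      have := L.le_opNorm (f x); exact_mod_cast this) 2
  rwa [ENNReal.smul_def] at this

end Lebesgue

theorem exists_pos_mul_lt_ennreal (C : ℝ≥0∞) (hC : C ≠ ∞) {ε : ℝ≥0∞} (hε : 0 < ε) :
    ∃ δ : ℝ≥0∞, 0 < δ ∧ C * δ < ε := by
  obtain ⟨δ, hδ, h⟩ := ENNReal.exists_nnreal_pos_mul_lt hC hε.ne'
  exact ⟨δ, by exact_mod_cast hδ, by rwa [mul_comm]⟩

section Sobolev

variable {E : Type*} [NormedAddCommGroup E] [NormedSpace ℝ E] [MeasureSpace E]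
  {𝕜 : Type*} [RCLike 𝕜] {𝕜' : Type*} [RCLike 𝕜'] {ι : Type*} {Ω Γ : Set E} {e : ι → E}

theorem IsTestFunction.mono {Ω Ω' : Set E} (h : Ω ⊆ Ω') {φ : E → ℝ} (hφ : IsTestFunction Ω φ) :
    IsTestFunction Ω' φ :=
  ⟨hφ.1, hφ.2, hφ.3.trans h⟩

theorem IsTestFunction.continuous_fderiv_apply {φ : E → ℝ} (hφ : IsTestFunction Ω φ) (v : E) :
    Continuous fun x => fderiv ℝ φ x v :=
  (hφ.contDiff.continuous_fderiv (by simp)).clm_apply continuous_const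

theorem IsTestFunction.hasCompactSupport_fderiv_apply {φ : E → ℝ} (hφ : IsTestFunction Ω φ) (v : E) :
    HasCompactSupport fun x => fderiv ℝ φ x v :=
  hφ.hasCompactSupport.fderiv_apply ℝ v

section Finite

variable [BorelSpace E] [IsFiniteMeasureOnCompacts (volume : Measure E)]
  [SecondCountableTopology E]

theorem memLp_ofReal_of_hasCompactSupport {φ : E → ℝ} (hφ : Continuous φ) (hc : HasCompactSupport φ)
    (μ : Measure E) [IsFiniteMeasureOnCompacts μ] : MemLp (fun x => (φ x : 𝕜)) 2 μ :=
  (hφ.memLp_of_hasCompactSupport hc).ofReal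

theorem IsTestFunction.memLp {φ : E → ℝ} (hφ : IsTestFunction Ω φ) (s : Set E) :
    MemLp (fun x => (φ x : 𝕜)) 2 (volume.restrict s) :=
  memLp_ofReal_of_hasCompactSupport hφ.contDiff.continuous hφ.hasCompactSupport _

theorem IsTestFunction.memLp_fderiv {φ : E → ℝ} (hφ : IsTestFunction Ω φ) (v : E) (s : Set E) :
    MemLp (fun x => (fderiv ℝ φ x v : 𝕜)) 2 (volume.restrict s) :=
  memLp_ofReal_of_hasCompactSupport (hφ.continuous_fderiv_apply v)
    (hφ.hasCompactSupport_fderiv_apply v) _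

/-- The defect of the weak derivative identity depends continuously on the function and on the
derivative. -/
theorem integral_weak_deriv_eq_of_approx {u P : E → 𝕜} {v : E} {φ : E → ℝ}
    (hφ : IsTestFunction Ω φ)
    (hu : MemLp u 2 (volume.restrict Ω)) (hP : MemLp P 2 (volume.restrict Ω))
    (h : ∀ ε : ℝ≥0∞, 0 < ε → ∃ w Q : E → 𝕜, MemLp w 2 (volume.restrict Ω) ∧
      MemLp Q 2 (volume.restrict Ω) ∧
      ∫ x in Ω, (fderiv ℝ φ x v : 𝕜) * w x = - ∫ x in Ω, (φ x : 𝕜) * Q x ∧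
      eLpNorm (u - w) 2 (volume.restrict Ω) < ε ∧ eLpNorm (P - Q) 2 (volume.restrict Ω) < ε) :
    ∫ x in Ω, (fderiv ℝ φ x v : 𝕜) * u x = - ∫ x in Ω, (φ x : 𝕜) * P x := by
  have h1 := hφ.memLp (𝕜 := 𝕜) Ω
  have h2 := hφ.memLp_fderiv (𝕜 := 𝕜) v Ω
  rw [← add_eq_zero_iff_eq_neg, ← enorm_eq_zero, ← nonpos_iff_eq_zero]
  refine le_of_forall_gt fun ε hε => ?_
  set C := eLpNorm (fun x => (fderiv ℝ φ x v : 𝕜)) 2 (volume.restrict Ω)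
    + eLpNorm (fun x => (φ x : 𝕜)) 2 (volume.restrict Ω) with hC
  obtain ⟨δ, hδ, hCδ⟩ := exists_pos_mul_lt_ennreal C
    (ENNReal.add_ne_top.2 ⟨h2.2.ne, h1.2.ne⟩) hε
  obtain ⟨w, Q, hw, hQ, hwQ, hd1, hd2⟩ := h δ hδ
  have e1 : ∫ x in Ω, (fderiv ℝ φ x v : 𝕜) * (u - w) x
      = (∫ x in Ω, (fderiv ℝ φ x v : 𝕜) * u x) - ∫ x in Ω, (fderiv ℝ φ x v : 𝕜) * w x := by
    rw [← integral_sub (integrable_mul_of_memLp h2 hu) (integrable_mul_of_memLp h2 hw)]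
    simp [mul_sub]
  have e2 : ∫ x in Ω, (φ x : 𝕜) * (P - Q) x
      = (∫ x in Ω, (φ x : 𝕜) * P x) - ∫ x in Ω, (φ x : 𝕜) * Q x := by
    rw [← integral_sub (integrable_mul_of_memLp h1 hP) (integrable_mul_of_memLp h1 hQ)]
    simp [mul_sub]
  have e3 : (∫ x in Ω, (fderiv ℝ φ x v : 𝕜) * u x) + ∫ x in Ω, (φ x : 𝕜) * P x
      = (∫ x in Ω, (fderiv ℝ φ x v : 𝕜) * (u - w) x) + ∫ x in Ω, (φ x : 𝕜) * (P - Q) x := by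
    rw [e1, e2, hwQ]; ring
  rw [e3]
  calc _ ≤ _ := enorm_add_le _ _
    _ ≤ _ := add_le_add (enorm_integral_mul_le h2.1 (hu.sub hw).1)
        (enorm_integral_mul_le h1.1 (hP.sub hQ).1)
    _ ≤ eLpNorm (fun x => (fderiv ℝ φ x v : 𝕜)) 2 (volume.restrict Ω) * δ
        + eLpNorm (fun x => (φ x : 𝕜)) 2 (volume.restrict Ω) * δ := by gcongr
    _ = C * δ := by rw [hC, add_mul]
    _ < ε := hCδ

/-- `H¹_0(Ω, Γ)` is closed in `H¹(Ω)`, and already in `L²(Ω)` for the norm of `(u, ∇u)`. -/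
theorem MemSobolevZero.of_approx {u : E → 𝕜} {p : ι → E → 𝕜}
    (hu : MemLp u 2 (volume.restrict Ω)) (hp : ∀ i, MemLp (p i) 2 (volume.restrict Ω))
    (h : ∀ ε : ℝ≥0∞, 0 < ε → ∃ (w : E → 𝕜) (q : ι → E → 𝕜), MemSobolev Ω e w q ∧
      (∃ U : Set E, IsOpen U ∧ Γ ⊆ U ∧ ∀ᵐ x ∂(volume.restrict Ω), x ∈ U → w x = 0) ∧
      eLpNorm (u - w) 2 (volume.restrict Ω) < ε ∧
      ∀ i, eLpNorm (p i - q i) 2 (volume.restrict Ω) < ε) :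
    MemSobolevZero Ω Γ e u p where
  memLp := hu
  grad_memLp := hp
  weak_deriv i φ hφ := integral_weak_deriv_eq_of_approx hφ hu (hp i) fun ε hε => by
    obtain ⟨w, q, hwq, -, h1, h2⟩ := h ε hε
    exact ⟨w, q i, hwq.memLp, hwq.grad_memLp i, hwq.weak_deriv i φ hφ, h1, h2 i⟩
  approx := h

theorem MemSobolevZero.of_approx_zero {u : E → 𝕜} {p : ι → E → 𝕜}
    (hu : MemLp u 2 (volume.restrict Ω)) (hp : ∀ i, MemLp (p i) 2 (volume.restrict Ω))
    (h : ∀ ε : ℝ≥0∞, 0 < ε → ∃ (w : E → 𝕜) (q : ι → E → 𝕜), MemSobolevZero Ω Γ e w q ∧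
      eLpNorm (u - w) 2 (volume.restrict Ω) < ε ∧
      ∀ i, eLpNorm (p i - q i) 2 (volume.restrict Ω) < ε) :
    MemSobolevZero Ω Γ e u p := by
  refine .of_approx hu hp fun ε hε => ?_
  obtain ⟨w, q, hwq, h1, h2⟩ := h (ε / 2) (ENNReal.half_pos hε.ne')
  obtain ⟨w', q', hwq', hU, h1', h2'⟩ := hwq.approx (ε / 2) (ENNReal.half_pos hε.ne')
  refine ⟨w', q', hwq', hU, ?_, fun i => ?_⟩
  · rw [← ENNReal.add_halves ε, ← sub_add_sub_cancel u w w']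
    exact (eLpNorm_add_le (hu.sub hwq.memLp).1 (hwq.memLp.sub hwq'.memLp).1 one_le_two).trans_lt
      (ENNReal.add_lt_add h1 h1')
  · rw [← ENNReal.add_halves ε, ← sub_add_sub_cancel (p i) (q i) (q' i)]
    exact (eLpNorm_add_le ((hp i).sub (hwq.grad_memLp i)).1
      ((hwq.grad_memLp i).sub (hwq'.grad_memLp i)).1 one_le_two).trans_lt
      (ENNReal.add_lt_add (h2 i) (h2' i))

theorem MemSobolev.add {u v : E → 𝕜} {p q : ι → E → 𝕜} (hu : MemSobolev Ω e u p)
    (hv : MemSobolev Ω e v q) : MemSobolev Ω e (u + v) (p + q) where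
  memLp := hu.memLp.add hv.memLp
  grad_memLp i := (hu.grad_memLp i).add (hv.grad_memLp i)
  weak_deriv i φ hφ := by
    have h1 := hφ.memLp (𝕜 := 𝕜) Ω
    have h2 := hφ.memLp_fderiv (𝕜 := 𝕜) (e i) Ω
    simp only [Pi.add_apply, mul_add]
    rw [integral_add (integrable_mul_of_memLp h2 hu.memLp) (integrable_mul_of_memLp h2 hv.memLp),
      integral_add (integrable_mul_of_memLp h1 (hu.grad_memLp i)) (integrable_mul_of_memLp h1 (hv.grad_memLp i)),
      hu.weak_deriv i φ hφ, hv.weak_deriv i φ hφ]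
    ring

theorem MemSobolev.zero : MemSobolev Ω e (0 : E → 𝕜) (0 : ι → E → 𝕜) where
  memLp := MemLp.zero
  grad_memLp _ := MemLp.zero
  weak_deriv i φ hφ := by simp

/-- Real-linear maps of the values act on function and gradient alike. This covers real and
imaginary parts, complexification, and multiplication by a scalar. -/
theorem MemSobolev.map {u : E → 𝕜} {p : ι → E → 𝕜} (hu : MemSobolev Ω e u p) (L : 𝕜 →L[ℝ] 𝕜') :
    MemSobolev Ω e (fun x => L (u x)) (fun i x => L (p i x)) where
  memLp := L.comp_memLp' hu.memLp
  grad_memLp i := L.comp_memLp' (hu.grad_memLp i)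
  weak_deriv i φ hφ := by
    have h1 := integrable_mul_of_memLp (hφ.memLp (𝕜 := 𝕜) Ω) (hu.grad_memLp i)
    have h2 := integrable_mul_of_memLp (hφ.memLp_fderiv (𝕜 := 𝕜) (e i) Ω) hu.memLp
    have hL : ∀ (a : ℝ) (z : 𝕜), (a : 𝕜') * L z = L ((a : 𝕜) * z) := fun a z => by
      rw [← RCLike.real_smul_eq_coe_mul, ← RCLike.real_smul_eq_coe_mul, map_smul]
    simp only [hL]
    rw [L.integral_comp_comm h2, L.integral_comp_comm h1, hu.weak_deriv i φ hφ, map_neg]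

theorem MemSobolevZero.add {u v : E → 𝕜} {p q : ι → E → 𝕜} (hu : MemSobolevZero Ω Γ e u p)
    (hv : MemSobolevZero Ω Γ e v q) : MemSobolevZero Ω Γ e (u + v) (p + q) := by
  refine .of_approx (hu.memLp.add hv.memLp) (fun i => (hu.grad_memLp i).add (hv.grad_memLp i))
    fun ε hε => ?_
  obtain ⟨w, r, hw, ⟨U, hU, hΓ, h0⟩, h1, h2⟩ := hu.approx (ε / 2) (ENNReal.half_pos hε.ne')
  obtain ⟨w', r', hw', ⟨U', hU', hΓ', h0'⟩, h1', h2'⟩ := hv.approx (ε / 2) (ENNReal.half_pos hε.ne')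
  refine ⟨w + w', r + r', hw.add hw', ⟨U ∩ U', hU.inter hU', Set.subset_inter hΓ hΓ', ?_⟩,
    ?_, fun i => ?_⟩
  · filter_upwards [h0, h0'] with x hx hx' hxU
    simp [hx hxU.1, hx' hxU.2]
  · rw [← ENNReal.add_halves ε, add_sub_add_comm]
    exact (eLpNorm_add_le (hu.memLp.sub hw.memLp).1 (hv.memLp.sub hw'.memLp).1
      one_le_two).trans_lt (ENNReal.add_lt_add h1 h1')
  · rw [← ENNReal.add_halves ε, Pi.add_apply, Pi.add_apply, add_sub_add_comm]
    exact (eLpNorm_add_le ((hu.grad_memLp i).sub (hw.grad_memLp i)).1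
      ((hv.grad_memLp i).sub (hw'.grad_memLp i)).1 one_le_two).trans_lt
      (ENNReal.add_lt_add (h2 i) (h2' i))

theorem MemSobolevZero.zero : MemSobolevZero Ω Γ e (0 : E → 𝕜) (0 : ι → E → 𝕜) where
  toMemSobolev := .zero
  approx ε hε := ⟨0, 0, .zero, ⟨Set.univ, isOpen_univ, Set.subset_univ _, by simp⟩, by simpa,
    fun _ => by simpa⟩

theorem MemSobolevZero.map {u : E → 𝕜} {p : ι → E → 𝕜} (hu : MemSobolevZero Ω Γ e u p)
    (L : 𝕜 →L[ℝ] 𝕜') : MemSobolevZero Ω Γ e (fun x => L (u x)) (fun i x => L (p i x)) where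
  toMemSobolev := hu.toMemSobolev.map L
  approx ε hε := by
    obtain ⟨δ, hδ, hlt⟩ := exists_pos_mul_lt_ennreal ‖L‖ₑ enorm_ne_top hε
    obtain ⟨w, q, hw, ⟨U, hU, hΓ, h0⟩, h1, h2⟩ := hu.approx δ hδ
    refine ⟨_, _, hw.map L, ⟨U, hU, hΓ, ?_⟩, ?_, fun i => ?_⟩
    · filter_upwards [h0] with x hx hxU
      rw [hx hxU, map_zero]
    · have : (fun x => L (u x)) - (fun x => L (w x)) = fun x => L ((u - w) x) := by
        ext x; simp
      rw [this]
      exact ((eLpNorm_clm_comp_le L _).trans (by gcongr)).trans_lt hlt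
    · have : (fun x => L (p i x)) - (fun x => L (q i x)) = fun x => L ((p i - q i) x) := by
        ext x; simp
      rw [this]
      refine ((eLpNorm_clm_comp_le L _).trans ?_).trans_lt hlt
      gcongr
      exact (h2 i).le

theorem MemSobolevZero.const_smul {u : E → 𝕜} {p : ι → E → 𝕜} (hu : MemSobolevZero Ω Γ e u p)
    (c : 𝕜) : MemSobolevZero Ω Γ e (c • u) (c • p) :=
  hu.map ((c • ContinuousLinearMap.id 𝕜 𝕜).restrictScalars ℝ)

theorem MemSobolev.congr_ae {u v : E → 𝕜} {p q : ι → E → 𝕜} (hu : MemSobolev Ω e u p)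
    (h : u =ᵐ[volume.restrict Ω] v) (h' : ∀ i, p i =ᵐ[volume.restrict Ω] q i) :
    MemSobolev Ω e v q where
  memLp := hu.memLp.ae_eq h
  grad_memLp i := (hu.grad_memLp i).ae_eq (h' i)
  weak_deriv i φ hφ := by
    have h1 : ∫ x in Ω, (fderiv ℝ φ x (e i) : 𝕜) * u x = ∫ x in Ω, (fderiv ℝ φ x (e i) : 𝕜) * v x :=
      integral_congr_ae (by filter_upwards [h] with x hx; rw [hx])
    have h2 : ∫ x in Ω, (φ x : 𝕜) * p i x = ∫ x in Ω, (φ x : 𝕜) * q i x :=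
      integral_congr_ae (by filter_upwards [h' i] with x hx; rw [hx])
    rw [← h1, ← h2, hu.weak_deriv i φ hφ]

theorem MemSobolevZero.congr_ae {u v : E → 𝕜} {p q : ι → E → 𝕜} (hu : MemSobolevZero Ω Γ e u p)
    (h : u =ᵐ[volume.restrict Ω] v) (h' : ∀ i, p i =ᵐ[volume.restrict Ω] q i) :
    MemSobolevZero Ω Γ e v q where
  toMemSobolev := hu.toMemSobolev.congr_ae h h'
  approx ε hε := by
    obtain ⟨w, r, hw, hU, h1, h2⟩ := hu.approx ε hε
    refine ⟨w, r, hw, hU, ?_, fun i => ?_⟩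
    · rwa [← eLpNorm_congr_ae (h.sub (ae_eq_refl w))]
    · rw [← eLpNorm_congr_ae ((h' i).sub (ae_eq_refl (r i)))]; exact h2 i

/-- Multiplication by a smooth function which, with its derivatives, is bounded on `Ω`. -/
theorem MemSobolev.smooth_mul {u : E → ℝ} {p : ι → E → ℝ} (hu : MemSobolev Ω e u p)
    (hΩ : MeasurableSet Ω)
    {g : E → ℝ} (hg : ContDiff ℝ (⊤ : ℕ∞) g) {C : ℝ} (hC : ∀ x ∈ Ω, ‖g x‖ ≤ C)
    (hC' : ∀ i, ∀ x ∈ Ω, ‖fderiv ℝ g x (e i)‖ ≤ C) :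
    MemSobolev Ω e (fun x => g x * u x) (fun i x => g x * p i x + fderiv ℝ g x (e i) * u x) := by
  have hgm : ∀ i, Continuous fun x => fderiv ℝ g x (e i) := fun i =>
    (hg.continuous_fderiv (by simp)).clm_apply continuous_const
  have hbd : ∀ i, MemLp (fun x => fderiv ℝ g x (e i) * u x) 2 (volume.restrict Ω) := fun i =>
    hu.memLp.of_le_mul (c := C) ((hgm i).aestronglyMeasurable.mul hu.memLp.1)
      ((ae_restrict_iff' hΩ).2 (Eventually.of_forall fun x hx => by
        rw [norm_mul]; gcongr; exact hC' i x hx))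
  have hgd : ∀ v : E → ℝ, MemLp v 2 (volume.restrict Ω) →
      MemLp (fun x => g x * v x) 2 (volume.restrict Ω) := fun v hv =>
    hv.of_le_mul (c := C) (hg.continuous.aestronglyMeasurable.mul hv.1)
      ((ae_restrict_iff' hΩ).2 (Eventually.of_forall fun x hx => by
        rw [norm_mul]; gcongr; exact hC x hx))
  refine ⟨hgd u hu.memLp, fun i => (hgd _ (hu.grad_memLp i)).add (hbd i), fun i φ hφ => ?_⟩
  -- The Leibniz rule follows by testing the weak derivative of `u` with `φ g`.
  have ht : IsTestFunction Ω fun x => φ x * g x :=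
    ⟨hφ.contDiff.mul hg, hφ.hasCompactSupport.mul_right,
      (closure_mono (Function.support_mul_subset_left _ _)).trans hφ.tsupport_subset⟩
  have hd : ∀ x, fderiv ℝ (fun x => φ x * g x) x (e i)
      = φ x * fderiv ℝ g x (e i) + g x * fderiv ℝ φ x (e i) := fun x => by
    rw [fderiv_fun_mul (hφ.contDiff.differentiable (by simp) x) (hg.differentiable (by simp) x)]
    simp
  have hw := hu.weak_deriv i _ ht
  have m1 := integrable_mul_of_memLp (hφ.memLp (𝕜 := ℝ) Ω) (hbd i)
  have m2 := integrable_mul_of_memLp (hφ.memLp_fderiv (𝕜 := ℝ) (e i) Ω) (hgd u hu.memLp)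
  have m3 := integrable_mul_of_memLp (hφ.memLp (𝕜 := ℝ) Ω) (hgd _ (hu.grad_memLp i))
  simp only [RCLike.ofReal_real_eq_id, id_eq] at hw m1 m2 m3 ⊢
  have e1 : ∫ x in Ω, fderiv ℝ (fun x => φ x * g x) x (e i) * u x
      = (∫ x in Ω, φ x * (fderiv ℝ g x (e i) * u x)) + ∫ x in Ω, fderiv ℝ φ x (e i) * (g x * u x) := by
    rw [← integral_add m1 m2]
    refine integral_congr_ae (Eventually.of_forall fun x => ?_)
    simp only [hd]; ring
  have e2 : ∫ x in Ω, φ x * (g x * p i x + fderiv ℝ g x (e i) * u x)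
      = (∫ x in Ω, φ x * (g x * p i x)) + ∫ x in Ω, φ x * (fderiv ℝ g x (e i) * u x) := by
    rw [← integral_add m3 m1]
    simp only [mul_add]
  have e3 : ∫ x in Ω, φ x * g x * p i x = ∫ x in Ω, φ x * (g x * p i x) := by
    simp only [mul_assoc]
  rw [e1, e3] at hw
  rw [e2]
  linarith

theorem MemSobolevZero.smooth_mul {u : E → ℝ} {p : ι → E → ℝ} (hu : MemSobolevZero Ω Γ e u p)
    (hΩ : MeasurableSet Ω)
    {g : E → ℝ} (hg : ContDiff ℝ (⊤ : ℕ∞) g) {C : ℝ} (hC : ∀ x ∈ Ω, ‖g x‖ ≤ C)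
    (hC' : ∀ i, ∀ x ∈ Ω, ‖fderiv ℝ g x (e i)‖ ≤ C) :
    MemSobolevZero Ω Γ e (fun x => g x * u x)
      (fun i x => g x * p i x + fderiv ℝ g x (e i) * u x) where
  toMemSobolev := hu.toMemSobolev.smooth_mul hΩ hg hC hC'
  approx ε hε := by
    obtain ⟨δ, hδ, hlt⟩ := exists_pos_mul_lt_ennreal (ENNReal.ofReal C + ENNReal.ofReal C)
      (ENNReal.add_ne_top.2 ⟨ENNReal.ofReal_ne_top, ENNReal.ofReal_ne_top⟩) hε
    obtain ⟨w, q, hw, ⟨U, hU, hΓ, h0⟩, h1, h2⟩ := hu.approx δ hδ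
    have hgm : ∀ i, Continuous fun x => fderiv ℝ g x (e i) := fun i =>
      (hg.continuous_fderiv (by simp)).clm_apply continuous_const
    have hb : ∀ (a v : E → ℝ), (∀ x ∈ Ω, ‖a x‖ ≤ C) →
        eLpNorm (fun x => a x * v x) 2 (volume.restrict Ω)
          ≤ ENNReal.ofReal C * eLpNorm v 2 (volume.restrict Ω) := fun a v ha =>
      eLpNorm_le_mul_eLpNorm_of_ae_le_mul ((ae_restrict_iff' hΩ).2
        (Eventually.of_forall fun x hx => by
          rw [norm_mul]; gcongr; exact ha x hx)) 2
    refine ⟨_, _, hw.smooth_mul hΩ hg hC hC', ⟨U, hU, hΓ, ?_⟩, ?_, fun i => ?_⟩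
    · filter_upwards [h0] with x hx hxU
      rw [hx hxU, mul_zero]
    · have : (fun x => g x * u x) - (fun x => g x * w x) = fun x => g x * (u - w) x := by
        ext x; simp [mul_sub]
      rw [this]
      refine ((hb _ _ hC).trans ?_).trans_lt hlt
      rw [add_mul]
      exact (mul_le_mul_right h1.le _).trans le_self_add
    · have : (fun x => g x * p i x + fderiv ℝ g x (e i) * u x)
          - (fun x => g x * q i x + fderiv ℝ g x (e i) * w x)
          = (fun x => g x * (p i - q i) x) + fun x => fderiv ℝ g x (e i) * (u - w) x := by
        ext x; simp; ring
      rw [this]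
      refine (eLpNorm_add_le (hg.continuous.aestronglyMeasurable.mul
        ((hu.grad_memLp i).sub (hw.grad_memLp i)).1)
        ((hgm i).aestronglyMeasurable.mul (hu.memLp.sub hw.memLp).1) one_le_two).trans_lt
        (lt_of_le_of_lt ?_ hlt)
      rw [add_mul]
      exact add_le_add ((hb _ _ hC).trans (mul_le_mul_right (h2 i).le _))
        ((hb _ _ (hC' i)).trans (mul_le_mul_right h1.le _))

end Finite

end Sobolev

end

/-! ### Translation estimate for weakly differentiable functions -/

section

open Filter Topology
open scoped ENNReal Convolution

section Translation

variable {E : Type*} [NormedAddCommGroup E] [NormedSpace ℝ E] [FiniteDimensional ℝ E]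
  [MeasureSpace E] [BorelSpace E] [(volume : Measure E).IsAddHaarMeasure]
  {Ω A : Set E}

theorem IsTestFunction.add {φ χ : E → ℝ} (hφ : IsTestFunction A φ) (hχ : IsTestFunction A χ) :
    IsTestFunction A (φ + χ) :=
  ⟨hφ.1.add hχ.1, hφ.2.add hχ.2,
    (tsupport_add φ χ).trans (Set.union_subset hφ.3 hχ.3)⟩

theorem IsTestFunction.const_smul {φ : E → ℝ} (hφ : IsTestFunction A φ) (c : ℝ) :
    IsTestFunction A (c • φ) :=
  ⟨hφ.1.const_smul c, hφ.2.smul_left (f := fun _ => c),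
    (closure_mono (Function.support_const_smul_subset c φ)).trans hφ.3⟩

theorem IsTestFunction.zero : IsTestFunction A (0 : E → ℝ) :=
  ⟨contDiff_const, HasCompactSupport.zero, by simp [tsupport]⟩

/-- The classes of the test functions in `L²(A)`. -/
def testSubmodule (A : Set E) : Submodule ℝ (Lp ℝ 2 ((volume : Measure E).restrict A)) where
  carrier := {f | ∃ φ, IsTestFunction A φ ∧ f =ᵐ[volume.restrict A] φ}
  zero_mem' := ⟨0, .zero, Lp.coeFn_zero _ _ _⟩
  add_mem' := by
    rintro f g ⟨φ, hφ, hf⟩ ⟨χ, hχ, hg⟩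
    exact ⟨φ + χ, hφ.add hχ, (Lp.coeFn_add f g).trans (hf.add hg)⟩
  smul_mem' := by
    rintro c f ⟨φ, hφ, hf⟩
    exact ⟨c • φ, hφ.const_smul c, (Lp.coeFn_smul c f).trans (hf.const_smul c)⟩

theorem real_inner_eq_integral {α : Type*} [MeasurableSpace α] {μ : Measure α} (f g : Lp ℝ 2 μ) :
    inner ℝ f g = ∫ x, f x * g x ∂μ := by
  rw [L2.inner_def]
  refine integral_congr_ae (Eventually.of_forall fun x => ?_)
  simp [mul_comm]

theorem dense_testSubmodule (hA : IsOpen A) : (testSubmodule A).topologicalClosure = ⊤ := by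
  rw [Submodule.topologicalClosure_eq_top_iff, Submodule.eq_bot_iff]
  intro g hg
  have h0 : ∀ᵐ x ∂(volume.restrict A), x ∈ A → g x = 0 := by
    refine hA.ae_eq_zero_of_integral_contDiff_smul_eq_zero
      (((Lp.memLp g).locallyIntegrable one_le_two).locallyIntegrableOn A) fun φ h1 h2 h3 => ?_
    have hφ : IsTestFunction A φ := ⟨h1, h2, h3⟩
    have hm : MemLp φ 2 (volume.restrict A) := hφ.memLp (𝕜 := ℝ) A
    have := Submodule.inner_right_of_mem_orthogonal (K := testSubmodule A)
      (u := hm.toLp φ) ⟨φ, hφ, hm.coeFn_toLp⟩ hg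
    rw [real_inner_eq_integral] at this
    rw [← this]
    refine integral_congr_ae ?_
    filter_upwards [hm.coeFn_toLp] with x hx
    rw [hx, smul_eq_mul]
  rw [Lp.eq_zero_iff_ae_eq_zero]
  filter_upwards [h0, ae_restrict_mem hA.measurableSet] with x hx hxA using hx hxA

/-- The bound is a closed condition on the function paired with `v`, so by density of the test
functions it holds for `v` itself, where it reads `‖v‖² ≤ ‖v‖ C`. -/
theorem eLpNorm_le_of_test {v : E → ℝ} (hA : IsOpen A) (hv : MemLp v 2 (volume.restrict A))
    {C : ℝ} (hC : 0 ≤ C)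
    (h : ∀ φ, IsTestFunction A φ →
      ‖∫ x in A, φ x * v x‖ ≤ (eLpNorm φ 2 (volume.restrict A)).toReal * C) :
    eLpNorm v 2 (volume.restrict A) ≤ ENNReal.ofReal C := by
  have hcl : IsClosed {f : Lp ℝ 2 (volume.restrict A) | ‖inner ℝ f (hv.toLp v)‖ ≤ ‖f‖ * C} :=
    isClosed_le (by fun_prop) (by fun_prop)
  have hsub : ((testSubmodule A : Set (Lp ℝ 2 (volume.restrict A))))
      ⊆ {f | ‖inner ℝ f (hv.toLp v)‖ ≤ ‖f‖ * C} := by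
    rintro f ⟨φ, hφ, hf⟩
    have h1 := h φ hφ
    rw [← eLpNorm_congr_ae hf, ← Lp.norm_def] at h1
    rw [Set.mem_ofPred_eq, real_inner_eq_integral]
    convert h1 using 2
    refine integral_congr_ae ?_
    filter_upwards [hf, hv.coeFn_toLp] with x hx hx'
    rw [hx, hx']
  have hmem : hv.toLp v ∈ (testSubmodule A).topologicalClosure := by
    rw [dense_testSubmodule hA]; trivial
  have h2 : ‖inner ℝ (hv.toLp v) (hv.toLp v)‖ ≤ ‖hv.toLp v‖ * C :=
    hcl.closure_subset_iff.2 hsub hmem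
  rw [real_inner_self_eq_norm_mul_norm, norm_mul, norm_norm] at h2
  have h3 : ‖hv.toLp v‖ ≤ C := by
    rcases (norm_nonneg (hv.toLp v)).eq_or_lt with h0 | h0
    · rw [← h0]; exact hC
    · exact le_of_mul_le_mul_left h2 h0
  rw [Lp.norm_toLp] at h3
  exact (ENNReal.le_ofReal_iff_toReal_le hv.2.ne hC).2 h3

theorem IsTestFunction.comp_sub {φ : E → ℝ} (hφ : IsTestFunction A φ) (h : E)
    (hsub : ∀ x ∈ A, x + h ∈ Ω) : IsTestFunction Ω fun x => φ (x - h) where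
  contDiff := hφ.contDiff.comp (contDiff_id.sub contDiff_const)
  hasCompactSupport := hφ.hasCompactSupport.comp_homeomorph (Homeomorph.subRight h)
  tsupport_subset := by
    have : tsupport (fun x => φ (x - h)) = (fun x => x - h) ⁻¹' tsupport φ :=
      tsupport_comp_eq_preimage φ (Homeomorph.subRight h)
    rw [this]
    intro x hx
    simpa using hsub _ (hφ.tsupport_subset hx)

/-- By duality, it suffices to pair with a test function `φ` on `A`. With `ũ` the extension of `u`
by zero, `F s = ∫ ũ φ(· - s h)` is differentiable, and `F 1 - F 0` is the pairing of `φ` with `u(· +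
h) - u`. Each `φ(· - s h)` is a test function on `Ω` because `A + s h ⊆ Ω`, so `F' s = ∫ φ(· - s h)
P`, which Cauchy–Schwarz bounds. The jump of `ũ` across the boundary is never seen. -/
theorem eLpNorm_translate_sub_le {u P : E → ℝ} {h : E} (hΩ : IsOpen Ω) (hA : IsOpen A)
    (hseg : ∀ x ∈ A, ∀ s ∈ Set.Icc (0 : ℝ) 1, x + s • h ∈ Ω)
    (hu : MemLp u 2 (volume.restrict Ω)) (hP : MemLp P 2 (volume.restrict Ω))
    (hw : ∀ φ, IsTestFunction Ω φ →
      ∫ x in Ω, fderiv ℝ φ x h * u x = - ∫ x in Ω, φ x * P x) :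
    eLpNorm (fun x => u (x + h) - u x) 2 (volume.restrict A)
      ≤ eLpNorm P 2 (volume.restrict Ω) := by
  have hAΩ : A ⊆ Ω := fun x hx => by simpa using hseg x hx 0 (by simp)
  have hAhΩ : ∀ x ∈ A, x + h ∈ Ω := fun x hx => by simpa using hseg x hx 1 (by simp)
  set ũ := Ω.indicator u with hũ
  have hũm : MemLp ũ 2 volume := (memLp_indicator_iff_restrict hΩ.measurableSet).2 hu
  have hũt : MemLp (fun x => ũ (x + h)) 2 volume :=
    hũm.comp_measurePreserving (measurePreserving_add_right volume h)
  have heq : ∀ x ∈ A, u (x + h) - u x = ũ (x + h) - ũ x := fun x hx => by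
    rw [hũ, Set.indicator_of_mem (hAΩ hx), Set.indicator_of_mem (hAhΩ x hx)]
  rw [eLpNorm_congr_ae (g := fun x => ũ (x + h) - ũ x)
    ((ae_restrict_iff' hA.measurableSet).2 (Eventually.of_forall heq))]
  rw [← ENNReal.ofReal_toReal hP.2.ne]
  refine eLpNorm_le_of_test hA ((hũt.sub hũm).restrict A) ENNReal.toReal_nonneg fun φ hφ => ?_
  have hφsupp : Function.support φ ⊆ A := (subset_tsupport φ).trans hφ.tsupport_subset
  have hφm : MemLp φ 2 volume := memLp_ofReal_of_hasCompactSupport (𝕜 := ℝ)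
    hφ.contDiff.continuous hφ.hasCompactSupport volume
  rw [eLpNorm_restrict_eq_of_support_subset hφsupp]
  -- Reflecting `φ` turns the pairing with its translates into a convolution, whose
  -- differentiability is known.
  set φ' : E → ℝ := fun x => φ (-x) with hφ'
  have hφ'c : HasCompactSupport φ' := hφ.hasCompactSupport.comp_homeomorph (Homeomorph.neg E)
  have hφ'd : ContDiff ℝ (⊤ : ℕ∞) φ' := hφ.contDiff.comp contDiff_neg
  set F : ℝ → ℝ := fun s => (ũ ⋆[ContinuousLinearMap.mul ℝ ℝ, volume] φ') (s • h) with hF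
  set F' : ℝ → ℝ := fun s => (ũ ⋆[ContinuousLinearMap.mul ℝ ℝ, volume]
    fun x => fderiv ℝ φ' x h) (s • h) with hF'
  have hloc : LocallyIntegrable ũ volume := hũm.locallyIntegrable one_le_two
  have hderiv : ∀ s, HasDerivAt F (F' s) s := fun s => by
    have h1 := hφ'c.hasFDerivAt_convolution_right (ContinuousLinearMap.mul ℝ ℝ) hloc
      (hφ'd.of_le (by simp)) (s • h)
    have h2 : HasDerivAt (fun s : ℝ => s • h) h s := by
      simpa using (hasDerivAt_id s).smul_const h
    have h3 := h1.comp_hasDerivAt s h2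
    rw [convolution_precompR_apply _ hloc (hφ'c.fderiv ℝ)
      (hφ'd.continuous_fderiv (by simp))] at h3
    exact h3
  have hFval : ∀ s, F s = ∫ x, ũ x * φ (x - s • h) := fun s => by
    simp [hF, convolution_def, hφ']
  have hF'val : ∀ s, F' s = - ∫ x, ũ x * fderiv ℝ (fun x => φ (x - s • h)) x h := fun s => by
    simp only [hF', convolution_def, ContinuousLinearMap.mul_apply']
    rw [← integral_neg]
    refine integral_congr_ae (Eventually.of_forall fun x => ?_)
    have d : ∀ y, HasFDerivAt φ (fderiv ℝ φ y) y := fun y =>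
      (hφ.contDiff.differentiable (by simp) y).hasFDerivAt
    have d1 : HasFDerivAt φ' _ (s • h - x) :=
      (d (-(s • h - x))).comp (s • h - x) (hasFDerivAt_id (s • h - x)).neg
    have d2 : HasFDerivAt (fun x => φ (x - s • h)) _ x :=
      (d (x - s • h)).comp x ((hasFDerivAt_id x).sub_const (s • h))
    simp only [d1.fderiv, d2.fderiv]
    simp
  have hbound : ∀ s ∈ Set.Ico (0 : ℝ) 1,
      ‖F' s‖ ≤ (eLpNorm φ 2 volume).toReal * (eLpNorm P 2 (volume.restrict Ω)).toReal := by
    intro s hs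
    have ht := hφ.comp_sub (s • h) fun x hx => hseg x hx s ⟨hs.1, hs.2.le⟩
    have e1 : ∫ x, ũ x * fderiv ℝ (fun x => φ (x - s • h)) x h
        = ∫ x in Ω, fderiv ℝ (fun x => φ (x - s • h)) x h * u x := by
      rw [← integral_indicator hΩ.measurableSet]
      refine integral_congr_ae (Eventually.of_forall fun x => ?_)
      by_cases hx : x ∈ Ω <;> simp [hũ, hx, mul_comm]
    have hle := enorm_integral_mul_le (𝕜 := ℝ) (ht.memLp (𝕜 := ℝ) Ω).1 hP.1
    have hn : eLpNorm (fun x => φ (x - s • h)) 2 (volume.restrict Ω) ≤ eLpNorm φ 2 volume :=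
      (eLpNorm_mono_measure _ Measure.restrict_le_self).trans
        (eLpNorm_comp_measurePreserving hφm.1 (measurePreserving_sub_right volume (s • h))).le
    rw [hF'val, e1, hw _ ht, neg_neg, ← toReal_enorm, ← ENNReal.toReal_mul]
    exact ENNReal.toReal_mono (ENNReal.mul_ne_top hφm.2.ne hP.2.ne)
      (hle.trans (mul_le_mul_left hn _))
  have hmain := norm_image_sub_le_of_norm_deriv_le_segment_01'
    (fun s _ => (hderiv s).hasDerivWithinAt) hbound
  refine (le_of_eq ?_).trans hmain
  congr 1
  rw [hFval, hFval]
  have i1 : Integrable fun x => ũ x * φ (x - (1 : ℝ) • h) :=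
    integrable_mul_of_memLp hũm
      (hφm.comp_measurePreserving (measurePreserving_sub_right volume ((1 : ℝ) • h)))
  have e2 : ∫ x, ũ x * φ (x - (1 : ℝ) • h) = ∫ x, φ x * ũ (x + h) := by
    rw [← integral_add_right_eq_self _ h]
    simp [mul_comm]
  have e3 : ∫ x in A, φ x * (ũ (x + h) - ũ x) = ∫ x, φ x * (ũ (x + h) - ũ x) :=
    setIntegral_eq_integral_of_forall_compl_eq_zero fun x hx => by
      rw [Function.notMem_support.1 fun hx' => hx (hφsupp hx'), zero_mul]
  have e4 : ∫ x, ũ x * φ (x - (0 : ℝ) • h) = ∫ x, φ x * ũ x := by simp [mul_comm]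
  change ∫ x in A, φ x * (ũ (x + h) - ũ x) = _
  rw [e2, e3, e4, ← integral_sub (integrable_mul_of_memLp hφm hũt)
    (integrable_mul_of_memLp hφm hũm)]
  simp only [mul_sub]

end Translation

end

/-! ### Compactness from averages over small cones -/

section

open Filter Topology
open scoped ENNReal Pointwise

section Compactness

variable {E : Type*} [NormedAddCommGroup E] [NormedSpace ℝ E] [FiniteDimensional ℝ E]
  [MeasureSpace E] [BorelSpace E] [(volume : Measure E).IsAddHaarMeasure]
  {Ω A S : Set E}

/-- The difference between a function and its averages over small translations is controlled by
the translates themselves. -/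
theorem eLpNorm_sub_average_le {u : E → ℝ} (hum : Measurable u) (A : Set E)
    (ν : Measure E) [IsProbabilityMeasure ν] {t : ℝ}
    (hint : ∀ᵐ x ∂(volume.restrict A), Integrable (fun h => u (x + t • h)) ν) {D : ℝ≥0∞}
    (hD : ∀ᵐ h ∂ν, eLpNorm (fun x => u (x + t • h) - u x) 2 (volume.restrict A) ≤ D) :
    eLpNorm (fun x => u x - ∫ h, u (x + t • h) ∂ν) 2 (volume.restrict A) ≤ D := by
  have hm : Measurable fun z : E × E => u (z.1 + t • z.2) - u z.1 :=
    (hum.comp (by fun_prop)).sub (hum.comp measurable_fst)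
  have hsq : eLpNorm (fun x => u x - ∫ h, u (x + t • h) ∂ν) 2 (volume.restrict A) ^ 2 ≤ D ^ 2 := by
    rw [eLpNorm_two_sq]
    -- The inner step is Jensen's inequality for the probability measure `ν`; Tonelli then brings
    -- the integral over `A` inside.
    calc ∫⁻ x in A, ‖u x - ∫ h, u (x + t • h) ∂ν‖ₑ ^ 2
        ≤ ∫⁻ x in A, ∫⁻ h, ‖u (x + t • h) - u x‖ₑ ^ 2 ∂ν := by
          refine lintegral_mono_ae ?_
          filter_upwards [hint] with x hx
          have e : u x - ∫ h, u (x + t • h) ∂ν = - ∫ h, (u (x + t • h) - u x) ∂ν := by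
            rw [integral_sub hx (integrable_const _)]; simp
          rw [e, enorm_neg, ← eLpNorm_two_sq]
          gcongr
          refine (enorm_integral_le_lintegral_enorm _).trans ?_
          rw [← eLpNorm_one_eq_lintegral_enorm]
          exact eLpNorm_le_eLpNorm_of_exponent_le one_le_two
            (hx.sub (integrable_const _)).aestronglyMeasurable
      _ = ∫⁻ h, (∫⁻ x in A, ‖u (x + t • h) - u x‖ₑ ^ 2) ∂ν :=
          lintegral_lintegral_swap (hm.enorm.pow_const 2).aemeasurable
      _ ≤ ∫⁻ h, D ^ 2 ∂ν := by
          refine lintegral_mono_ae ?_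
          filter_upwards [hD] with h hh
          rw [← eLpNorm_two_sq]
          gcongr
      _ = D ^ 2 := by simp
  exact (ENNReal.pow_le_pow_left_iff two_ne_zero).1 hsq

/-- Compare `u n` with its average over the cell `x + t S`. The difference is at most `t D` in
`L²(A)`, uniformly in `n`, by the translation estimate. For fixed `t` the averages tend to zero
pointwise by `hweak` and are uniformly bounded, so they tend to zero in `L²(A)` by dominated
convergence. Now choose `t` small, then `n` large. The condition `hseg` keeps every cell inside `Ω`.
-/
theorem tendsto_eLpNorm_of_cone {u : ℕ → E → ℝ} (hΩ : IsOpen Ω) (hA : IsOpen A)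
    (hAfin : volume A ≠ ∞) (hS : MeasurableSet S) (hS0 : volume S ≠ 0) (hSfin : volume S ≠ ∞)
    (hseg : ∀ x ∈ A, ∀ h ∈ S, ∀ s ∈ Set.Icc (0 : ℝ) 1, x + s • h ∈ Ω)
    (hum : ∀ n, Measurable (u n)) (hu : ∀ n, MemLp (u n) 2 (volume.restrict Ω))
    {B D : ℝ≥0∞} (hB : B ≠ ∞) (hD : D ≠ ∞)
    (hbd : ∀ n, eLpNorm (u n) 2 (volume.restrict Ω) ≤ B)
    (hdir : ∀ n, ∀ h ∈ S, ∃ P : E → ℝ, MemLp P 2 (volume.restrict Ω) ∧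
      eLpNorm P 2 (volume.restrict Ω) ≤ D ∧ ∀ φ, IsTestFunction Ω φ →
        ∫ x in Ω, fderiv ℝ φ x h * u n x = - ∫ x in Ω, φ x * P x)
    (hweak : ∀ F ⊆ Ω, MeasurableSet F → volume F ≠ ∞ →
      Tendsto (fun n => ∫ x in F, u n x) atTop (𝓝 0)) :
    Tendsto (fun n => eLpNorm (u n) 2 (volume.restrict A)) atTop (𝓝 0) := by
  set ν : Measure E := (volume S)⁻¹ • volume.restrict S with hν
  have hνp : IsProbabilityMeasure ν := ⟨by
    rw [hν, Measure.smul_apply, Measure.restrict_apply_univ, smul_eq_mul,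
      ENNReal.inv_mul_cancel hS0 hSfin]⟩
  have hνS : ∀ᵐ h ∂ν, h ∈ S := (Measure.ae_smul_measure (ae_restrict_mem hS) _)
  have htrans : ∀ n, ∀ t ∈ Set.Ioc (0 : ℝ) 1, ∀ h ∈ S,
      eLpNorm (fun x => u n (x + t • h) - u n x) 2 (volume.restrict A) ≤ ENNReal.ofReal t * D := by
    intro n t ht h hh
    obtain ⟨P, hP, hPD, hPw⟩ := hdir n h hh
    refine (eLpNorm_translate_sub_le (P := t • P) hΩ hA (fun x hx s hs => ?_) (hu n)
      (hP.const_smul t) fun φ hφ => ?_).trans ?_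
    · rw [smul_smul]
      exact hseg x hx h hh _ ⟨mul_nonneg hs.1 ht.1.le, mul_le_one₀ hs.2 ht.1.le ht.2⟩
    · simp only [map_smul, smul_eq_mul, Pi.smul_apply, mul_assoc, mul_left_comm _ t]
      rw [integral_const_mul, integral_const_mul, hPw φ hφ, mul_neg]
    · rw [eLpNorm_const_smul, Real.enorm_eq_ofReal ht.1.le]
      gcongr
  have hcell : ∀ t ∈ Set.Ioc (0 : ℝ) 1, ∀ x ∈ A,
      (fun h => x + t • h) '' S ⊆ Ω := by
    rintro t ht x hx _ ⟨h, hh, rfl⟩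
    exact hseg x hx h hh t ⟨ht.1.le, ht.2⟩
  have himg : ∀ (t : ℝ) (x : E), (fun h => x + t • h) '' S = (fun y => x + y) '' (t • S) := by
    intro t x
    rw [← Set.image_smul, Set.image_image]
  have hFm : ∀ t ∈ Set.Ioc (0 : ℝ) 1, ∀ x, MeasurableSet ((fun h => x + t • h) '' S) := by
    intro t ht x
    rw [himg]
    exact (Homeomorph.addLeft x).measurableEmbedding.measurableSet_image.2
      (hS.const_smul₀ t)
  have hFvol : ∀ t ∈ Set.Ioc (0 : ℝ) 1, ∀ x, volume ((fun h => x + t • h) '' S)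
      = ENNReal.ofReal (t ^ Module.finrank ℝ E) * volume S := by
    intro t ht x
    rw [himg, Set.image_add_left, measure_preimage_add, Measure.addHaar_smul,
      abs_of_nonneg (pow_nonneg ht.1.le _)]
  have hchange : ∀ t ∈ Set.Ioc (0 : ℝ) 1, ∀ (x : E) (v : E → ℝ),
      ∫ h in S, v (x + t • h) = (t ^ Module.finrank ℝ E)⁻¹ * ∫ y in (fun h => x + t • h) '' S, v y := by
    intro t ht x v
    rw [Measure.setIntegral_comp_smul_of_pos volume (fun y => v (x + y)) S ht.1, himg, smul_eq_mul,
      (measurePreserving_add_left volume x).setIntegral_image_emb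
        (Homeomorph.addLeft x).measurableEmbedding]
  have hinteg : ∀ n, ∀ t ∈ Set.Ioc (0 : ℝ) 1, ∀ x ∈ A,
      Integrable (fun h => u n (x + t • h)) ν := by
    intro n t ht x hx
    refine Integrable.smul_measure ?_ (ENNReal.inv_ne_top.2 hS0)
    have h1 : IntegrableOn (u n) ((fun h => x + t • h) '' S) := by
      have : IsFiniteMeasure (volume.restrict ((fun h => x + t • h) '' S)) :=
        ⟨by rw [Measure.restrict_apply_univ, hFvol t ht]; exact
          ENNReal.mul_lt_top ENNReal.ofReal_lt_top hSfin.lt_top⟩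
      exact ((hu n).mono_measure (Measure.restrict_mono_set _ (hcell t ht x hx))).integrable
        one_le_two
    have h2 := (measurePreserving_add_left volume x).integrableOn_image
      (Homeomorph.addLeft x).measurableEmbedding (f := u n) (s := t • S)
    rw [← himg] at h2
    have h3 := h2.1 h1
    have h4 : IntegrableOn (fun h => (u n ∘ fun y => x + y) (t • h)) S := by
      rw [← integrable_indicator_iff hS]
      rw [← integrable_indicator_iff (hS.const_smul₀ t)] at h3
      refine (h3.comp_smul ht.1.ne').congr (Eventually.of_forall fun h => ?_)
      beta_reduce
      have hiff : t • h ∈ t • S ↔ h ∈ S := Set.smul_mem_smul_set_iff₀ ht.1.ne' S h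
      by_cases hh : h ∈ S
      · rw [Set.indicator_of_mem hh, Set.indicator_of_mem (hiff.2 hh)]
      · rw [Set.indicator_of_notMem hh, Set.indicator_of_notMem (mt hiff.1 hh)]
    exact h4
  have hM : ∀ t ∈ Set.Ioc (0 : ℝ) 1,
      Tendsto (fun n => eLpNorm (fun x => ∫ h, u n (x + t • h) ∂ν) 2 (volume.restrict A))
        atTop (𝓝 0) := by
    intro t ht
    set c : ℝ := ((volume S)⁻¹).toReal * (t ^ Module.finrank ℝ E)⁻¹ with hc
    have hval : ∀ n x, ∫ h, u n (x + t • h) ∂ν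
        = c * ∫ y in (fun h => x + t • h) '' S, u n y := fun n x => by
      rw [hν, integral_smul_measure, hchange t ht, smul_eq_mul, hc, mul_assoc]
    -- This bound for the averages is Cauchy–Schwarz on the cell, whose volume is `t ^ dim` times
    -- that of `S`.
    set K : ℝ≥0∞ := ‖c‖ₑ * ((ENNReal.ofReal (t ^ Module.finrank ℝ E) * volume S) ^ (1 / 2 : ℝ) * B)
      with hK
    have hbound : ∀ n, ∀ x ∈ A, ‖∫ h, u n (x + t • h) ∂ν‖ₑ ≤ K := by
      intro n x hx
      rw [hval, enorm_mul, hK]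
      gcongr
      have h1 := enorm_integral_mul_le (μ := volume.restrict ((fun h => x + t • h) '' S))
        (f := fun _ => (1 : ℝ)) (g := u n) aestronglyMeasurable_const (hum n).aestronglyMeasurable
      simp only [one_mul] at h1
      refine h1.trans ?_
      gcongr
      · by_cases hz : volume.restrict ((fun h => x + t • h) '' S) = 0
        · simp [hz]
        · rw [eLpNorm_const _ two_ne_zero hz, Measure.restrict_apply_univ, hFvol t ht]
          simp
      · exact (eLpNorm_mono_measure _ (Measure.restrict_mono_set _ (hcell t ht x hx))).trans (hbd n)
    have hKfin : K ≠ ∞ := by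
      rw [hK]
      exact ENNReal.mul_ne_top enorm_ne_top (ENNReal.mul_ne_top (ENNReal.rpow_ne_top_of_nonneg
        (by norm_num) (ENNReal.mul_ne_top ENNReal.ofReal_ne_top hSfin)) hB)
    have hmeas : ∀ n, Measurable fun x => ∫ h, u n (x + t • h) ∂ν := fun n => by
      have : StronglyMeasurable (Function.uncurry fun x h => u n (x + t • h)) :=
        ((hum n).comp (by fun_prop : Measurable fun z : E × E => z.1 + t • z.2)).stronglyMeasurable
      exact this.integral_prod_right.measurable
    have hlim : Tendsto (fun n => ∫⁻ x in A, ‖∫ h, u n (x + t • h) ∂ν‖ₑ ^ 2) atTop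
        (𝓝 (∫⁻ _ in A, 0)) := by
      refine tendsto_lintegral_of_dominated_convergence (fun _ => K ^ 2)
        (fun n => (hmeas n).enorm.pow_const 2) (fun n => ?_) ?_ ?_
      · filter_upwards [ae_restrict_mem hA.measurableSet] with x hx
        gcongr
        exact hbound n x hx
      · rw [lintegral_const, Measure.restrict_apply_univ]
        exact ENNReal.mul_ne_top (ENNReal.pow_ne_top hKfin) hAfin
      · filter_upwards [ae_restrict_mem hA.measurableSet] with x hx
        have h1 : Tendsto (fun n => ∫ h, u n (x + t • h) ∂ν) atTop (𝓝 0) := by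
          simp only [hval]
          rw [← mul_zero c]
          exact (hweak _ (hcell t ht x hx) (hFm t ht x) (by
            rw [hFvol t ht]; exact ENNReal.mul_ne_top ENNReal.ofReal_ne_top hSfin)).const_mul c
        have h2 := ENNReal.Tendsto.pow (n := 2) h1.enorm
        simpa using h2
    simp only [lintegral_zero, ← eLpNorm_two_sq] at hlim
    have h3 := (ENNReal.continuous_rpow_const (y := (1 / 2 : ℝ))).tendsto 0 |>.comp hlim
    rw [ENNReal.zero_rpow_of_pos (by norm_num)] at h3
    refine h3.congr fun n => ?_
    simp only [Function.comp]
    rw [← ENNReal.rpow_natCast, ← ENNReal.rpow_mul]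
    norm_num
  rw [ENNReal.tendsto_nhds_zero]
  intro ε hε
  obtain ⟨δ, hδ, hlt⟩ := exists_pos_mul_lt_ennreal D hD (ENNReal.half_pos hε.ne')
  -- The cap at `1` makes the parameter finite and keeps `t S` within the reach of `hseg`.
  set t : ℝ := (min δ 1).toReal with ht_def
  have hmin : min δ 1 ≠ ∞ := ne_top_of_le_ne_top ENNReal.one_ne_top (min_le_right _ _)
  have ht : t ∈ Set.Ioc (0 : ℝ) 1 :=
    ⟨ENNReal.toReal_pos (lt_min hδ one_pos).ne' hmin,
      ENNReal.toReal_le_of_le_ofReal zero_le_one (by simp)⟩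
  have htD : ENNReal.ofReal t * D ≤ ε / 2 := by
    rw [ht_def, ENNReal.ofReal_toReal hmin, mul_comm]
    exact (mul_le_mul_right (min_le_left _ _) _).trans hlt.le
  filter_upwards [ENNReal.tendsto_nhds_zero.1 (hM t ht) (ε / 2) (ENNReal.half_pos hε.ne')] with n hn
  have hdiff := eLpNorm_sub_average_le (hum n) A ν (t := t) (D := ENNReal.ofReal t * D)
    ((ae_restrict_iff' hA.measurableSet).2 (Eventually.of_forall fun x hx => hinteg n t ht x hx))
    (by filter_upwards [hνS] with h hh using htrans n t ht h hh)
  have hmeas : Measurable fun x => ∫ h, u n (x + t • h) ∂ν := by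
    have : StronglyMeasurable (Function.uncurry fun x h => u n (x + t • h)) :=
      ((hum n).comp (by fun_prop : Measurable fun z : E × E => z.1 + t • z.2)).stronglyMeasurable
    exact this.integral_prod_right.measurable
  have hsplit : u n = (fun x => u n x - ∫ h, u n (x + t • h) ∂ν)
      + fun x => ∫ h, u n (x + t • h) ∂ν := by
    ext x; simp
  rw [hsplit, ← ENNReal.add_halves ε]
  exact (eLpNorm_add_le ((hum n).sub hmeas).aestronglyMeasurable hmeas.aestronglyMeasurable
    one_le_two).trans (add_le_add (hdiff.trans htD) hn)

end Compactness

end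

/-! ### Local Rellich compactness -/

section

open Filter Topology
open scoped ENNReal Pointwise

section Compactness

variable {E : Type*} [NormedAddCommGroup E] [NormedSpace ℝ E] [FiniteDimensional ℝ E]
  [MeasureSpace E] [BorelSpace E] [(volume : Measure E).IsAddHaarMeasure]
  {𝕜 : Type*} [RCLike 𝕜] {ι : Type*} [Fintype ι] {Ω A S : Set E} {e : ι → E}

theorem MemSobolev.exists_directional {u : E → ℝ} {p : ι → E → ℝ} (hu : MemSobolev Ω e u p)
    {B c : ℝ≥0∞} (hp : ∀ i, eLpNorm (p i) 2 (volume.restrict Ω) ≤ B) {h : E} {a : ι → ℝ}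
    (hh : h = ∑ i, a i • e i) (ha : ∀ i, ‖a i‖ₑ ≤ c) :
    ∃ P : E → ℝ, MemLp P 2 (volume.restrict Ω) ∧
      eLpNorm P 2 (volume.restrict Ω) ≤ Fintype.card ι * (c * B) ∧ ∀ φ, IsTestFunction Ω φ →
        ∫ x in Ω, fderiv ℝ φ x h * u x = - ∫ x in Ω, φ x * P x := by
  have hm : ∀ i, MemLp (a i • p i) 2 (volume.restrict Ω) := fun i => (hu.grad_memLp i).const_smul _
  refine ⟨∑ i, a i • p i, memLp_finsetSum' _ fun i _ => hm i, ?_, fun φ hφ => ?_⟩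
  · refine (eLpNorm_sum_le (fun i _ => (hm i).1) one_le_two).trans ?_
    refine (Finset.sum_le_card_nsmul _ _ (c * B) fun i _ => ?_).trans ?_
    · rw [eLpNorm_const_smul]
      gcongr
      exacts [ha i, hp i]
    · simp
  · have h1 : ∀ i, Integrable (fun x => a i * (fderiv ℝ φ x (e i) * u x)) (volume.restrict Ω) :=
      fun i => (integrable_mul_of_memLp (hφ.memLp_fderiv (𝕜 := ℝ) (e i) Ω) hu.memLp).const_mul _
    have h2 : ∀ i, Integrable (fun x => a i * (φ x * p i x)) (volume.restrict Ω) :=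
      fun i => (integrable_mul_of_memLp (hφ.memLp (𝕜 := ℝ) Ω) (hu.grad_memLp i)).const_mul _
    have e1 : ∀ x, fderiv ℝ φ x h * u x = ∑ i, a i * (fderiv ℝ φ x (e i) * u x) := fun x => by
      simp only [hh, map_sum, map_smul, smul_eq_mul, Finset.sum_mul, mul_assoc]
    have e2 : ∀ x, φ x * (∑ i, a i • p i) x = ∑ i, a i * (φ x * p i x) := fun x => by
      simp only [Finset.sum_apply, Pi.smul_apply, smul_eq_mul, Finset.mul_sum, mul_left_comm]
    simp only [e1, e2]
    rw [integral_finsetSum _ fun i _ => h1 i, integral_finsetSum _ fun i _ => h2 i,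
      ← Finset.sum_neg_distrib]
    refine Finset.sum_congr rfl fun i _ => ?_
    have := hu.weak_deriv i φ hφ
    simp only [RCLike.ofReal_real_eq_id, id_eq] at this
    rw [integral_const_mul, integral_const_mul, this, mul_neg]

theorem tendsto_eLpNorm_real_of_weak {u : ℕ → E → ℝ} {p : ℕ → ι → E → ℝ} (hΩ : IsOpen Ω)
    (hA : IsOpen A) (hAfin : volume A ≠ ∞) (hS : IsOpen S) (hS0 : S.Nonempty)
    (hSb : Bornology.IsBounded S)
    (hseg : ∀ x ∈ A, ∀ h ∈ S, ∀ s ∈ Set.Icc (0 : ℝ) 1, x + s • h ∈ Ω)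
    (hspan : ∃ c : ℝ≥0∞, c ≠ ∞ ∧ ∀ h ∈ S, ∃ a : ι → ℝ, h = ∑ i, a i • e i ∧ ∀ i, ‖a i‖ₑ ≤ c)
    (hum : ∀ n, Measurable (u n)) (hu : ∀ n, MemSobolev Ω e (u n) (p n))
    {B : ℝ≥0∞} (hB : B ≠ ∞) (hbd : ∀ n, eLpNorm (u n) 2 (volume.restrict Ω) ≤ B)
    (hbd' : ∀ n i, eLpNorm (p n i) 2 (volume.restrict Ω) ≤ B)
    (hweak : ∀ F ⊆ Ω, MeasurableSet F → volume F ≠ ∞ →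
      Tendsto (fun n => ∫ x in F, u n x) atTop (𝓝 0)) :
    Tendsto (fun n => eLpNorm (u n) 2 (volume.restrict A)) atTop (𝓝 0) := by
  obtain ⟨c, hc, hspan⟩ := hspan
  refine tendsto_eLpNorm_of_cone (D := Fintype.card ι * (c * B)) hΩ hA hAfin hS.measurableSet
    (hS.measure_ne_zero _ hS0) hSb.measure_lt_top.ne hseg hum (fun n => (hu n).memLp) hB
    (ENNReal.mul_ne_top (ENNReal.natCast_ne_top _) (ENNReal.mul_ne_top hc hB)) hbd
    (fun n h hh => ?_) hweak
  obtain ⟨a, ha, ha'⟩ := hspan h hh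
  exact (hu n).exists_directional (hbd' n) ha ha'

theorem eLpNorm_le_re_add_im {α : Type*} [MeasurableSpace α] {μ : Measure α} {f : α → 𝕜}
    (hf : AEStronglyMeasurable f μ) :
    eLpNorm f 2 μ ≤ eLpNorm (fun x => RCLike.re (f x)) 2 μ + eLpNorm (fun x => RCLike.im (f x)) 2 μ := by
  have h1 : AEStronglyMeasurable (fun x => RCLike.re (f x)) μ :=
    RCLike.continuous_re.comp_aestronglyMeasurable hf
  have h2 : AEStronglyMeasurable (fun x => RCLike.im (f x)) μ :=
    RCLike.continuous_im.comp_aestronglyMeasurable hf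
  rw [← eLpNorm_norm (f := fun x => RCLike.re (f x)), ← eLpNorm_norm (f := fun x => RCLike.im (f x))]
  refine le_trans ?_ (eLpNorm_add_le h1.norm h2.norm one_le_two)
  refine eLpNorm_mono fun x => ?_
  simp only [Pi.add_apply, Real.norm_eq_abs]
  rw [abs_of_nonneg (by positivity)]
  calc ‖f x‖ = ‖(RCLike.re (f x) : 𝕜) + RCLike.im (f x) * RCLike.I‖ := by rw [RCLike.re_add_im]
    _ ≤ ‖(RCLike.re (f x) : 𝕜)‖ + ‖(RCLike.im (f x) : 𝕜) * RCLike.I‖ := norm_add_le _ _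
    _ ≤ |RCLike.re (f x)| + |RCLike.im (f x)| := by
      rw [norm_mul, RCLike.norm_ofReal, RCLike.norm_ofReal]
      gcongr
      refine mul_le_of_le_one_right (abs_nonneg _) ?_
      -- The case `I = 0` is that of real scalars.
      by_cases hI : (RCLike.I : 𝕜) = 0
      · simp [hI]
      · exact (RCLike.norm_I_of_ne_zero hI).le

/-- Local Rellich compactness: a bounded sequence of Sobolev functions on `Ω` whose integrals over
sets of finite measure tend to zero, tends to zero in `L²(A)` when a cone can be attached to all
points of `A` within `Ω`. -/
theorem tendsto_eLpNorm_of_weak {u : ℕ → E → 𝕜} {p : ℕ → ι → E → 𝕜} (hΩ : IsOpen Ω)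
    (hA : IsOpen A) (hAfin : volume A ≠ ∞) (hS : IsOpen S) (hS0 : S.Nonempty)
    (hSb : Bornology.IsBounded S)
    (hseg : ∀ x ∈ A, ∀ h ∈ S, ∀ s ∈ Set.Icc (0 : ℝ) 1, x + s • h ∈ Ω)
    (hspan : ∃ c : ℝ≥0∞, c ≠ ∞ ∧ ∀ h ∈ S, ∃ a : ι → ℝ, h = ∑ i, a i • e i ∧ ∀ i, ‖a i‖ₑ ≤ c)
    (hum : ∀ n, Measurable (u n)) (hu : ∀ n, MemSobolev Ω e (u n) (p n))
    {B : ℝ≥0∞} (hB : B ≠ ∞) (hbd : ∀ n, eLpNorm (u n) 2 (volume.restrict Ω) ≤ B)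
    (hbd' : ∀ n i, eLpNorm (p n i) 2 (volume.restrict Ω) ≤ B)
    (hweak : ∀ F ⊆ Ω, MeasurableSet F → volume F ≠ ∞ →
      Tendsto (fun n => ∫ x in F, u n x) atTop (𝓝 0)) :
    Tendsto (fun n => eLpNorm (u n) 2 (volume.restrict A)) atTop (𝓝 0) := by
  have hAΩ : A ⊆ Ω := fun x hx => by
    obtain ⟨h, hh⟩ := hS0
    simpa using hseg x hx h hh 0 (by simp)
  have key : ∀ L : 𝕜 →L[ℝ] ℝ,
      Tendsto (fun n => eLpNorm (fun x => L (u n x)) 2 (volume.restrict A)) atTop (𝓝 0) := by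
    intro L
    refine tendsto_eLpNorm_real_of_weak (B := ‖L‖ₑ * B) hΩ hA hAfin hS hS0 hSb hseg hspan
      (fun n => L.continuous.measurable.comp (hum n)) (fun n => (hu n).map L)
      (ENNReal.mul_ne_top enorm_ne_top hB)
      (fun n => (eLpNorm_clm_comp_le L _).trans (by gcongr; exact hbd n))
      (fun n i => (eLpNorm_clm_comp_le L _).trans (by gcongr; exact hbd' n i))
      fun F hF hFm hFfin => ?_
    have h1 := (L.continuous.tendsto 0).comp (hweak F hF hFm hFfin)
    rw [map_zero] at h1
    refine h1.congr fun n => ?_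
    have : IsFiniteMeasure (volume.restrict F) := ⟨by simpa using hFfin.lt_top⟩
    exact (L.integral_comp_comm (((hu n).memLp.mono_measure
      (Measure.restrict_mono_set _ hF)).integrable one_le_two)).symm
  have h2 := (key RCLike.reCLM).add (key RCLike.imCLM)
  rw [add_zero] at h2
  exact tendsto_of_tendsto_of_tendsto_of_le_of_le tendsto_const_nhds h2 (fun _ => bot_le)
    fun n => eLpNorm_le_re_add_im (hum n).aestronglyMeasurable

end Compactness

/-! ### The cone property of the cross section -/

section Geometry

/-- The function `f` is Lipschitz on each side of the point, and the two estimates join at `0` to a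
common constant `M`. The region below such a graph is preserved locally by vectors pointing
downwards with slope steeper than `M`; these contain an open set. -/
theorem exists_cone_of_mem_frontier {ω : Set Plane} (hω : HasPiecewiseC2Boundary ω) {p : Plane}
    (hp : p ∈ frontier ω) :
    ∃ U S : Set Plane, IsOpen U ∧ p ∈ U ∧ IsOpen S ∧ S.Nonempty ∧ Bornology.IsBounded S ∧
      ∀ x ∈ ω ∩ U, ∀ h ∈ S, ∀ s ∈ Set.Icc (0 : ℝ) 1, x + s • h ∈ ω := by
  obtain ⟨e, r, h, f, hr, hh, hf0, hf1, hf2, hmem⟩ := hω p hp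
  obtain ⟨K₁, hK₁⟩ := hf1.exists_lipschitzOnWith two_ne_zero (convex_Icc _ _) isCompact_Icc
  obtain ⟨K₂, hK₂⟩ := hf2.exists_lipschitzOnWith two_ne_zero (convex_Icc _ _) isCompact_Icc
  set M : ℝ := max K₁ K₂ with hM
  have hM0 : 0 ≤ M := le_max_of_le_left K₁.2
  have hl1 : ∀ a ∈ Set.Icc (-r) 0, ∀ b ∈ Set.Icc (-r) 0, |f a - f b| ≤ M * |a - b| :=
    fun a ha b hb => by
      have := hK₁.dist_le_mul a ha b hb
      rw [Real.dist_eq, Real.dist_eq] at this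
      exact this.trans (by gcongr; exact le_max_left _ _)
  have hl2 : ∀ a ∈ Set.Icc 0 r, ∀ b ∈ Set.Icc 0 r, |f a - f b| ≤ M * |a - b| :=
    fun a ha b hb => by
      have := hK₂.dist_le_mul a ha b hb
      rw [Real.dist_eq, Real.dist_eq] at this
      exact this.trans (by gcongr; exact le_max_right _ _)
  have hl12 : ∀ a ∈ Set.Icc (-r) 0, ∀ b ∈ Set.Icc 0 r, |f a - f b| ≤ M * |a - b| :=
    fun a ha b hb => by
      have h1 := hl1 a ha 0 (by simp [hr.le])
      have h2 := hl2 0 (by simp [hr.le]) b hb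
      have h3 := abs_sub_le (f a) (f 0) (f b)
      rw [sub_zero, abs_of_nonpos ha.2] at h1
      rw [zero_sub, abs_neg, abs_of_nonneg hb.1] at h2
      rw [abs_of_nonpos (by linarith [ha.2, hb.1] : a - b ≤ 0)]
      linarith
  have hlip : ∀ a b, |a| < r → |b| < r → f a - f b ≤ M * |a - b| := by
    intro a b ha hb
    rw [abs_lt] at ha hb
    rcases le_total a 0 with ha0 | ha0 <;> rcases le_total b 0 with hb0 | hb0
    · exact (le_abs_self _).trans (hl1 a ⟨ha.1.le, ha0⟩ b ⟨hb.1.le, hb0⟩)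
    · exact (le_abs_self _).trans (hl12 a ⟨ha.1.le, ha0⟩ b ⟨hb0, hb.2.le⟩)
    · have := hl12 b ⟨hb.1.le, hb0⟩ a ⟨ha0, ha.2.le⟩
      rw [abs_sub_comm (f b), abs_sub_comm b] at this
      exact (le_abs_self _).trans this
    · exact (le_abs_self _).trans (hl2 a ⟨ha0, ha.2.le⟩ b ⟨hb0, hb.2.le⟩)
  -- The bound `r / 2` keeps translated points in the chart horizontally. The bound `h / (4 (M +
  -- 1))` gives `M δ < h / 2`, which leaves room for the vertical range from `-h / 2` to `-M δ` of
  -- the cone.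
  set δ : ℝ := min (r / 2) (h / (4 * (M + 1))) with hδ
  have hδ0 : 0 < δ := lt_min (by linarith) (by positivity)
  have hMδ : M * δ < h / 2 := by
    have h1 : δ * (4 * (M + 1)) ≤ h := by
      rw [← le_div_iff₀ (by positivity)]; exact min_le_right _ _
    nlinarith
  have hcoord : ∀ y : Plane, y = !₂[y 0, y 1] := fun y => by ext i; fin_cases i <;> rfl
  have hc0 : Continuous fun y : Plane => y 0 := by fun_prop
  have hc1 : Continuous fun y : Plane => y 1 := by fun_prop
  refine ⟨{x | |(e.symm (x - p)) 0| < r / 2 ∧ |(e.symm (x - p)) 1| < h / 2},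
    {y | |(e.symm y) 0| < δ ∧ -(h / 2) < (e.symm y) 1 ∧ (e.symm y) 1 < -(M * δ)}, ?_, ?_, ?_, ?_,
    ?_, ?_⟩
  · have k0 : Continuous fun x : Plane => (e.symm (x - p)) 0 :=
      hc0.comp (e.symm.continuous.comp (continuous_id.sub continuous_const))
    have k1 : Continuous fun x : Plane => (e.symm (x - p)) 1 :=
      hc1.comp (e.symm.continuous.comp (continuous_id.sub continuous_const))
    exact (isOpen_lt k0.abs continuous_const).inter (isOpen_lt k1.abs continuous_const)
  · simp [hr, hh]
  · have k0 : Continuous fun x : Plane => (e.symm x) 0 := hc0.comp e.symm.continuous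
    have k1 : Continuous fun x : Plane => (e.symm x) 1 := hc1.comp e.symm.continuous
    exact (isOpen_lt k0.abs continuous_const).inter
      ((isOpen_lt continuous_const k1).inter (isOpen_lt k1 continuous_const))
  · refine ⟨e !₂[0, (-(h / 2) + -(M * δ)) / 2], ?_, ?_, ?_⟩ <;> simp <;> linarith
  · refine (Metric.isBounded_closedBall (x := (0 : Plane)) (r := δ + h / 2)).subset ?_
    rintro y ⟨h0, h1, h2⟩
    rw [mem_closedBall_zero_iff, ← e.symm.norm_map, EuclideanSpace.norm_eq, Fin.sum_univ_two]
    refine Real.sqrt_le_iff.2 ⟨by positivity, ?_⟩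
    have h3 : |(e.symm y) 1| ≤ h / 2 := abs_le.2 ⟨h1.le, by
      have := mul_nonneg hM0 hδ0.le
      linarith⟩
    simp only [Real.norm_eq_abs]
    nlinarith [abs_nonneg ((e.symm y) 0), abs_nonneg ((e.symm y) 1)]
  · rintro x ⟨hxω, hx0, hx1⟩ y ⟨hy0, hy1, hy2⟩ s ⟨hs0, hs1⟩
    set a := e.symm (x - p) with ha
    set b := e.symm y with hb
    have hx : x = p + e !₂[a 0, a 1] := by rw [← hcoord, ha, e.apply_symm_apply]; abel
    have hxy : x + s • y = p + e !₂[a 0 + s * b 0, a 1 + s * b 1] := by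
      have : (!₂[a 0 + s * b 0, a 1 + s * b 1] : Plane) = a + s • b := by
        ext i; fin_cases i <;> simp
      rw [this, map_add, map_smul, ha, hb, e.apply_symm_apply, e.apply_symm_apply]
      abel
    have hδr : δ ≤ r / 2 := min_le_left _ _
    have hsb0 : |s * b 0| ≤ s * δ := by
      rw [abs_mul, abs_of_nonneg hs0]; gcongr
    have hsδ : s * δ ≤ δ := mul_le_of_le_one_left hδ0.le hs1
    have hMδ0 : 0 ≤ M * δ := mul_nonneg hM0 hδ0.le
    have hb1 : |b 1| ≤ h / 2 := abs_le.2 ⟨hy1.le, by linarith⟩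
    have hsb1 : |s * b 1| ≤ h / 2 := by
      rw [abs_mul, abs_of_nonneg hs0]
      exact (mul_le_of_le_one_left (abs_nonneg _) hs1).trans hb1
    have hr0 : |a 0 + s * b 0| < r := (abs_add_le _ _).trans_lt (by linarith)
    have hr1 : |a 1 + s * b 1| < h := (abs_add_le _ _).trans_lt (by linarith)
    rw [hxy, hmem _ _ hr0 hr1]
    have hlt : a 1 < f (a 0) := by
      rw [← hmem _ _ (by linarith) (by linarith), ← hx]; exact hxω
    have h5 := hlip (a 0) (a 0 + s * b 0) (by linarith) hr0
    rw [sub_add_cancel_left, abs_neg] at h5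
    have h6 : M * |s * b 0| ≤ M * (s * δ) := by gcongr
    have h7 : s * b 1 ≤ s * -(M * δ) := by gcongr
    nlinarith

/-- A bounded domain with piecewise `C²` boundary has the cone property. -/
theorem IsCrossSection.exists_cones {ω : Set Plane} (hω : IsCrossSection ω) :
    ∃ (T : Finset Plane) (U S : Plane → Set Plane), (∀ p ∈ T, IsOpen (U p) ∧ IsOpen (S p) ∧
      (S p).Nonempty ∧ Bornology.IsBounded (S p) ∧
      ∀ x ∈ ω ∩ U p, ∀ h ∈ S p, ∀ s ∈ Set.Icc (0 : ℝ) 1, x + s • h ∈ ω) ∧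
      ω ⊆ ⋃ p ∈ T, U p := by
  have hex : ∀ p ∈ closure ω, ∃ U S : Set Plane, IsOpen U ∧ p ∈ U ∧ IsOpen S ∧ S.Nonempty ∧
      Bornology.IsBounded S ∧
      ∀ x ∈ ω ∩ U, ∀ h ∈ S, ∀ s ∈ Set.Icc (0 : ℝ) 1, x + s • h ∈ ω := by
    intro p hp
    by_cases hpω : p ∈ ω
    · obtain ⟨ε, hε, hball⟩ := Metric.isOpen_iff.1 hω.isOpen p hpω
      refine ⟨Metric.ball p (ε / 2), Metric.ball 0 (ε / 2), Metric.isOpen_ball,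
        Metric.mem_ball_self (by linarith), Metric.isOpen_ball, ⟨0, Metric.mem_ball_self (by linarith)⟩,
        Metric.isBounded_ball, ?_⟩
      rintro x ⟨-, hx⟩ h hh s ⟨hs0, hs1⟩
      refine hball ?_
      rw [mem_ball_iff_norm] at hx ⊢
      rw [mem_ball_zero_iff] at hh
      calc ‖x + s • h - p‖ = ‖(x - p) + s • h‖ := by congr 1; abel
        _ ≤ ‖x - p‖ + ‖s • h‖ := norm_add_le _ _
        _ ≤ ‖x - p‖ + ‖h‖ := by
          rw [norm_smul, Real.norm_of_nonneg hs0]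
          gcongr
          exact mul_le_of_le_one_left (norm_nonneg _) hs1
        _ < ε := by linarith
    · refine exists_cone_of_mem_frontier hω.boundary ?_
      rw [frontier, hω.isOpen.interior_eq]
      exact ⟨hp, hpω⟩
  choose! U S h using hex
  obtain ⟨T, hT, hcov⟩ := hω.isBounded.isCompact_closure.elim_nhds_subcover U
    fun p hp => (h p hp).1.mem_nhds (h p hp).2.1
  refine ⟨T, U, S, fun p hp => ?_, subset_closure.trans hcov⟩
  obtain ⟨h1, -, h2⟩ := h p (hT p hp)
  exact ⟨h1, h2⟩

end Geometry

end

/-! ### The form domain as a Hilbert space -/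

section

open Filter Topology
open scoped ENNReal

section Comparable

variable {α : Type*} [MeasurableSpace α] {ε : Type*} [NormedAddCommGroup ε]

/-- Two measures bound each other up to a constant. -/
def ComparableMeasures (μ ν : Measure α) : Prop :=
  ∃ c : ℝ≥0∞, c ≠ ∞ ∧ μ ≤ c • ν ∧ ν ≤ c • μ

variable {μ ν : Measure α}

theorem ComparableMeasures.symm (h : ComparableMeasures μ ν) : ComparableMeasures ν μ := by
  obtain ⟨c, hc, h1, h2⟩ := h
  exact ⟨c, hc, h2, h1⟩

theorem ComparableMeasures.refl (μ : Measure α) : ComparableMeasures μ μ :=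
  ⟨1, ENNReal.one_ne_top, by simp, by simp⟩

theorem ComparableMeasures.absolutelyContinuous (h : ComparableMeasures μ ν) : μ ≪ ν := by
  obtain ⟨c, hc, h1, -⟩ := h
  exact Measure.absolutelyContinuous_of_le_smul h1

theorem ComparableMeasures.memLp (h : ComparableMeasures μ ν) {f : α → ε} (hf : MemLp f 2 ν) :
    MemLp f 2 μ := by
  obtain ⟨c, hc, h1, -⟩ := h
  exact hf.of_measure_le_smul hc h1

theorem ComparableMeasures.exists_eLpNorm_le (h : ComparableMeasures μ ν) :
    ∃ C : ℝ≥0∞, C ≠ ∞ ∧ ∀ f : α → ε, eLpNorm f 2 μ ≤ C * eLpNorm f 2 ν := by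
  obtain ⟨c, hc, h1, -⟩ := h
  refine ⟨c ^ (1 / 2 : ℝ), ENNReal.rpow_ne_top_of_nonneg (by norm_num) hc, fun f => ?_⟩
  refine (eLpNorm_mono_measure f h1).trans ?_
  rw [eLpNorm_smul_measure_of_ne_top ENNReal.ofNat_ne_top]
  simp

end Comparable

section FormSpace

variable {E : Type*} [NormedAddCommGroup E] [NormedSpace ℝ E] [FiniteDimensional ℝ E]
  [MeasureSpace E] [BorelSpace E] [(volume : Measure E).IsAddHaarMeasure]
  {𝕜 : Type*} [RCLike 𝕜] {ι : Type*} [Fintype ι]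

/-- The form domain `H¹_0(Ω, Γ)`, with `u` in `L²(μ none)` and `∂ᵢu` in `L²(μ (some i))`. -/
def formSpace (𝕜 : Type*) [RCLike 𝕜] (Ω Γ : Set E) (e : ι → E) {μ : Option ι → Measure E}
    (hμ : ∀ j, ComparableMeasures (volume.restrict Ω) (μ j)) :
    Submodule 𝕜 (PiLp 2 fun j : Option ι => Lp 𝕜 2 (μ j)) where
  carrier := {k | MemSobolevZero Ω Γ e (k none : E → 𝕜) fun i => (k (some i) : E → 𝕜)}
  zero_mem' := MemSobolevZero.zero.congr_ae
    ((hμ none).absolutelyContinuous.ae_le (Lp.coeFn_zero 𝕜 2 (μ none)).symm)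
    fun i => (hμ (some i)).absolutelyContinuous.ae_le (Lp.coeFn_zero 𝕜 2 (μ (some i))).symm
  add_mem' {k l} hk hl := (MemSobolevZero.add hk hl).congr_ae
    ((hμ none).absolutelyContinuous.ae_le (Lp.coeFn_add (k none) (l none)).symm)
    fun i => (hμ (some i)).absolutelyContinuous.ae_le (Lp.coeFn_add (k (some i)) (l (some i))).symm
  smul_mem' c k hk := (MemSobolevZero.const_smul hk c).congr_ae
    ((hμ none).absolutelyContinuous.ae_le (Lp.coeFn_smul c (k none)).symm)
    fun i => (hμ (some i)).absolutelyContinuous.ae_le (Lp.coeFn_smul c (k (some i))).symm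

variable {Ω Γ : Set E} {e : ι → E} {μ : Option ι → Measure E}
  (hμ : ∀ j, ComparableMeasures (volume.restrict Ω) (μ j))

/-- This is the closedness of the form: comparability of the measures makes convergence in the
ambient product imply unweighted `L²` convergence of the function and its gradient. -/
theorem isClosed_formSpace :
    IsClosed (formSpace 𝕜 Ω Γ e hμ : Set (PiLp 2 fun j : Option ι => Lp 𝕜 2 (μ j))) := by
  choose C hC hle using fun j => (hμ j).exists_eLpNorm_le (ε := 𝕜)
  refine isClosed_of_closure_subset fun k hk => ?_
  refine MemSobolevZero.of_approx_zero ((hμ none).memLp (Lp.memLp _))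
    (fun i => (hμ _).memLp (Lp.memLp _)) fun ε hε => ?_
  obtain ⟨δ, hδ, hlt⟩ := exists_pos_mul_lt_ennreal (∑ j, C j)
    (ENNReal.sum_ne_top.2 fun j _ => hC j) hε
  have hmin : min δ 1 ≠ ∞ := ne_top_of_le_ne_top ENNReal.one_ne_top (min_le_right _ _)
  obtain ⟨l, hl, hd⟩ := Metric.mem_closure_iff.1 hk (min δ 1).toReal
    (ENNReal.toReal_pos (lt_min hδ one_pos).ne' hmin)
  have hj : ∀ j, eLpNorm ((k j : E → 𝕜) - (l j : E → 𝕜)) 2 (volume.restrict Ω) < ε := by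
    intro j
    refine (hle j _).trans_lt (lt_of_le_of_lt ?_ hlt)
    gcongr
    · exact Finset.single_le_sum (f := C) (fun _ _ => bot_le) (Finset.mem_univ j)
    · rw [← eLpNorm_congr_ae (Lp.coeFn_sub (k j) (l j)), ← Lp.enorm_def]
      have h1 : ‖k j - l j‖ ≤ (min δ 1).toReal := by
        have := PiLp.norm_apply_le (k - l) j
        rw [dist_eq_norm] at hd
        exact this.trans hd.le
      rw [← ofReal_norm]
      refine (ENNReal.ofReal_le_ofReal h1).trans ?_
      rw [ENNReal.ofReal_toReal hmin]
      exact min_le_left _ _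
  exact ⟨_, _, hl, hj none, fun i => hj (some i)⟩

instance : CompleteSpace (formSpace 𝕜 Ω Γ e hμ) :=
  (isClosed_formSpace hμ).completeSpace_coe

/-- The inclusion of the form domain in `L²`. -/
def formInclusion (𝕜 : Type*) [RCLike 𝕜] (Γ : Set E) (e : ι → E) :
    formSpace 𝕜 Ω Γ e hμ →L[𝕜] Lp 𝕜 2 (μ none) :=
  (PiLp.proj 2 (fun j : Option ι => Lp 𝕜 2 (μ j)) none).comp (formSpace 𝕜 Ω Γ e hμ).subtypeL

theorem exists_formSpace_of_memSobolevZero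
    (hμ' : ∀ j, ComparableMeasures (μ j) (volume.restrict Ω)) {u : E → 𝕜}
    {p : ι → E → 𝕜} (h : MemSobolevZero Ω Γ e u p) :
    ∃ U : formSpace 𝕜 Ω Γ e hμ, formInclusion hμ 𝕜 Γ e U =ᵐ[μ none] u ∧
      ∀ i, U.1 (some i) =ᵐ[μ (some i)] p i := by
  have h0 : MemLp u 2 (μ none) := (hμ' none).memLp h.memLp
  have h1 : ∀ i, MemLp (p i) 2 (μ (some i)) := fun i => (hμ' (some i)).memLp (h.grad_memLp i)
  set k : PiLp 2 fun j : Option ι => Lp 𝕜 2 (μ j) := WithLp.toLp 2 fun j => match j with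
    | none => h0.toLp u
    | some i => (h1 i).toLp (p i)
  have hk0 : k none =ᵐ[μ none] u := h0.coeFn_toLp
  have hk1 : ∀ i, k (some i) =ᵐ[μ (some i)] p i := fun i => (h1 i).coeFn_toLp
  have hk : k ∈ formSpace 𝕜 Ω Γ e hμ := h.congr_ae ((hμ none).absolutelyContinuous.ae_le hk0.symm)
    fun i => (hμ (some i)).absolutelyContinuous.ae_le (hk1 i).symm
  exact ⟨⟨k, hk⟩, hk0, hk1⟩

theorem formSpace_inner_eq (U W : formSpace 𝕜 Ω Γ e hμ) :
    inner 𝕜 W U = inner 𝕜 (formInclusion hμ 𝕜 Γ e W) (formInclusion hμ 𝕜 Γ e U)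
      + ∑ i, inner 𝕜 (W.1 (some i)) (U.1 (some i)) := by
  rw [Submodule.coe_inner, PiLp.inner_apply, Fintype.sum_option]
  rfl

theorem formSpace_norm_sq_eq (U : formSpace 𝕜 Ω Γ e hμ) :
    ‖U‖ ^ 2 = ‖formInclusion hμ 𝕜 Γ e U‖ ^ 2 + ∑ i, ‖U.1 (some i)‖ ^ 2 := by
  rw [← Submodule.norm_coe, PiLp.norm_sq_eq_of_L2, Fintype.sum_option]
  rfl

theorem sum_inner_eq_sum_integral {k l : PiLp 2 fun j : Option ι => Lp 𝕜 2 (μ j)}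
    {p q : ι → E → 𝕜} (hk : ∀ i, k (some i) =ᵐ[μ (some i)] p i)
    (hl : ∀ i, l (some i) =ᵐ[μ (some i)] q i) :
    ∑ i, inner 𝕜 (l (some i)) (k (some i)) = ∑ i, ∫ x, inner 𝕜 (q i x) (p i x) ∂μ (some i) := by
  refine Finset.sum_congr rfl fun i _ => ?_
  rw [L2.inner_def]
  refine integral_congr_ae ?_
  filter_upwards [hk i, hl i] with x hx hx'
  rw [hx, hx']

/-- The operator associated with the form is expressed by its resolvent at `-1`. -/
theorem formOperator_iff (hμ' : ∀ j, ComparableMeasures (μ j) (volume.restrict Ω))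
    (u f : Lp 𝕜 2 (μ none)) :
    (∃ p : ι → E → 𝕜, MemSobolevZero Ω Γ e (u : E → 𝕜) p ∧
      ∀ (v : Lp 𝕜 2 (μ none)) (q : ι → E → 𝕜), MemSobolevZero Ω Γ e (v : E → 𝕜) q →
        ∑ i, ∫ x, inner 𝕜 (q i x) (p i x) ∂μ (some i) = inner 𝕜 v f) ↔
    u = formResolvent (formInclusion hμ 𝕜 Γ e) (u + f) := by
  rw [formResolvent, ContinuousLinearMap.comp_apply]
  constructor
  · rintro ⟨p, hp, h⟩
    obtain ⟨U, hU0, hU⟩ := exists_formSpace_of_memSobolevZero hμ hμ' hp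
    have hJU : formInclusion hμ 𝕜 Γ e U = u := Lp.ext hU0
    -- Adding `⟨v, u⟩` to the form equation turns it into `⟨W, U⟩ = ⟨J W, u + f⟩` for all `W`, which
    -- is the definition of `J† (u + f)`.
    have key : U = ContinuousLinearMap.adjoint (formInclusion hμ 𝕜 Γ e) (u + f) := by
      refine ext_inner_left 𝕜 fun W => ?_
      rw [ContinuousLinearMap.adjoint_inner_right, formSpace_inner_eq, hJU, inner_add_right,
        sum_inner_eq_sum_integral hU fun i => ae_eq_refl _]
      congr 1
      exact h (formInclusion hμ 𝕜 Γ e W) _ W.2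
    rw [← key, hJU]
  · intro h
    obtain ⟨U, hU⟩ : ∃ U, U = ContinuousLinearMap.adjoint (formInclusion hμ 𝕜 Γ e) (u + f) :=
      ⟨_, rfl⟩
    rw [← hU] at h
    have hmem : MemSobolevZero Ω Γ e (u : E → 𝕜) fun i => (U.1 (some i) : E → 𝕜) := by
      rw [h]; exact U.2
    refine ⟨_, hmem, fun v q hq => ?_⟩
    obtain ⟨W, hW0, hW⟩ := exists_formSpace_of_memSobolevZero hμ hμ' hq
    have hJW : formInclusion hμ 𝕜 Γ e W = v := Lp.ext hW0
    have h1 := formSpace_inner_eq hμ U W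
    have h2 : inner 𝕜 W U = inner 𝕜 v (u + f) := by
      rw [hU, ContinuousLinearMap.adjoint_inner_right, hJW]
    rw [h2, hJW, ← h, inner_add_right, add_right_inj,
      sum_inner_eq_sum_integral (fun i => ae_eq_refl _) hW] at h1
    exact h1.symm

/-- Integration over a set of finite measure is a bounded functional on `L²`. Hence weak convergence
in the form space entails convergence of such integrals, the form in which the compactness theorem
uses it. -/
theorem exists_setIntegral_clm {ν : Measure E} (hν : ComparableMeasures (volume.restrict Ω) ν)
    {F : Set E} (hF : F ⊆ Ω) (hFfin : volume F ≠ ∞) :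
    ∃ L : Lp 𝕜 2 ν →L[𝕜] 𝕜, ∀ u : Lp 𝕜 2 ν, L u = ∫ x in F, u x := by
  have hfin : IsFiniteMeasure (volume.restrict F) := ⟨by simpa using hFfin.lt_top⟩
  have hle : volume.restrict F ≤ volume.restrict Ω := Measure.restrict_mono_set _ hF
  obtain ⟨C, hC, hCle⟩ := hν.exists_eLpNorm_le (ε := 𝕜)
  have hac : volume.restrict F ≪ ν :=
    (Measure.absolutelyContinuous_of_le hle).trans hν.absolutelyContinuous
  have hint : ∀ u : Lp 𝕜 2 ν, Integrable u (volume.restrict F) := fun u =>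
    ((hν.memLp (Lp.memLp u)).mono_measure hle).integrable one_le_two
  set B : ℝ≥0∞ := eLpNorm (fun _ : E => (1 : 𝕜)) 2 (volume.restrict F) with hB
  have hBfin : B ≠ ∞ := (memLp_const (1 : 𝕜)).2.ne
  refine ⟨LinearMap.mkContinuous
    { toFun := fun u => ∫ x in F, u x
      map_add' := fun u v => ?_
      map_smul' := fun c u => ?_ } (B * C).toReal fun u => ?_, fun u => rfl⟩
  · rw [← integral_add (hint u) (hint v)]
    exact integral_congr_ae (hac.ae_le (Lp.coeFn_add u v))
  · rw [RingHom.id_apply, ← integral_smul]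
    exact integral_congr_ae (hac.ae_le (Lp.coeFn_smul c u))
  · have h1 := enorm_integral_mul_le (μ := volume.restrict F) (f := fun _ => (1 : 𝕜)) (g := u)
      aestronglyMeasurable_const (hint u).1
    simp only [one_mul] at h1
    have h2 : ‖∫ x in F, u x‖ₑ ≤ B * C * ‖u‖ₑ := by
      rw [Lp.enorm_def, mul_assoc]
      refine h1.trans ?_
      gcongr
      exact (eLpNorm_mono_measure _ hle).trans (hCle _)
    have h3 := ENNReal.toReal_mono (ENNReal.mul_ne_top (ENNReal.mul_ne_top hBfin hC) enorm_ne_top) h2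
    rwa [ENNReal.toReal_mul, toReal_enorm, toReal_enorm] at h3

/-- A bound on the form norm controls the function and all its derivatives in unweighted `L²`, so
local Rellich compactness applies in the form space. -/
theorem formSpace_tendsto_eLpNorm {A S : Set E} (hΩ : IsOpen Ω)
    (hA : IsOpen A) (hAfin : volume A ≠ ∞) (hS : IsOpen S) (hS0 : S.Nonempty)
    (hSb : Bornology.IsBounded S)
    (hseg : ∀ x ∈ A, ∀ h ∈ S, ∀ s ∈ Set.Icc (0 : ℝ) 1, x + s • h ∈ Ω)
    (hspan : ∃ c : ℝ≥0∞, c ≠ ∞ ∧ ∀ h ∈ S, ∃ a : ι → ℝ, h = ∑ i, a i • e i ∧ ∀ i, ‖a i‖ₑ ≤ c)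
    (U : ℕ → formSpace 𝕜 Ω Γ e hμ) {B : ℝ} (hU : ∀ n, ‖U n‖ ≤ B) (hw : WeaklyNull 𝕜 U) :
    Tendsto (fun n => eLpNorm (formInclusion hμ 𝕜 Γ e (U n)) 2 (volume.restrict A)) atTop (𝓝 0) := by
  choose C hC hle using fun j => (hμ j).exists_eLpNorm_le (ε := 𝕜)
  have hcomp : ∀ n j, eLpNorm ((U n).1 j) 2 (volume.restrict Ω) ≤ (∑ j, C j) * ENNReal.ofReal B := by
    intro n j
    refine (hle j _).trans ?_
    gcongr
    · exact Finset.single_le_sum (f := C) (fun _ _ => bot_le) (Finset.mem_univ j)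
    · rw [← Lp.enorm_def, ← ofReal_norm]
      exact ENNReal.ofReal_le_ofReal ((PiLp.norm_apply_le (U n).1 j).trans (hU n))
  refine tendsto_eLpNorm_of_weak (p := fun n i => ((U n).1 (some i) : E → 𝕜)) hΩ hA hAfin hS hS0 hSb
    hseg hspan (fun n => (Lp.stronglyMeasurable _).measurable) (fun n => (U n).2.toMemSobolev)
    (B := (∑ j, C j) * ENNReal.ofReal B)
    (ENNReal.mul_ne_top (ENNReal.sum_ne_top.2 fun j _ => hC j) ENNReal.ofReal_ne_top)
    (fun n => hcomp n none) (fun n i => hcomp n (some i)) fun F hF hFm hFfin => ?_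
  obtain ⟨L, hL⟩ := exists_setIntegral_clm (𝕜 := 𝕜) (hμ none) hF hFfin
  have h1 := hw.map (L.comp (formInclusion hμ 𝕜 Γ e)) 1
  simpa [hL] using h1

end FormSpace

end

/-! ### The transverse problem: compact embedding and the Rayleigh quotient -/

section

open Filter Topology
open scoped ENNReal

theorem tendsto_eLpNorm_biUnion {α κ : Type*} [MeasurableSpace α] {μ : Measure α} {ε : Type*}
    [NormedAddCommGroup ε] {f : ℕ → α → ε} (T : Finset κ) (A : κ → Set α)
    (h : ∀ p ∈ T, Tendsto (fun n => eLpNorm (f n) 2 (μ.restrict (A p))) atTop (𝓝 0)) :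
    Tendsto (fun n => eLpNorm (f n) 2 (μ.restrict (⋃ p ∈ T, A p))) atTop (𝓝 0) := by
  have hsq : ∀ p ∈ T, Tendsto (fun n => ∫⁻ x in A p, ‖f n x‖ₑ ^ 2 ∂μ) atTop (𝓝 0) := fun p hp => by
    simpa [← eLpNorm_two_sq] using ENNReal.Tendsto.pow (n := 2) (h p hp)
  have hsum : Tendsto (fun n => ∑ p ∈ T, ∫⁻ x in A p, ‖f n x‖ₑ ^ 2 ∂μ) atTop (𝓝 0) := by
    simpa using tendsto_finsetSum T hsq
  have hle : ∀ n, ∫⁻ x in ⋃ p ∈ T, A p, ‖f n x‖ₑ ^ 2 ∂μ ≤ ∑ p ∈ T, ∫⁻ x in A p, ‖f n x‖ₑ ^ 2 ∂μ := by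
    intro n
    clear h hsq hsum
    classical
    induction T using Finset.induction_on with
    | empty => simp
    | insert a s ha ih =>
      rw [Finset.set_biUnion_insert, Finset.sum_insert ha]
      exact (lintegral_union_le _ _ _).trans (add_le_add_right ih _)
  have hlim := tendsto_of_tendsto_of_tendsto_of_le_of_le tendsto_const_nhds hsum
    (fun _ => bot_le) hle
  simp only [← eLpNorm_two_sq] at hlim
  have h3 := (ENNReal.continuous_rpow_const (y := (1 / 2 : ℝ))).tendsto 0 |>.comp hlim
  rw [ENNReal.zero_rpow_of_pos (by norm_num)] at h3
  refine h3.congr fun n => ?_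
  simp only [Function.comp]
  rw [← ENNReal.rpow_natCast, ← ENNReal.rpow_mul]
  norm_num

theorem exists_plane_coords {S : Set Plane} (hS : Bornology.IsBounded S) :
    ∃ c : ℝ≥0∞, c ≠ ∞ ∧ ∀ h ∈ S, ∃ a : Fin 2 → ℝ,
      h = ∑ i, a i • planeDir i ∧ ∀ i, ‖a i‖ₑ ≤ c := by
  obtain ⟨R, hR⟩ := hS.exists_norm_le
  refine ⟨ENNReal.ofReal R, ENNReal.ofReal_ne_top, fun h hh => ⟨h, ?_, fun i => ?_⟩⟩
  · ext j; fin_cases j <;> simp [planeDir]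
  · rw [← ofReal_norm]
    exact ENNReal.ofReal_le_ofReal ((PiLp.norm_apply_le h i).trans (hR h hh))

section Transverse

variable {ω γD : Set Plane}

/-- The Lebesgue measure on `ω`, for a function and for its two partial derivatives. -/
def transverseMeasure (ω : Set Plane) : Option (Fin 2) → Measure Plane := fun _ => volume.restrict ω

theorem comparable_transverseMeasure (ω : Set Plane) (j : Option (Fin 2)) :
    ComparableMeasures (volume.restrict ω) (transverseMeasure ω j) := .refl _

/-- The form space of the transverse problem. -/
abbrev transverseSpace (ω γD : Set Plane) :=
  formSpace ℝ ω γD planeDir (comparable_transverseMeasure ω)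

/-- The embedding of the form space of the transverse problem in `L²(ω)`. -/
abbrev transverseInclusion (ω γD : Set Plane) :
    transverseSpace ω γD →L[ℝ] Lp ℝ 2 (transverseMeasure ω none) :=
  formInclusion (comparable_transverseMeasure ω) ℝ γD planeDir

/-- Finitely many of the sets carrying a cone cover the bounded set `ω`, so the local compactness
sums up to Rellich's theorem. -/
theorem crossSection_tendsto_norm (hω : IsCrossSection ω)
    (U : ℕ → transverseSpace ω γD) (B : ℝ) (hU : ∀ n, ‖U n‖ ≤ B)
    (hw : WeaklyNull ℝ U) :
    Tendsto (fun n => ‖transverseInclusion ω γD (U n)‖) atTop (𝓝 0) := by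
  obtain ⟨T, V, S, hT, hcov⟩ := hω.exists_cones
  have h1 := tendsto_eLpNorm_biUnion (μ := volume) (f := fun n =>
    (transverseInclusion ω γD (U n) : Plane → ℝ)) T (fun p => ω ∩ V p)
    fun p hp => by
      obtain ⟨hV, hS, hS0, hSb, hseg⟩ := hT p hp
      exact formSpace_tendsto_eLpNorm _ hω.isOpen (hω.isOpen.inter hV)
        (hω.isBounded.subset Set.inter_subset_left).measure_lt_top.ne hS hS0 hSb hseg
        (exists_plane_coords hSb) U hU hw
  have hset : ⋃ p ∈ T, ω ∩ V p = ω := by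
    rw [← Set.inter_iUnion₂]; exact Set.inter_eq_left.2 hcov
  rw [hset] at h1
  have h2 := (ENNReal.tendsto_toReal ENNReal.zero_ne_top).comp h1
  rw [ENNReal.toReal_zero] at h2
  exact h2

theorem Lp_real_norm_sq {α : Type*} [MeasurableSpace α] {μ : Measure α} (f : Lp ℝ 2 μ) {u : α → ℝ}
    (h : f =ᵐ[μ] u) : ‖f‖ ^ 2 = ∫ x, u x ^ 2 ∂μ := by
  rw [← real_inner_self_eq_norm_sq, real_inner_eq_integral]
  refine integral_congr_ae ?_
  filter_upwards [h] with x hx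
  rw [hx, sq]

theorem exists_transverseSpace {φ : Plane → ℝ} {dφ : Fin 2 → Plane → ℝ}
    (hφ : MemSobolevZero ω γD planeDir φ dφ) :
    ∃ W : transverseSpace ω γD, transverseInclusion ω γD W =ᵐ[volume.restrict ω] φ ∧
      ∀ i, W.1 (some i) =ᵐ[volume.restrict ω] dφ i :=
  exists_formSpace_of_memSobolevZero (comparable_transverseMeasure ω)
    (fun j => (comparable_transverseMeasure ω j).symm) hφ

theorem transverse_norm_sq {W : transverseSpace ω γD} {φ : Plane → ℝ} {dφ : Fin 2 → Plane → ℝ}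
    (h : transverseInclusion ω γD W =ᵐ[volume.restrict ω] φ)
    (h' : ∀ i, W.1 (some i) =ᵐ[volume.restrict ω] dφ i) :
    ‖transverseInclusion ω γD W‖ ^ 2 = ∫ x in ω, φ x ^ 2 ∧
    ‖W‖ ^ 2 = (∫ x in ω, φ x ^ 2) + ∑ i, ∫ x in ω, dφ i x ^ 2 := by
  have h0 : ‖transverseInclusion ω γD W‖ ^ 2 = ∫ x in ω, φ x ^ 2 := Lp_real_norm_sq _ h
  refine ⟨h0, ?_⟩
  rw [formSpace_norm_sq_eq, h0]
  congr 1
  exact Finset.sum_congr rfl fun i _ => Lp_real_norm_sq _ (h' i)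

theorem transverse_inner {U W : transverseSpace ω γD} {φ χ : Plane → ℝ} {dφ dχ : Fin 2 → Plane → ℝ}
    (hU : transverseInclusion ω γD U =ᵐ[volume.restrict ω] φ)
    (hU' : ∀ i, U.1 (some i) =ᵐ[volume.restrict ω] dφ i)
    (hW : transverseInclusion ω γD W =ᵐ[volume.restrict ω] χ)
    (hW' : ∀ i, W.1 (some i) =ᵐ[volume.restrict ω] dχ i) :
    inner ℝ (transverseInclusion ω γD W) (transverseInclusion ω γD U) = ∫ x in ω, φ x * χ x ∧
    inner ℝ W U = (∫ x in ω, φ x * χ x) + ∑ i, ∫ x in ω, dφ i x * dχ i x := by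
  have key : ∀ (f g : Lp ℝ 2 ((volume : Measure Plane).restrict ω)) (a b : Plane → ℝ),
      f =ᵐ[volume.restrict ω] a → g =ᵐ[volume.restrict ω] b →
        inner ℝ g f = ∫ x in ω, a x * b x := fun f g a b hf hg => by
    rw [real_inner_eq_integral]
    refine integral_congr_ae ?_
    filter_upwards [hf, hg] with x hx hx'
    rw [hx, hx', mul_comm]
  have h0 := key _ _ _ _ hU hW
  refine ⟨h0, ?_⟩
  rw [formSpace_inner_eq]
  congr 1
  exact Finset.sum_congr rfl fun i _ => key _ _ _ _ (hU' i) (hW' i)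

/-- A ground state is only assumed to be least among eigenvalues; this provides an eigenvalue that
is the minimum of the Rayleigh quotient. The given `ψ` serves to ensure that the form domain is
nonzero. -/
theorem exists_minimal_eigenpair (hω : IsCrossSection ω) {ψ : Plane → ℝ} {dψ : Fin 2 → Plane → ℝ}
    (hψ : MemSobolevZero ω γD planeDir ψ dψ) (hψ1 : ∫ x in ω, ψ x ^ 2 = 1) :
    ∃ (μ : ℝ) (φ : Plane → ℝ) (dφ : Fin 2 → Plane → ℝ), IsTransverseEigenpair ω γD μ φ dφ ∧
      ∀ (χ : Plane → ℝ) (dχ : Fin 2 → Plane → ℝ), MemSobolevZero ω γD planeDir χ dχ →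
        μ * ∫ x in ω, χ x ^ 2 ≤ ∑ i, ∫ x in ω, dχ i x ^ 2 := by
  have hsep : Fact ((2 : ℝ≥0∞) ≠ ∞) := ⟨ENNReal.ofNat_ne_top⟩
  have hfin : IsSeparable (transverseMeasure ω none) :=
    inferInstanceAs (IsSeparable ((volume : Measure Plane).restrict ω))
  obtain ⟨Ψ, hΨ, hΨ'⟩ := exists_transverseSpace hψ
  have hΨ1 : 0 < ‖transverseInclusion ω γD Ψ‖ ^ 2 := by
    rw [(transverse_norm_sq hΨ hΨ').1, hψ1]
    exact one_pos
  obtain ⟨r, U, hr, hJU1, hU, hle⟩ := exists_minimizer_of_compact (transverseInclusion ω γD)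
    (crossSection_tendsto_norm hω) hΨ1
  -- The form norm contains the `L²` norm, which shifts the eigenvalue `r⁻¹` by one.
  refine ⟨r⁻¹ - 1, transverseInclusion ω γD U, fun i => U.1 (some i), ⟨U.2, ?_, fun v q hq => ?_⟩,
    fun χ dχ hχ => ?_⟩
  · rw [← (transverse_norm_sq (ae_eq_refl _) fun i => ae_eq_refl _).1, hJU1, one_pow]
  · obtain ⟨W, hW, hW'⟩ := exists_transverseSpace hq
    obtain ⟨h1, h2⟩ := transverse_inner (U := U) (ae_eq_refl _) (fun i => ae_eq_refl _) hW hW'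
    have h3 := hU W
    rw [h1, h2, Fin.sum_univ_two, ← integral_add] at h3
    · simp only [RCLike.ofReal_real_eq_id, id_eq] at h3
      linarith
    · exact integrable_mul_of_memLp (Lp.memLp (U.1 (some 0))) (hq.grad_memLp 0)
    · exact integrable_mul_of_memLp (Lp.memLp (U.1 (some 1))) (hq.grad_memLp 1)
  · obtain ⟨W, hW, hW'⟩ := exists_transverseSpace hχ
    obtain ⟨h1, h2⟩ := transverse_norm_sq hW hW'
    have h3 := hle W
    rw [h1, h2, ← inv_mul_le_iff₀ hr] at h3
    linarith

/-- The lowest eigenvalue of the transverse problem is the minimum of the Rayleigh quotient. -/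
theorem IsTransverseGroundState.le_dirichlet (hω : IsCrossSection ω) {lam : ℝ} {ψ : Plane → ℝ}
    {dψ : Fin 2 → Plane → ℝ} (hψ : IsTransverseGroundState ω γD lam ψ dψ) {φ : Plane → ℝ}
    {dφ : Fin 2 → Plane → ℝ} (hφ : MemSobolevZero ω γD planeDir φ dφ) :
    lam * ∫ x in ω, φ x ^ 2 ≤ ∑ i, ∫ x in ω, dφ i x ^ 2 := by
  obtain ⟨μ, χ, dχ, hχ, hle⟩ := exists_minimal_eigenpair hω hψ.mem hψ.normalized
  exact (mul_le_mul_of_nonneg_right (hψ.lowest _ _ _ hχ)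
    (integral_nonneg fun x => sq_nonneg _)).trans (hle φ dφ hφ)

theorem IsTransverseEigenpair.nonneg {lam : ℝ} {ψ : Plane → ℝ}
    {dψ : Fin 2 → Plane → ℝ} (hψ : IsTransverseEigenpair ω γD lam ψ dψ) : 0 ≤ lam := by
  have h := hψ.weak_eq ψ dψ hψ.mem
  have h1 : ∫ x in ω, ψ x * ψ x = 1 := by simpa only [sq] using hψ.normalized
  rw [h1, mul_one] at h
  rw [← h]
  exact integral_nonneg fun x => add_nonneg (mul_self_nonneg _) (mul_self_nonneg _)

end Transverse

end

/-! ### Partial pairings on a product and Parseval's identity -/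

section

open Filter Topology
open scoped ENNReal

section Pairing

variable {α β : Type*} [MeasurableSpace α] [MeasurableSpace β] {μ : Measure α} {ν : Measure β}
  [SFinite μ] [SFinite ν]

/-- The function `x ↦ ∫ θ(z) u(x, z) dν(z)`. -/
def partialPairing (ν : Measure β) (θ : β → ℝ) (u : α × β → ℝ) (x : α) : ℝ :=
  ∫ z, θ z * u (x, z) ∂ν

theorem eLpNorm_prod_two_sq {u : α × β → ℝ} (hu : AEStronglyMeasurable u (μ.prod ν)) :
    eLpNorm u 2 (μ.prod ν) ^ 2 = ∫⁻ x, eLpNorm (fun z => u (x, z)) 2 ν ^ 2 ∂μ := by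
  rw [eLpNorm_two_sq, lintegral_prod _ (hu.enorm.pow_const 2)]
  simp only [eLpNorm_two_sq]

theorem aemeasurable_eLpNorm_slice_sq {u : α × β → ℝ} (hu : AEStronglyMeasurable u (μ.prod ν)) :
    AEMeasurable (fun x => eLpNorm (fun z => u (x, z)) 2 ν ^ 2) μ := by
  simp only [eLpNorm_two_sq]
  exact (hu.enorm.pow_const 2).lintegral_prod_right'

theorem ae_memLp_slice {u : α × β → ℝ} (hu : MemLp u 2 (μ.prod ν)) :
    ∀ᵐ x ∂μ, MemLp (fun z => u (x, z)) 2 ν := by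
  have h : ∫⁻ x, eLpNorm (fun z => u (x, z)) 2 ν ^ 2 ∂μ ≠ ∞ := by
    rw [← eLpNorm_prod_two_sq hu.1]
    exact ENNReal.pow_ne_top hu.2.ne
  filter_upwards [hu.1.prodMk_left, ae_lt_top' (aemeasurable_eLpNorm_slice_sq hu.1) h] with x h1 h2
  refine ⟨h1, ?_⟩
  by_contra h3
  rw [not_lt, top_le_iff] at h3
  simp [h3] at h2

theorem eLpNorm_mul_prod_sq {η : α → ℝ} {θ : β → ℝ} (hη : AEStronglyMeasurable η μ)
    (hθ : AEStronglyMeasurable θ ν) :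
    eLpNorm (fun x : α × β => η x.1 * θ x.2) 2 (μ.prod ν) ^ 2
      = eLpNorm η 2 μ ^ 2 * eLpNorm θ 2 ν ^ 2 := by
  rw [eLpNorm_two_sq, eLpNorm_two_sq, eLpNorm_two_sq, ← lintegral_prod_mul
    (hη.enorm.pow_const 2) (hθ.enorm.pow_const 2)]
  simp only [enorm_mul, mul_pow]

theorem eLpNorm_mul_prod {η : α → ℝ} {θ : β → ℝ} (hη : AEStronglyMeasurable η μ)
    (hθ : AEStronglyMeasurable θ ν) :
    eLpNorm (fun x : α × β => η x.1 * θ x.2) 2 (μ.prod ν) = eLpNorm η 2 μ * eLpNorm θ 2 ν :=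
  le_antisymm
    ((ENNReal.pow_le_pow_left_iff two_ne_zero).1 (by rw [eLpNorm_mul_prod_sq hη hθ, mul_pow]))
    ((ENNReal.pow_le_pow_left_iff two_ne_zero).1 (by rw [eLpNorm_mul_prod_sq hη hθ, mul_pow]))

theorem memLp_mul_prod {η : α → ℝ} {θ : β → ℝ} (hη : MemLp η 2 μ) (hθ : MemLp θ 2 ν) :
    MemLp (fun x : α × β => η x.1 * θ x.2) 2 (μ.prod ν) :=
  ⟨hη.1.comp_fst.mul hθ.1.comp_snd, by
    rw [eLpNorm_mul_prod hη.1 hθ.1]; exact ENNReal.mul_lt_top hη.2 hθ.2⟩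

theorem aestronglyMeasurable_partialPairing {θ : β → ℝ} {u : α × β → ℝ}
    (hθ : AEStronglyMeasurable θ ν) (hu : AEStronglyMeasurable u (μ.prod ν)) :
    AEStronglyMeasurable (partialPairing ν θ u) μ :=
  (hθ.comp_snd.mul hu).integral_prod_right'

theorem eLpNorm_partialPairing_le {θ : β → ℝ} {u : α × β → ℝ}
    (hθ : AEStronglyMeasurable θ ν) (hu : AEStronglyMeasurable u (μ.prod ν)) :
    eLpNorm (partialPairing ν θ u) 2 μ ≤ eLpNorm θ 2 ν * eLpNorm u 2 (μ.prod ν) := by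
  rw [← ENNReal.pow_le_pow_left_iff two_ne_zero, mul_pow, eLpNorm_prod_two_sq hu,
    ← lintegral_const_mul'' _ (aemeasurable_eLpNorm_slice_sq hu), eLpNorm_two_sq]
  refine lintegral_mono_ae ?_
  filter_upwards [hu.prodMk_left] with x hx
  rw [← mul_pow]
  exact pow_le_pow_left' (enorm_integral_mul_le hθ hx) 2

theorem memLp_partialPairing {θ : β → ℝ} {u : α × β → ℝ}
    (hθ : MemLp θ 2 ν) (hu : MemLp u 2 (μ.prod ν)) : MemLp (partialPairing ν θ u) 2 μ :=
  ⟨aestronglyMeasurable_partialPairing hθ.1 hu.1,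
    (eLpNorm_partialPairing_le hθ.1 hu.1).trans_lt (ENNReal.mul_lt_top hθ.2 hu.2)⟩

theorem integral_mul_partialPairing {η : α → ℝ} {θ : β → ℝ} {u : α × β → ℝ}
    (hη : MemLp η 2 μ) (hθ : MemLp θ 2 ν) (hu : MemLp u 2 (μ.prod ν)) :
    ∫ x, η x * partialPairing ν θ u x ∂μ = ∫ x, η x.1 * θ x.2 * u x ∂(μ.prod ν) := by
  rw [integral_prod _ (integrable_mul_of_memLp (memLp_mul_prod hη hθ) hu)]
  simp only [partialPairing, mul_assoc, integral_const_mul]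

theorem partialPairing_sub_right {θ : β → ℝ} {u v : α × β → ℝ}
    (hθ : MemLp θ 2 ν) (hu : MemLp u 2 (μ.prod ν)) (hv : MemLp v 2 (μ.prod ν)) :
    partialPairing ν θ u - partialPairing ν θ v =ᵐ[μ] partialPairing ν θ (u - v) := by
  filter_upwards [ae_memLp_slice hu, ae_memLp_slice hv] with x h1 h2
  simp only [partialPairing, Pi.sub_apply, mul_sub]
  exact (integral_sub (integrable_mul_of_memLp hθ h1) (integrable_mul_of_memLp hθ h2)).symm

theorem partialPairing_sub_left {θ χ : β → ℝ} {u : α × β → ℝ}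
    (hθ : MemLp θ 2 ν) (hχ : MemLp χ 2 ν) (hu : MemLp u 2 (μ.prod ν)) :
    partialPairing ν θ u - partialPairing ν χ u =ᵐ[μ] partialPairing ν (θ - χ) u := by
  filter_upwards [ae_memLp_slice hu] with x h1
  simp only [partialPairing, Pi.sub_apply, sub_mul]
  exact (integral_sub (integrable_mul_of_memLp hθ h1) (integrable_mul_of_memLp hχ h1)).symm

/-- Distinct orthonormal vectors are at distance `√2`, so the balls of radius `1 / 2` about them are
disjoint. Countability allows sum and integral to be exchanged in Parseval's identity. -/
theorem countable_of_orthonormal {H ι : Type*} [NormedAddCommGroup H] [InnerProductSpace ℝ H]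
    [TopologicalSpace.SeparableSpace H] {v : ι → H} (hv : Orthonormal ℝ v) : Countable ι := by
  have hd : Pairwise (Function.onFun Disjoint fun i => Metric.ball (v i) (1 / 2)) := by
    intro i j hij
    refine Metric.ball_disjoint_ball ?_
    have h1 : ‖v i - v j‖ ^ 2 = 2 := by
      rw [@norm_sub_sq_real, hv.1 i, hv.1 j, hv.2 hij]; norm_num
    rw [dist_eq_norm]
    nlinarith [norm_nonneg (v i - v j)]
  exact hd.countable_of_isOpen_disjoint (fun i => Metric.isOpen_ball)
    fun i => ⟨v i, Metric.mem_ball_self (by norm_num)⟩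

/-- Parseval's identity in the second variable. -/
theorem tsum_eLpNorm_partialPairing_sq {ι : Type*} [Countable ι] (b : HilbertBasis ι ℝ (Lp ℝ 2 ν))
    {u : α × β → ℝ} (hu : MemLp u 2 (μ.prod ν)) :
    ∑' i, eLpNorm (partialPairing ν (b i) u) 2 μ ^ 2 = eLpNorm u 2 (μ.prod ν) ^ 2 := by
  have hm : ∀ i, AEStronglyMeasurable (partialPairing ν (b i) u) μ := fun i =>
    aestronglyMeasurable_partialPairing (Lp.memLp (b i)).1 hu.1
  simp only [eLpNorm_prod_two_sq hu.1, eLpNorm_two_sq (partialPairing _ _ _)]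
  rw [← lintegral_tsum fun i => (hm i).enorm.pow_const 2]
  refine lintegral_congr_ae ?_
  filter_upwards [ae_memLp_slice hu] with x hx
  have h1 := b.hasSum_inner_mul_inner (hx.toLp _) (hx.toLp _)
  have h2 : ∀ i, inner ℝ (hx.toLp _) (b i) * inner ℝ (b i) (hx.toLp _)
      = (partialPairing ν (b i) u x) ^ 2 := fun i => by
    rw [real_inner_comm, ← sq, real_inner_eq_integral]
    congr 1
    refine integral_congr_ae ?_
    filter_upwards [hx.coeFn_toLp] with z hz
    rw [hz]
  simp only [h2] at h1
  rw [real_inner_self_eq_norm_sq, Lp.norm_toLp] at h1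
  have h3 : ∀ i, ‖partialPairing ν (b i) u x‖ₑ ^ 2
      = ENNReal.ofReal (partialPairing ν (b i) u x ^ 2) := fun i => by
    rw [← sq_abs, ENNReal.ofReal_pow (abs_nonneg _), ← Real.norm_eq_abs, ofReal_norm]
  simp only [h3]
  rw [← ENNReal.ofReal_tsum_of_nonneg (fun i => sq_nonneg _) h1.summable, h1.tsum_eq,
    ENNReal.ofReal_pow ENNReal.toReal_nonneg, ENNReal.ofReal_toReal hx.2.ne]

end Pairing

end

/-! ### From the transverse inequality to the tube -/

section

open Filter Topology
open scoped ENNReal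

section TubeSlices

variable {ω γD : Set Plane}

theorem restrict_straightTube (ω : Set Plane) :
    (volume : Measure (Plane × ℝ)).restrict (straightTube ω)
      = ((volume : Measure Plane).restrict ω).prod volume := by
  rw [straightTube, Measure.volume_eq_prod, ← Measure.prod_restrict, Measure.restrict_univ]

theorem restrict_prod_set (ω : Set Plane) (J : Set ℝ) :
    (volume : Measure (Plane × ℝ)).restrict (ω ×ˢ J)
      = ((volume : Measure Plane).restrict ω).prod (volume.restrict J) := by
  rw [Measure.volume_eq_prod, ← Measure.prod_restrict]

theorem tubeDir_castSucc (i : Fin 2) : tubeDir i.castSucc = (planeDir i, 0) := by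
  fin_cases i <;> rfl

theorem tsupport_mul_prod_subset {E F : Type*} [TopologicalSpace E] [TopologicalSpace F]
    (η : E → ℝ) (θ : F → ℝ) :
    tsupport (fun x : E × F => η x.1 * θ x.2) ⊆ tsupport η ×ˢ tsupport θ := by
  rw [tsupport, tsupport, tsupport, ← closure_prod_eq]
  refine closure_mono fun x hx => ?_
  exact ⟨left_ne_zero_of_mul hx, right_ne_zero_of_mul hx⟩

theorem IsTestFunction.mul_prod {η : Plane → ℝ} {θ : ℝ → ℝ} (hη : IsTestFunction ω η)
    (hθ : IsTestFunction Set.univ θ) :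
    IsTestFunction (straightTube ω) fun x : Plane × ℝ => η x.1 * θ x.2 where
  contDiff := (hη.contDiff.comp contDiff_fst).mul (hθ.contDiff.comp contDiff_snd)
  hasCompactSupport := (hη.hasCompactSupport.isCompact.prod
    hθ.hasCompactSupport.isCompact).of_isClosed_subset (isClosed_tsupport _)
    (tsupport_mul_prod_subset η θ)
  tsupport_subset := (tsupport_mul_prod_subset η θ).trans
    (Set.prod_mono hη.tsupport_subset (Set.subset_univ _))

theorem fderiv_mul_prod_apply {η : Plane → ℝ} {θ : ℝ → ℝ} (hη : Differentiable ℝ η)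
    (hθ : Differentiable ℝ θ) (x : Plane × ℝ) (v : Plane) (s : ℝ) :
    fderiv ℝ (fun x : Plane × ℝ => η x.1 * θ x.2) x (v, s)
      = fderiv ℝ η x.1 v * θ x.2 + η x.1 * (s * deriv θ x.2) := by
  have h1 : HasFDerivAt (fun x : Plane × ℝ => η x.1) ((fderiv ℝ η x.1).comp
      (ContinuousLinearMap.fst ℝ Plane ℝ)) x := (hη x.1).hasFDerivAt.comp x hasFDerivAt_fst
  have h2 : HasFDerivAt (fun x : Plane × ℝ => θ x.2) ((fderiv ℝ θ x.2).comp
      (ContinuousLinearMap.snd ℝ Plane ℝ)) x := (hθ x.2).hasFDerivAt.comp x hasFDerivAt_snd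
  have h3 : HasFDerivAt (fun x : Plane × ℝ => η x.1 * θ x.2) _ x := h1.mul h2
  rw [h3.fderiv]
  simp [mul_comm]
  ring

/-- Test the weak derivatives on the tube with products `η(x') θ(x₃)` and use Fubini. -/
theorem MemSobolev.partialPairing {u : Plane × ℝ → ℝ} {p : Fin 3 → Plane × ℝ → ℝ}
    (hu : MemSobolev (straightTube ω) tubeDir u p) {θ : ℝ → ℝ} (hθ : IsTestFunction Set.univ θ) :
    MemSobolev ω planeDir (partialPairing volume θ u)
      fun i => BentTube.partialPairing volume θ (p i.castSucc) := by
  have hθm : MemLp θ 2 volume := memLp_ofReal_of_hasCompactSupport (𝕜 := ℝ)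
    hθ.contDiff.continuous hθ.hasCompactSupport volume
  have hum := hu.memLp
  have hpm := hu.grad_memLp
  rw [restrict_straightTube] at hum
  simp only [restrict_straightTube] at hpm
  refine ⟨memLp_partialPairing hθm hum, fun i => memLp_partialPairing hθm (hpm _),
    fun i η hη => ?_⟩
  have h := hu.weak_deriv i.castSucc _ (hη.mul_prod hθ)
  simp only [RCLike.ofReal_real_eq_id, id] at h ⊢
  have h1 : MemLp (fun x => fderiv ℝ η x (planeDir i)) 2 (volume.restrict ω) :=
    hη.memLp_fderiv (𝕜 := ℝ) _ ω
  have h2 : MemLp η 2 (volume.restrict ω) := hη.memLp (𝕜 := ℝ) ω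
  rw [integral_mul_partialPairing h1 hθm hum, integral_mul_partialPairing h2 hθm (hpm _),
    ← restrict_straightTube, ← h]
  congr 1 with x
  rw [tubeDir_castSucc, fderiv_mul_prod_apply (hη.contDiff.differentiable (by simp))
    (hθ.contDiff.differentiable (by simp))]
  simp

/-- The tube lemma: a neighbourhood of `γD × ℝ` may shrink at infinity, but over the compact support
of `θ` it contains a product neighbourhood. -/
theorem partialPairing_vanishing {θ : ℝ → ℝ} (hθ : HasCompactSupport θ)
    {w : Plane × ℝ → ℝ} {U : Set (Plane × ℝ)} (hU : IsOpen U) (hΓ : lateralDirichlet γD ⊆ U)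
    (hw : ∀ᵐ x ∂(volume.restrict (straightTube ω)), x ∈ U → w x = 0) :
    ∃ V : Set Plane, IsOpen V ∧ γD ⊆ V ∧
      ∀ᵐ x ∂(volume.restrict ω), x ∈ V → partialPairing volume θ w x = 0 := by
  refine ⟨{x | ∀ z ∈ tsupport θ, (x, z) ∈ U}, ?_, fun x hx z _ => hΓ ⟨hx, trivial⟩, ?_⟩
  · rw [isOpen_iff_eventually]
    exact fun x hx => hθ.isCompact.eventually_forall_of_forall_eventually
      fun z hz => hU.mem_nhds (hx z hz)
  · rw [restrict_straightTube] at hw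
    filter_upwards [Measure.ae_ae_of_ae_prod hw] with x hx hxV
    refine integral_eq_zero_of_ae ?_
    filter_upwards [hx] with z hz
    by_cases h : z ∈ tsupport θ
    · simp [hz (hxV z h)]
    · simp [image_eq_zero_of_notMem_tsupport h]

theorem MemSobolevZero.partialPairing {u : Plane × ℝ → ℝ} {p : Fin 3 → Plane × ℝ → ℝ}
    (hu : MemSobolevZero (straightTube ω) (lateralDirichlet γD) tubeDir u p) {θ : ℝ → ℝ}
    (hθ : IsTestFunction Set.univ θ) :
    MemSobolevZero ω γD planeDir (BentTube.partialPairing volume θ u)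
      fun i => BentTube.partialPairing volume θ (p i.castSucc) := by
  have h0 := hu.toMemSobolev.partialPairing hθ
  have hθm : MemLp θ 2 volume := memLp_ofReal_of_hasCompactSupport (𝕜 := ℝ)
    hθ.contDiff.continuous hθ.hasCompactSupport volume
  have key : ∀ {f g : Plane × ℝ → ℝ}, MemLp f 2 (volume.restrict (straightTube ω)) →
      MemLp g 2 (volume.restrict (straightTube ω)) → ∀ {δ ε : ℝ≥0∞},
      eLpNorm (f - g) 2 (volume.restrict (straightTube ω)) < δ → eLpNorm θ 2 volume * δ < ε →
      eLpNorm (BentTube.partialPairing volume θ f - BentTube.partialPairing volume θ g) 2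
        (volume.restrict ω) < ε := by
    intro f g hf hg δ ε h1 h2
    rw [restrict_straightTube] at hf hg h1
    rw [eLpNorm_congr_ae (partialPairing_sub_right hθm hf hg)]
    refine (eLpNorm_partialPairing_le hθm.1 (hf.sub hg).1).trans_lt (lt_of_le_of_lt ?_ h2)
    gcongr
  refine .of_approx h0.memLp h0.grad_memLp fun ε hε => ?_
  obtain ⟨δ, hδ, hδε⟩ := exists_pos_mul_lt_ennreal _ hθm.2.ne hε
  obtain ⟨w, q, hwq, ⟨U, hU, hΓ, hw⟩, h1, h2⟩ := hu.approx δ hδ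
  exact ⟨_, _, hwq.partialPairing hθ, partialPairing_vanishing hθ.hasCompactSupport hU hΓ hw,
    key hu.memLp hwq.memLp h1 hδε, fun i => key (hu.grad_memLp _) (hwq.grad_memLp _) (h2 _) hδε⟩

/-- The pairing with an arbitrary square integrable function of the longitudinal variable. -/
theorem MemSobolevZero.partialPairing_Lp {u : Plane × ℝ → ℝ} {p : Fin 3 → Plane × ℝ → ℝ}
    (hu : MemSobolevZero (straightTube ω) (lateralDirichlet γD) tubeDir u p) {J : Set ℝ}
    (hJ : IsOpen J) (θ : Lp ℝ 2 (volume.restrict J)) :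
    MemSobolevZero ω γD planeDir (BentTube.partialPairing (volume.restrict J) θ u)
      fun i => BentTube.partialPairing (volume.restrict J) θ (p i.castSucc) := by
  have hr : ∀ {f : Plane × ℝ → ℝ}, MemLp f 2 (volume.restrict (straightTube ω)) →
      MemLp f 2 (((volume : Measure Plane).restrict ω).prod (volume.restrict J)) := fun {f} hf => by
    rw [← restrict_prod_set]
    exact hf.mono_measure (Measure.restrict_mono (Set.prod_mono subset_rfl (Set.subset_univ _)) le_rfl)
  have hum := hr hu.memLp
  have hpm := fun i => hr (hu.grad_memLp i)
  have hθ := Lp.memLp θ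
  refine .of_approx_zero (memLp_partialPairing hθ hum)
    (fun i => memLp_partialPairing hθ (hpm _)) fun ε hε => ?_
  set C := eLpNorm u 2 (((volume : Measure Plane).restrict ω).prod (volume.restrict J))
    + ∑ i, eLpNorm (p i) 2 (((volume : Measure Plane).restrict ω).prod (volume.restrict J)) with hC
  have hC' : C ≠ ∞ := ENNReal.add_ne_top.2 ⟨hum.2.ne, (ENNReal.sum_lt_top.2 fun i _ => (hpm i).2).ne⟩
  obtain ⟨δ, hδ, hδε⟩ := exists_pos_mul_lt_ennreal C hC' hε
  have hmem : θ ∈ closure (testSubmodule J : Set (Lp ℝ 2 (volume.restrict J))) := by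
    have : θ ∈ (testSubmodule J).topologicalClosure := by rw [dense_testSubmodule hJ]; trivial
    exact this
  obtain ⟨f, ⟨φ, hφ, hfφ⟩, hf⟩ := EMetric.mem_closure_iff.1 hmem δ hδ
  rw [Lp.edist_def] at hf
  have hpair : ∀ v : Plane × ℝ → ℝ, BentTube.partialPairing volume φ v
      = BentTube.partialPairing (volume.restrict J) f v := fun v => by
    ext x
    rw [BentTube.partialPairing, BentTube.partialPairing,
      ← setIntegral_eq_integral_of_forall_compl_eq_zero (s := J)]
    · refine integral_congr_ae ?_
      filter_upwards [hfφ] with z hz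
      rw [hz]
    · intro z hz
      rw [image_eq_zero_of_notMem_tsupport fun h => hz (hφ.tsupport_subset h), zero_mul]
  have key : ∀ {v : Plane × ℝ → ℝ},
      MemLp v 2 (((volume : Measure Plane).restrict ω).prod (volume.restrict J)) →
      eLpNorm v 2 (((volume : Measure Plane).restrict ω).prod (volume.restrict J)) ≤ C →
      eLpNorm (BentTube.partialPairing (volume.restrict J) θ v
        - BentTube.partialPairing volume φ v) 2 (volume.restrict ω) < ε := fun {v} hv hvC => by
    rw [hpair, eLpNorm_congr_ae (partialPairing_sub_left hθ (Lp.memLp f) hv)]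
    refine (eLpNorm_partialPairing_le (hθ.sub (Lp.memLp f)).1 hv.1).trans_lt
      (lt_of_le_of_lt ?_ hδε)
    rw [mul_comm]
    gcongr
  refine ⟨_, _, hu.partialPairing (hφ.mono (Set.subset_univ J)), key hum le_self_add,
    fun i => key (hpm _) ?_⟩
  exact (Finset.single_le_sum (f := fun i => eLpNorm (p i) 2
    (((volume : Measure Plane).restrict ω).prod (volume.restrict J))) (fun _ _ => bot_le)
    (Finset.mem_univ i.castSucc)).trans le_add_self

theorem toReal_eLpNorm_sq {α : Type*} [MeasurableSpace α] {μ : Measure α} {f : α → ℝ}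
    (hf : MemLp f 2 μ) : ENNReal.ofReal (∫ x, f x ^ 2 ∂μ) = eLpNorm f 2 μ ^ 2 := by
  rw [eLpNorm_two_sq, ofReal_integral_eq_lintegral_ofReal hf.integrable_sq
    (Eventually.of_forall fun x => sq_nonneg _)]
  refine lintegral_congr fun x => ?_
  rw [← sq_abs, ENNReal.ofReal_pow (abs_nonneg _), ← Real.norm_eq_abs, ofReal_norm]

variable {lam : ℝ} {ψ : Plane → ℝ} {dψ : Fin 2 → Plane → ℝ}

theorem IsTransverseGroundState.eLpNorm_le (hω : IsCrossSection ω)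
    (hψ : IsTransverseGroundState ω γD lam ψ dψ) {φ : Plane → ℝ} {dφ : Fin 2 → Plane → ℝ}
    (hφ : MemSobolevZero ω γD planeDir φ dφ) :
    ENNReal.ofReal lam * eLpNorm φ 2 (volume.restrict ω) ^ 2
      ≤ ∑ i, eLpNorm (dφ i) 2 (volume.restrict ω) ^ 2 := by
  have h := hψ.le_dirichlet hω hφ
  have h0 : 0 ≤ lam := hψ.toIsTransverseEigenpair.nonneg
  rw [← toReal_eLpNorm_sq hφ.memLp, ← ENNReal.ofReal_mul h0]
  simp only [← toReal_eLpNorm_sq (hφ.grad_memLp _)]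
  rw [← ENNReal.ofReal_sum_of_nonneg fun i _ => integral_nonneg fun x => sq_nonneg _]
  exact ENNReal.ofReal_le_ofReal h

/-- The transverse energy of a function on the tube is at least `λ` times its mass, on each open
part of the tube. -/
theorem IsTransverseGroundState.tube_eLpNorm_le (hω : IsCrossSection ω)
    (hψ : IsTransverseGroundState ω γD lam ψ dψ) {u : Plane × ℝ → ℝ} {p : Fin 3 → Plane × ℝ → ℝ}
    (hu : MemSobolevZero (straightTube ω) (lateralDirichlet γD) tubeDir u p) {J : Set ℝ}
    (hJ : IsOpen J) :
    ENNReal.ofReal lam * eLpNorm u 2 (volume.restrict (ω ×ˢ J)) ^ 2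
      ≤ ∑ i : Fin 2, eLpNorm (p i.castSucc) 2 (volume.restrict (ω ×ˢ J)) ^ 2 := by
  have hsep : Fact ((2 : ℝ≥0∞) ≠ ∞) := ⟨ENNReal.ofNat_ne_top⟩
  -- Individual slices `u(·, z)` would need an argument that almost all of them lie in the
  -- transverse form domain. The coefficients in a Hilbert basis of `L²(J)` do lie there, each
  -- satisfies the transverse inequality, and Parseval adds these up.
  obtain ⟨s, b, -⟩ := exists_hilbertBasis ℝ (Lp ℝ 2 ((volume : Measure ℝ).restrict J))
  have hs : Countable s := countable_of_orthonormal b.orthonormal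
  have hsub : volume.restrict (ω ×ˢ J) ≤ (volume : Measure (Plane × ℝ)).restrict (straightTube ω) :=
    Measure.restrict_mono (Set.prod_mono subset_rfl (Set.subset_univ _)) le_rfl
  have hum := hu.memLp.mono_measure hsub
  have hpm := fun i => (hu.grad_memLp i).mono_measure hsub
  rw [restrict_prod_set] at hum ⊢
  simp only [restrict_prod_set] at hpm
  rw [← tsum_eLpNorm_partialPairing_sq b hum, ← ENNReal.tsum_mul_left]
  simp only [← tsum_eLpNorm_partialPairing_sq b (hpm _)]
  rw [← Summable.tsum_finsetSum fun i _ => ENNReal.summable]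
  exact ENNReal.tsum_le_tsum fun k => hψ.eLpNorm_le hω (hu.partialPairing_Lp hJ (b k))

end TubeSlices

end

/-! ### Products of a transverse and a longitudinal function -/

section

open Filter Topology
open scoped ENNReal

section Product

variable {ω γD : Set Plane}

theorem IsTestFunction.slice_left {Φ : Plane × ℝ → ℝ} (hΦ : IsTestFunction (straightTube ω) Φ)
    (z : ℝ) : IsTestFunction ω fun x => Φ (x, z) where
  contDiff := hΦ.contDiff.comp (contDiff_id.prodMk contDiff_const)
  hasCompactSupport := hΦ.hasCompactSupport.comp_isClosedEmbedding
    ⟨isEmbedding_prodMkLeft z, by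
      have h : Set.range (fun x : Plane => (x, z)) = Set.univ ×ˢ {z} := by ext ⟨a, b⟩; simp [eq_comm]
      rw [h]; exact isClosed_univ.prod isClosed_singleton⟩
  tsupport_subset := by
    have h : tsupport (fun x => Φ (x, z)) ⊆ (fun x => (x, z)) ⁻¹' tsupport Φ :=
      tsupport_comp_subset_preimage Φ (by fun_prop)
    exact fun x hx => (hΦ.tsupport_subset (h hx)).1

theorem IsTestFunction.slice_right {Φ : Plane × ℝ → ℝ} (hΦ : IsTestFunction (straightTube ω) Φ)
    (x : Plane) : IsTestFunction Set.univ fun z => Φ (x, z) where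
  contDiff := hΦ.contDiff.comp (contDiff_const.prodMk contDiff_id)
  hasCompactSupport := hΦ.hasCompactSupport.comp_isClosedEmbedding
    ⟨isEmbedding_prodMkRight x, by
      have h : Set.range (fun z : ℝ => (x, z)) = {x} ×ˢ Set.univ := by ext ⟨a, b⟩; simp [eq_comm]
      rw [h]; exact isClosed_singleton.prod isClosed_univ⟩
  tsupport_subset := Set.subset_univ _

theorem fderiv_slice_left {Φ : Plane × ℝ → ℝ} (hΦ : Differentiable ℝ Φ) (x v : Plane) (z : ℝ) :
    fderiv ℝ (fun y => Φ (y, z)) x v = fderiv ℝ Φ (x, z) (v, 0) := by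
  have h : HasFDerivAt (fun y => Φ (y, z)) ((fderiv ℝ Φ (x, z)).comp
      (ContinuousLinearMap.inl ℝ Plane ℝ)) x :=
    (hΦ (x, z)).hasFDerivAt.comp x (hasFDerivAt_prodMk_left x z)
  rw [h.fderiv]; simp

theorem deriv_slice_right {Φ : Plane × ℝ → ℝ} (hΦ : Differentiable ℝ Φ) (x : Plane) (z : ℝ) :
    deriv (fun s => Φ (x, s)) z = fderiv ℝ Φ (x, z) (0, 1) := by
  have h : HasFDerivAt (fun s => Φ (x, s)) ((fderiv ℝ Φ (x, z)).comp
      (ContinuousLinearMap.inr ℝ Plane ℝ)) z :=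
    (hΦ (x, z)).hasFDerivAt.comp z (hasFDerivAt_prodMk_right x z)
  rw [← fderiv_apply_one_eq_deriv, h.fderiv]; simp

theorem integral_deriv_mul_eq_neg {φ χ : ℝ → ℝ} (hφ : IsTestFunction Set.univ φ)
    (hχ : IsTestFunction Set.univ χ) :
    ∫ z, deriv φ z * χ z = - ∫ z, φ z * deriv χ z := by
  have c1 := hφ.contDiff.continuous
  have c2 := hχ.contDiff.continuous
  have d1 : Continuous (deriv φ) := hφ.contDiff.continuous_deriv (by simp)
  have d2 : Continuous (deriv χ) := hχ.contDiff.continuous_deriv (by simp)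
  have h := integral_mul_deriv_eq_deriv_mul_of_integrable (u := φ) (v := χ) (u' := deriv φ)
    (v' := deriv χ) (fun z _ => (hφ.contDiff.differentiable (by simp) z).hasDerivAt)
    (fun z _ => (hχ.contDiff.differentiable (by simp) z).hasDerivAt)
    ((c1.mul d2).integrable_of_hasCompactSupport hφ.hasCompactSupport.mul_right)
    ((d1.mul c2).integrable_of_hasCompactSupport hχ.hasCompactSupport.mul_left)
    ((c1.mul c2).integrable_of_hasCompactSupport hφ.hasCompactSupport.mul_right)
  rw [h, neg_neg]

/-- The gradient of `(x, z) ↦ w(x) φ(z)`, where `q = ∇w`. -/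
def productGradient (w : Plane → ℝ) (q : Fin 2 → Plane → ℝ) (φ : ℝ → ℝ) :
    Fin 3 → Plane × ℝ → ℝ :=
  Fin.snoc (α := fun _ => Plane × ℝ → ℝ) (fun i x => q i x.1 * φ x.2) fun x => w x.1 * deriv φ x.2

theorem productGradient_castSucc (w : Plane → ℝ) (q : Fin 2 → Plane → ℝ) (φ : ℝ → ℝ) (i : Fin 2) :
    productGradient w q φ i.castSucc = fun x => q i x.1 * φ x.2 := Fin.snoc_castSucc ..

theorem productGradient_last (w : Plane → ℝ) (q : Fin 2 → Plane → ℝ) (φ : ℝ → ℝ) :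
    productGradient w q φ (Fin.last 2) = fun x => w x.1 * deriv φ x.2 := Fin.snoc_last ..

theorem IsTestFunction.memLp_deriv {φ : ℝ → ℝ} (hφ : IsTestFunction Set.univ φ) :
    MemLp (deriv φ) 2 volume := by
  have h := hφ.memLp_fderiv (𝕜 := ℝ) 1 Set.univ
  simpa using h

theorem IsTestFunction.memLp_univ {φ : ℝ → ℝ} (hφ : IsTestFunction Set.univ φ) :
    MemLp φ 2 volume := by
  simpa using hφ.memLp (𝕜 := ℝ) Set.univ

/-- With Fubini, the longitudinal derivative is classical integration by parts for fixed `x'`, and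
the transverse ones are the weak derivatives of `w` tested with a slice of `Φ`. -/
theorem MemSobolev.mul_prod {w : Plane → ℝ} {q : Fin 2 → Plane → ℝ}
    (hw : MemSobolev ω planeDir w q) {φ : ℝ → ℝ} (hφ : IsTestFunction Set.univ φ) :
    MemSobolev (straightTube ω) tubeDir (fun x => w x.1 * φ x.2) (productGradient w q φ) where
  memLp := by
    rw [restrict_straightTube]; exact memLp_mul_prod hw.memLp hφ.memLp_univ
  grad_memLp i := by
    rw [restrict_straightTube]
    induction i using Fin.lastCases with
    | last => rw [productGradient_last]; exact memLp_mul_prod hw.memLp hφ.memLp_deriv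
    | cast i =>
      rw [productGradient_castSucc]; exact memLp_mul_prod (hw.grad_memLp i) hφ.memLp_univ
  weak_deriv i Φ hΦ := by
    have hd : Differentiable ℝ Φ := hΦ.contDiff.differentiable (by simp)
    have m0 : MemLp Φ 2 (volume.restrict (straightTube ω)) := hΦ.memLp (𝕜 := ℝ) _
    have m1 : MemLp (fun x => fderiv ℝ Φ x (tubeDir i)) 2 (volume.restrict (straightTube ω)) :=
      hΦ.memLp_fderiv (𝕜 := ℝ) _ _
    have n0 : MemLp (fun x : Plane × ℝ => w x.1 * φ x.2) 2 (volume.restrict (straightTube ω)) := by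
      rw [restrict_straightTube]; exact memLp_mul_prod hw.memLp hφ.memLp_univ
    have n1 : MemLp (productGradient w q φ i) 2 (volume.restrict (straightTube ω)) := by
      rw [restrict_straightTube]
      induction i using Fin.lastCases with
      | last => rw [productGradient_last]; exact memLp_mul_prod hw.memLp hφ.memLp_deriv
      | cast i =>
        rw [productGradient_castSucc]; exact memLp_mul_prod (hw.grad_memLp i) hφ.memLp_univ
    have i0 := integrable_mul_of_memLp m1 n0
    have i1 := integrable_mul_of_memLp m0 n1
    simp only [RCLike.ofReal_real_eq_id, id]
    rw [restrict_straightTube] at i0 i1 ⊢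
    induction i using Fin.lastCases with
    | last =>
      rw [productGradient_last] at i1 ⊢
      rw [integral_prod _ i0, integral_prod _ i1, ← integral_neg]
      congr 1 with x
      have h := integral_deriv_mul_eq_neg (hΦ.slice_right x) hφ
      simp only [deriv_slice_right hd] at h
      have e1 : ∀ z, fderiv ℝ Φ (x, z) (tubeDir (Fin.last 2)) * (w x * φ z)
          = w x * (fderiv ℝ Φ (x, z) (0, 1) * φ z) := fun z => by
        rw [show tubeDir (Fin.last 2) = (0, 1) from rfl]; ring
      have e2 : ∀ z, Φ (x, z) * (w x * deriv φ z) = w x * (Φ (x, z) * deriv φ z) := fun z => by ring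
      simp only [e1, e2, integral_const_mul, h, mul_neg]
    | cast i =>
      rw [productGradient_castSucc] at i1 ⊢
      rw [integral_prod_symm _ i0, integral_prod_symm _ i1, ← integral_neg]
      congr 1 with z
      have h := hw.weak_deriv i _ (hΦ.slice_left z)
      simp only [RCLike.ofReal_real_eq_id, id, fderiv_slice_left hd] at h
      have e1 : ∀ x, fderiv ℝ Φ (x, z) (tubeDir i.castSucc) * (w x * φ z)
          = φ z * (fderiv ℝ Φ (x, z) (planeDir i, 0) * w x) := fun x => by
        rw [tubeDir_castSucc]; ring
      have e2 : ∀ x, Φ (x, z) * (q i x * φ z) = φ z * (Φ (x, z) * q i x) := fun x => by ring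
      simp only [e1, e2, integral_const_mul, h, mul_neg]

theorem MemSobolevZero.mul_prod {w : Plane → ℝ} {q : Fin 2 → Plane → ℝ}
    (hw : MemSobolevZero ω γD planeDir w q) {φ : ℝ → ℝ} (hφ : IsTestFunction Set.univ φ) :
    MemSobolevZero (straightTube ω) (lateralDirichlet γD) tubeDir
      (fun x => w x.1 * φ x.2) (productGradient w q φ) where
  toMemSobolev := hw.toMemSobolev.mul_prod hφ
  approx ε hε := by
    have m0 := hφ.memLp_univ
    have m1 := hφ.memLp_deriv
    obtain ⟨δ, hδ, hδε⟩ := exists_pos_mul_lt_ennreal (eLpNorm φ 2 volume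
      + eLpNorm (deriv φ) 2 volume) (ENNReal.add_ne_top.2 ⟨m0.2.ne, m1.2.ne⟩) hε
    obtain ⟨v, r, hv, ⟨U, hU, hΓ, h0⟩, h1, h2⟩ := hw.approx δ hδ
    have key : ∀ {f g : Plane → ℝ} {χ : ℝ → ℝ}, MemLp f 2 (volume.restrict ω) →
        MemLp g 2 (volume.restrict ω) → MemLp χ 2 volume →
        eLpNorm χ 2 volume ≤ eLpNorm φ 2 volume + eLpNorm (deriv φ) 2 volume →
        eLpNorm (f - g) 2 (volume.restrict ω) < δ →
        eLpNorm ((fun x : Plane × ℝ => f x.1 * χ x.2) - fun x => g x.1 * χ x.2) 2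
          (volume.restrict (straightTube ω)) < ε := by
      intro f g χ hf hg hχ hle hfg
      have e : ((fun x : Plane × ℝ => f x.1 * χ x.2) - fun x => g x.1 * χ x.2)
          = fun x => (f - g) x.1 * χ x.2 := by
        ext x; simp [sub_mul]
      rw [e, restrict_straightTube, eLpNorm_mul_prod (hf.sub hg).1 hχ.1, mul_comm]
      exact (mul_le_mul' hle hfg.le).trans_lt hδε
    refine ⟨_, _, hv.mul_prod hφ, ⟨U ×ˢ Set.univ, hU.prod isOpen_univ,
      Set.prod_mono hΓ subset_rfl, ?_⟩, key hw.memLp hv.memLp m0 le_self_add h1, fun i => ?_⟩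
    · rw [restrict_straightTube]
      filter_upwards [Measure.quasiMeasurePreserving_fst.ae h0] with x hx hxU
      rw [hx hxU.1, zero_mul]
    · induction i using Fin.lastCases with
      | last =>
        rw [productGradient_last, productGradient_last]
        exact key hw.memLp hv.memLp m1 le_add_self h1
      | cast i =>
        rw [productGradient_castSucc, productGradient_castSucc]
        exact key (hw.grad_memLp i) (hv.grad_memLp i) m0 le_self_add (h2 i)

end Product

end

/-! ### The energy of the trial function -/

section

open Filter Topology
open scoped ENNReal

section Trial

variable {ω γD : Set Plane} {lam : ℝ} {ψ : Plane → ℝ} {dψ : Fin 2 → Plane → ℝ} {κ β : ℝ → ℝ}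

/-- `κ (A₁ cos β + A₂ sin β)`. -/
def bendingDensity (ω : Set Plane) (ψ : Plane → ℝ) (dψ : Fin 2 → Plane → ℝ) (κ β : ℝ → ℝ)
    (z : ℝ) : ℝ :=
  κ z * (transverseMean ω ψ dψ 0 * Real.cos (β z) + transverseMean ω ψ dψ 1 * Real.sin (β z))

theorem contDiff_weight_slice (κ β : ℝ → ℝ) (z : ℝ) :
    ContDiff ℝ (⊤ : ℕ∞) fun x : Plane => weight κ β (x, z) := by
  simp only [weight]
  generalize Real.cos (β z) = c, Real.sin (β z) = s, κ z = k
  fun_prop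

theorem fderiv_weight_slice (κ β : ℝ → ℝ) (z : ℝ) (x v : Plane) :
    fderiv ℝ (fun x : Plane => weight κ β (x, z)) x v
      = -(v 0 * Real.cos (β z) + v 1 * Real.sin (β z)) * κ z := by
  have h0 : ∀ i : Fin 2, HasFDerivAt (fun x : Plane => x i)
      (EuclideanSpace.proj i : Plane →L[ℝ] ℝ) x := fun i =>
    (EuclideanSpace.proj i : Plane →L[ℝ] ℝ).hasFDerivAt
  have h : HasFDerivAt (fun x : Plane => weight κ β (x, z)) _ x :=
    ((((h0 0).mul_const (Real.cos (β z))).add ((h0 1).mul_const (Real.sin (β z)))).mul_const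
      (κ z)).const_sub 1
  rw [h.fderiv]
  simp
  ring

theorem fderiv_weight_slice_planeDir (κ β : ℝ → ℝ) (z : ℝ) (x : Plane) :
    fderiv ℝ (fun x : Plane => weight κ β (x, z)) x (planeDir 0) = -(κ z * Real.cos (β z)) ∧
    fderiv ℝ (fun x : Plane => weight κ β (x, z)) x (planeDir 1) = -(κ z * Real.sin (β z)) := by
  constructor <;> rw [fderiv_weight_slice] <;> simp [planeDir] <;> ring

/-- The weak equation is tested with `g(·, z) ψ`, which is admissible since the weight is smooth in
`x'`. The transverse gradient of the weight is `-κ (cos β, sin β)`, and its product with `ψ ∇ψ`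
integrates to the bending density. -/
theorem transverse_weighted_energy (hω : IsOpen ω) (hωb : Bornology.IsBounded ω)
    (hψ : IsTransverseEigenpair ω γD lam ψ dψ) (z : ℝ) :
    (∑ i, ∫ x in ω, weight κ β (x, z) * dψ i x ^ 2) - lam * ∫ x in ω, weight κ β (x, z) * ψ x ^ 2
      = bendingDensity ω ψ dψ κ β z := by
  set G : Plane → ℝ := fun x => weight κ β (x, z) with hG
  have hGd : ContDiff ℝ (⊤ : ℕ∞) G := contDiff_weight_slice κ β z
  obtain ⟨C, hC⟩ := (hωb.isCompact_closure).exists_bound_of_continuousOn hGd.continuous.continuousOn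
  have hGb : ∀ x ∈ ω, ‖G x‖ ≤ C := fun x hx => hC x (subset_closure hx)
  obtain ⟨hd0, hd1⟩ := And.intro (fun x => (fderiv_weight_slice_planeDir κ β z x).1)
    (fun x => (fderiv_weight_slice_planeDir κ β z x).2)
  have hmem := hψ.mem.smooth_mul hω.measurableSet hGd (C := max C |κ z|)
    (fun x hx => (hGb x hx).trans (le_max_left _ _)) (fun i x hx => by
      refine le_trans ?_ (le_max_right _ _)
      fin_cases i
      · simp only [hG, Fin.zero_eta, hd0, norm_neg, norm_mul, Real.norm_eq_abs]
        exact mul_le_of_le_one_right (abs_nonneg _) (Real.abs_cos_le_one _)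
      · simp only [hG, Fin.mk_one, hd1, norm_neg, norm_mul, Real.norm_eq_abs]
        exact mul_le_of_le_one_right (abs_nonneg _) (Real.abs_sin_le_one _))
  have hw := hψ.weak_eq _ _ hmem
  have hGm : ∀ {f : Plane → ℝ}, MemLp f 2 (volume.restrict ω) →
      MemLp (fun x => G x * f x) 2 (volume.restrict ω) := fun {f} hf =>
    hf.of_le_mul (c := C) (hGd.continuous.aestronglyMeasurable.mul hf.1)
      ((ae_restrict_iff' hω.measurableSet).2 (Eventually.of_forall fun x hx => by
        rw [norm_mul]; gcongr; exact hGb x hx))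
  have i1 : ∀ i, Integrable (fun x => G x * dψ i x ^ 2) (volume.restrict ω) := fun i => by
    refine (integrable_mul_of_memLp (hGm (hψ.mem.grad_memLp i)) (hψ.mem.grad_memLp i)).congr
      (Eventually.of_forall fun x => ?_)
    simp only; ring
  have i2 : ∀ i, Integrable (fun x => ψ x * dψ i x) (volume.restrict ω) := fun i =>
    integrable_mul_of_memLp hψ.mem.memLp (hψ.mem.grad_memLp i)
  have e1 : ∫ x in ω, (dψ 0 x * (G x * dψ 0 x + fderiv ℝ G x (planeDir 0) * ψ x)
        + dψ 1 x * (G x * dψ 1 x + fderiv ℝ G x (planeDir 1) * ψ x))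
      = (∑ i, ∫ x in ω, G x * dψ i x ^ 2) - bendingDensity ω ψ dψ κ β z := by
    simp only [hd0, hd1, hG]
    rw [Fin.sum_univ_two, ← integral_add (i1 0) (i1 1), bendingDensity, transverseMean, transverseMean,
      mul_add, mul_comm (∫ x in ω, ψ x * dψ 0 x), mul_comm (∫ x in ω, ψ x * dψ 1 x), ← mul_assoc,
      ← mul_assoc, ← integral_const_mul, ← integral_const_mul,
      ← integral_add ((i2 0).const_mul _) ((i2 1).const_mul _),
      ← integral_sub (f := fun x => G x * dψ 0 x ^ 2 + G x * dψ 1 x ^ 2)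
        (g := fun x => κ z * Real.cos (β z) * (ψ x * dψ 0 x) + κ z * Real.sin (β z) * (ψ x * dψ 1 x))
        ((i1 0).add (i1 1)) (((i2 0).const_mul _).add ((i2 1).const_mul _))]
    congr 1 with x
    ring
  have e2 : ∫ x in ω, ψ x * (G x * ψ x) = ∫ x in ω, G x * ψ x ^ 2 := by
    congr 1 with x; ring
  rw [e1, e2] at hw
  linarith

theorem continuous_weight (hκ : Continuous κ) (hβ : Continuous β) : Continuous (weight κ β) := by
  unfold weight
  fun_prop

theorem continuous_bendingDensity (hκ : Continuous κ) (hβ : Continuous β) :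
    Continuous (bendingDensity ω ψ dψ κ β) := by
  unfold bendingDensity
  fun_prop

theorem integral_weight_mul_prod_sq {f : Plane → ℝ} {φ : ℝ → ℝ} {a : Plane × ℝ → ℝ} {C : ℝ}
    (hω : MeasurableSet ω)
    (ha : AEStronglyMeasurable a (volume.restrict (straightTube ω)))
    (hC : ∀ x ∈ straightTube ω, ‖a x‖ ≤ C)
    (hf : MemLp f 2 (volume.restrict ω)) (hφ : MemLp φ 2 volume) :
    Integrable (fun x => a x * (f x.1 * φ x.2) ^ 2) (volume.restrict (straightTube ω)) ∧
    Integrable (fun z => φ z ^ 2 * ∫ x in ω, a (x, z) * f x ^ 2) ∧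
    ∫ x in straightTube ω, a x * (f x.1 * φ x.2) ^ 2
      = ∫ z, φ z ^ 2 * ∫ x in ω, a (x, z) * f x ^ 2 := by
  have hm : MemLp (fun x : Plane × ℝ => f x.1 * φ x.2) 2 (volume.restrict (straightTube ω)) := by
    rw [restrict_straightTube]; exact memLp_mul_prod hf hφ
  have hi : Integrable (fun x => a x * (f x.1 * φ x.2) ^ 2) (volume.restrict (straightTube ω)) :=
    hm.integrable_sq.bdd_mul ha ((ae_restrict_iff' (hω.prod MeasurableSet.univ)).2
      (Eventually.of_forall hC))
  have e : ∀ z, ∫ x in ω, a (x, z) * (f x * φ z) ^ 2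
      = φ z ^ 2 * ∫ x in ω, a (x, z) * f x ^ 2 := fun z => by
    rw [← integral_const_mul]
    congr 1 with x; ring
  refine ⟨hi, ?_, ?_⟩
  · rw [restrict_straightTube] at hi
    simpa only [e] using hi.integral_prod_right
  · rw [restrict_straightTube] at hi ⊢
    rw [integral_prod_symm _ hi]
    simp only [e]

/-- Integrate the preceding identity against `φ²`. In the longitudinal term, `g⁻¹ ≤ m⁻¹` and the
normalization of `ψ` leave `m⁻¹ ∫ φ'²`. -/
theorem trial_energy_le (hω : IsOpen ω) (hωb : Bornology.IsBounded ω) (hκ : Continuous κ)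
    (hβ : Continuous β) {m C : ℝ} (hm : 0 < m) (hmw : ∀ x ∈ straightTube ω, m ≤ weight κ β x)
    (hCw : ∀ x ∈ straightTube ω, weight κ β x ≤ C)
    (hψ : IsTransverseEigenpair ω γD lam ψ dψ) {φ : ℝ → ℝ} (hφ : IsTestFunction Set.univ φ) :
    (∑ i : Fin 2, ∫ x in straightTube ω, weight κ β x * (productGradient ψ dψ φ i.castSucc x) ^ 2)
      + ∫ x in straightTube ω, (weight κ β x)⁻¹ * (productGradient ψ dψ φ (Fin.last 2) x) ^ 2
      ≤ lam * (∫ x in straightTube ω, weight κ β x * (ψ x.1 * φ x.2) ^ 2)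
        + (∫ z, φ z ^ 2 * bendingDensity ω ψ dψ κ β z) + m⁻¹ * ∫ z, deriv φ z ^ 2 := by
  have hwc := continuous_weight hκ hβ
  have hQ : MeasurableSet (straightTube ω) := hω.measurableSet.prod MeasurableSet.univ
  have hb : ∀ x ∈ straightTube ω, ‖weight κ β x‖ ≤ C := fun x hx => by
    rw [Real.norm_of_nonneg (hm.le.trans (hmw x hx))]; exact hCw x hx
  have hb' : ∀ x ∈ straightTube ω, ‖(weight κ β x)⁻¹‖ ≤ m⁻¹ := fun x hx => by
    rw [norm_inv, Real.norm_of_nonneg (hm.le.trans (hmw x hx))]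
    exact inv_anti₀ hm (hmw x hx)
  have k0 := integral_weight_mul_prod_sq hω.measurableSet hwc.aestronglyMeasurable hb
    hψ.mem.memLp hφ.memLp_univ
  have k1 := fun i => integral_weight_mul_prod_sq hω.measurableSet hwc.aestronglyMeasurable hb
    (hψ.mem.grad_memLp i) hφ.memLp_univ
  have k2 := integral_weight_mul_prod_sq (C := m⁻¹) (a := fun x => (weight κ β x)⁻¹)
    hω.measurableSet hwc.measurable.inv.aestronglyMeasurable hb' hψ.mem.memLp hφ.memLp_deriv
  have k3 := integral_weight_mul_prod_sq (C := ‖m⁻¹‖) (a := fun _ => m⁻¹) hω.measurableSet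
    aestronglyMeasurable_const (fun _ _ => le_rfl) hψ.mem.memLp hφ.memLp_deriv
  have e3 : ∫ x in straightTube ω, (weight κ β x)⁻¹ * (ψ x.1 * deriv φ x.2) ^ 2
      ≤ m⁻¹ * ∫ z, deriv φ z ^ 2 := by
    calc _ ≤ ∫ x in straightTube ω, m⁻¹ * (ψ x.1 * deriv φ x.2) ^ 2 :=
          setIntegral_mono_on k2.1 k3.1 hQ fun x hx => by
            have := (Real.le_norm_self _).trans (hb' x hx)
            gcongr
      _ = _ := by
        rw [k3.2.2, ← integral_const_mul]
        simp only [integral_const_mul, hψ.normalized, mul_one, mul_comm]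
  simp only [productGradient_castSucc, productGradient_last]
  have e1 : (∑ i : Fin 2, ∫ x in straightTube ω, weight κ β x * (dψ i x.1 * φ x.2) ^ 2)
      = lam * (∫ x in straightTube ω, weight κ β x * (ψ x.1 * φ x.2) ^ 2)
        + ∫ z, φ z ^ 2 * bendingDensity ω ψ dψ κ β z := by
    simp only [(k1 _).2.2, k0.2.2]
    rw [← integral_finsetSum _ fun i _ => (k1 i).2.1, ← integral_const_mul, ← sub_eq_iff_eq_add',
      ← integral_sub (integrable_finsetSum _ fun i _ => (k1 i).2.1) (k0.2.1.const_mul lam)]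
    congr 1 with z
    rw [← transverse_weighted_energy hω hωb hψ, ← Finset.mul_sum]
    ring
  rw [e1]
  linarith

/-- Take `φ z = χ(z / n)` with a fixed bump `χ` equal to `1` on `[-1, 1]`. For large `n` it is `1`
on the interval, outside the interval the contribution is nonpositive, and `∫ φ'²` is `n⁻¹ ∫ χ'²` by
scaling. -/
theorem exists_cutoff {E : ℝ → ℝ} (hEc : Continuous E) {c d : ℝ} (m : ℝ)
    (hI : ∫ z in Set.Icc c d, E z < 0) (hout : ∀ z, z ∉ Set.Icc c d → E z ≤ 0) :
    ∃ φ : ℝ → ℝ, IsTestFunction Set.univ φ ∧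
      (∫ z, φ z ^ 2 * E z) + m⁻¹ * ∫ z, deriv φ z ^ 2 < 0 := by
  obtain ⟨χ, hχd, hχc, hχ1⟩ : ∃ χ : ℝ → ℝ, ContDiff ℝ (⊤ : ℕ∞) χ ∧ HasCompactSupport χ ∧
      ∀ z, |z| ≤ 1 → χ z = 1 := by
    let b : ContDiffBump (0 : ℝ) := ⟨1, 2, one_pos, one_lt_two⟩
    exact ⟨b, b.contDiff, b.hasCompactSupport, fun z hz => b.one_of_mem_closedBall (by
      simpa [b] using hz)⟩
  set φ : ℕ → ℝ → ℝ := fun n z => χ (z * (n : ℝ)⁻¹) with hφ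
  have hlim : Tendsto (fun n : ℕ => (n : ℝ)⁻¹ * (m⁻¹ * ∫ z, deriv χ z ^ 2)) atTop (𝓝 0) := by
    have := (tendsto_inv_atTop_nhds_zero_nat (𝕜 := ℝ)).mul_const (m⁻¹ * ∫ z, deriv χ z ^ 2)
    rwa [zero_mul] at this
  have hpos : 0 < -∫ z in Set.Icc c d, E z := neg_pos.2 hI
  obtain ⟨n, h1, h2, h3⟩ := ((hlim.eventually_lt_const hpos).and
    ((tendsto_natCast_atTop_atTop.eventually_ge_atTop (max |c| |d|)).and
      (eventually_gt_atTop 0))).exists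
  have hn : (0 : ℝ) < n := by exact_mod_cast h3
  have hφn : IsTestFunction Set.univ (φ n) := by
    refine ⟨hχd.comp (contDiff_id.mul contDiff_const), ?_, Set.subset_univ _⟩
    exact hχc.comp_homeomorph (Homeomorph.mulRight₀ _ (inv_ne_zero hn.ne'))
  refine ⟨φ n, hφn, ?_⟩
  have hder : ∀ z, deriv (φ n) z = deriv χ (z * (n : ℝ)⁻¹) * (n : ℝ)⁻¹ := fun z => by
    have h : HasDerivAt (φ n) (deriv χ (z * (n : ℝ)⁻¹) * (1 * (n : ℝ)⁻¹)) z :=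
      ((hχd.differentiable (by simp)) _).hasDerivAt.comp z ((hasDerivAt_id z).mul_const _)
    rw [h.deriv, one_mul]
  have hder2 : ∫ z, deriv (φ n) z ^ 2 = (n : ℝ)⁻¹ * ∫ z, deriv χ z ^ 2 := by
    simp only [hder, mul_pow, integral_mul_const]
    rw [Measure.integral_comp_mul_right (fun z => deriv χ z ^ 2), inv_inv, abs_of_pos hn, smul_eq_mul]
    field_simp
  have hφc : Continuous (φ n) := hφn.contDiff.continuous
  have hint : Integrable fun z => φ n z ^ 2 * E z := by
    have h : HasCompactSupport fun z => φ n z * (φ n z * E z) := hφn.hasCompactSupport.mul_right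
    refine ((hφc.mul (hφc.mul hEc)).integrable_of_hasCompactSupport h).congr
      (Eventually.of_forall fun z => ?_)
    simp only [sq, mul_assoc, Pi.mul_apply]
  have hone : ∀ z ∈ Set.Icc c d, φ n z = 1 := fun z hz => by
    refine hχ1 _ ?_
    rw [abs_mul, abs_inv, abs_of_pos hn, ← div_eq_mul_inv, div_le_iff₀ hn, one_mul]
    refine le_trans ?_ h2
    exact abs_le_max_abs_abs hz.1 hz.2
  have hle : ∫ z, φ n z ^ 2 * E z ≤ ∫ z in Set.Icc c d, E z := by
    rw [← integral_add_compl (measurableSet_Icc (a := c) (b := d)) hint]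
    have h4 : ∫ z in Set.Icc c d, φ n z ^ 2 * E z = ∫ z in Set.Icc c d, E z :=
      setIntegral_congr_fun measurableSet_Icc fun z hz => by simp [hone z hz]
    have h5 : ∫ z in (Set.Icc c d)ᶜ, φ n z ^ 2 * E z ≤ 0 :=
      setIntegral_nonpos measurableSet_Icc.compl fun z hz =>
        mul_nonpos_of_nonneg_of_nonpos (sq_nonneg _) (hout z hz)
    linarith
  rw [hder2, ← mul_assoc, mul_comm m⁻¹, mul_assoc]
  linarith

end Trial

end

/-! ### Weighted measures on the tube -/

section

open Filter Topology
open scoped ENNReal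

section TubeMeasure

variable {ω γD : Set Plane} {κ β : ℝ → ℝ} {m C : ℝ}

/-- The weight lies between the positive constants `m` and `C` on the tube. -/
structure IsTubeWeight (ω : Set Plane) (κ β : ℝ → ℝ) (m C : ℝ) : Prop where
  measurableSet : MeasurableSet ω
  continuous_curvature : Continuous κ
  continuous_angle : Continuous β
  pos : 0 < m
  le_weight : ∀ x ∈ straightTube ω, m ≤ weight κ β x
  weight_le : ∀ x ∈ straightTube ω, weight κ β x ≤ C

/-- The weights of a function and of its three partial derivatives in the form of the tube. -/
def tubeDensity (κ β : ℝ → ℝ) : Option (Fin 3) → Plane × ℝ → ℝ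
  | none => weight κ β
  | some 0 => weight κ β
  | some 1 => weight κ β
  | some 2 => fun x => (weight κ β x)⁻¹

/-- The measures with the densities `tubeDensity`. -/
def tubeMeasure (ω : Set Plane) (κ β : ℝ → ℝ) (j : Option (Fin 3)) : Measure (Plane × ℝ) :=
  (volume.restrict (straightTube ω)).withDensity fun x => ENNReal.ofReal (tubeDensity κ β j x)

theorem tubeDensity_castSucc (i : Fin 2) : tubeDensity κ β (some i.castSucc) = weight κ β := by
  fin_cases i <;> rfl

theorem tubeDensity_last : tubeDensity κ β (some (Fin.last 2)) = fun x => (weight κ β x)⁻¹ := rfl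

theorem comparableMeasures_withDensity {α : Type*} [MeasurableSpace α] {μ : Measure α} {ρ : α → ℝ}
    {a b : ℝ} (ha : 0 < a) (hle : ∀ᵐ x ∂μ, a ≤ ρ x) (hge : ∀ᵐ x ∂μ, ρ x ≤ b) :
    ComparableMeasures μ (μ.withDensity fun x => ENNReal.ofReal (ρ x)) := by
  have h1 : ENNReal.ofReal a • μ ≤ μ.withDensity fun x => ENNReal.ofReal (ρ x) := by
    rw [← withDensity_const]
    exact withDensity_mono (hle.mono fun x hx => ENNReal.ofReal_le_ofReal hx)
  have h2 : μ.withDensity (fun x => ENNReal.ofReal (ρ x)) ≤ ENNReal.ofReal b • μ := by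
    rw [← withDensity_const]
    exact withDensity_mono (hge.mono fun x hx => ENNReal.ofReal_le_ofReal hx)
  have hsmul : ∀ {c d : ℝ≥0∞}, c ≤ d → ∀ ν : Measure α, c • ν ≤ d • ν := fun hcd ν s => by
    simp only [Measure.smul_apply, smul_eq_mul]
    gcongr
  refine ⟨max (ENNReal.ofReal a⁻¹) (ENNReal.ofReal b), by simp, ?_,
    h2.trans (hsmul (le_max_right _ _) μ)⟩
  refine le_trans ?_ (hsmul (le_max_left _ _) _)
  intro s
  have h3 := h1 s
  simp only [Measure.smul_apply, smul_eq_mul] at h3 ⊢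
  calc μ s = ENNReal.ofReal a⁻¹ * (ENNReal.ofReal a * μ s) := by
        rw [← mul_assoc, ← ENNReal.ofReal_mul (inv_nonneg.2 ha.le), inv_mul_cancel₀ ha.ne',
          ENNReal.ofReal_one, one_mul]
    _ ≤ _ := by gcongr

instance isAddHaarMeasure_tube : (volume : Measure (Plane × ℝ)).IsAddHaarMeasure := by
  rw [Measure.volume_eq_prod]
  exact Measure.prod.instIsAddHaarMeasure _ _

theorem IsTubeWeight.measurable_weight (h : IsTubeWeight ω κ β m C) : Measurable (weight κ β) :=
  (continuous_weight h.2 h.3).measurable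

theorem IsTubeWeight.measurableSet_tube (h : IsTubeWeight ω κ β m C) :
    MeasurableSet (straightTube ω) := h.1.prod MeasurableSet.univ

theorem IsTubeWeight.measurable_density (h : IsTubeWeight ω κ β m C) (j : Option (Fin 3)) :
    Measurable (tubeDensity κ β j) := by
  match j with
  | none => exact h.measurable_weight
  | some 0 => exact h.measurable_weight
  | some 1 => exact h.measurable_weight
  | some 2 => exact h.measurable_weight.inv

theorem IsTubeWeight.density_bounds (h : IsTubeWeight ω κ β m C) (j : Option (Fin 3)) :
    ∃ a b : ℝ, 0 < a ∧ ∀ x ∈ straightTube ω, a ≤ tubeDensity κ β j x ∧ tubeDensity κ β j x ≤ b := by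
  have h1 : ∀ x ∈ straightTube ω, m ≤ weight κ β x ∧ weight κ β x ≤ max C 1 := fun x hx =>
    ⟨h.le_weight x hx, (h.weight_le x hx).trans (le_max_left _ _)⟩
  -- Nothing makes `C` positive when `ω` is empty; the maximum with `1` can always be inverted, to
  -- bound `g⁻¹` from below.
  have hC : 0 < max C 1 := lt_max_of_lt_right one_pos
  match j with
  | none => exact ⟨m, max C 1, h.pos, h1⟩
  | some 0 => exact ⟨m, max C 1, h.pos, h1⟩
  | some 1 => exact ⟨m, max C 1, h.pos, h1⟩
  | some 2 => exact ⟨(max C 1)⁻¹, m⁻¹, inv_pos.2 hC, fun x hx =>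
      ⟨inv_anti₀ (h.pos.trans_le (h1 x hx).1) (h1 x hx).2, inv_anti₀ h.pos (h1 x hx).1⟩⟩

theorem IsTubeWeight.density_nonneg (h : IsTubeWeight ω κ β m C) (j : Option (Fin 3)) {x}
    (hx : x ∈ straightTube ω) : 0 ≤ tubeDensity κ β j x := by
  obtain ⟨a, b, ha, hab⟩ := h.density_bounds j
  exact ha.le.trans (hab x hx).1

theorem IsTubeWeight.comparable (h : IsTubeWeight ω κ β m C) (j : Option (Fin 3)) :
    ComparableMeasures (volume.restrict (straightTube ω)) (tubeMeasure ω κ β j) := by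
  obtain ⟨a, b, ha, hab⟩ := h.density_bounds j
  have hQ := h.measurableSet_tube
  exact comparableMeasures_withDensity ha
    ((ae_restrict_iff' hQ).2 (Eventually.of_forall fun x hx => (hab x hx).1))
    ((ae_restrict_iff' hQ).2 (Eventually.of_forall fun x hx => (hab x hx).2))

theorem IsTubeWeight.integral_eq {F : Type*} [NormedAddCommGroup F] [NormedSpace ℝ F]
    (h : IsTubeWeight ω κ β m C) (j : Option (Fin 3)) (f : Plane × ℝ → F) :
    ∫ x, f x ∂tubeMeasure ω κ β j = ∫ x in straightTube ω, tubeDensity κ β j x • f x := by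
  rw [tubeMeasure, integral_withDensity_eq_integral_toReal_smul
    (h.measurable_density j).ennreal_ofReal (Eventually.of_forall fun _ => ENNReal.ofReal_lt_top)]
  refine setIntegral_congr_fun h.measurableSet_tube fun x hx => ?_
  simp only [ENNReal.toReal_ofReal (h.density_nonneg j hx)]

theorem Lp_complex_norm_sq {α : Type*} [MeasurableSpace α] {μ : Measure α} (f : Lp ℂ 2 μ)
    {u : α → ℂ} (hf : f =ᵐ[μ] u) : ‖f‖ ^ 2 = ∫ x, ‖u x‖ ^ 2 ∂μ := by
  have h : ((‖f‖ ^ 2 : ℝ) : ℂ) = ((∫ x, ‖u x‖ ^ 2 ∂μ : ℝ) : ℂ) := by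
    have h1 := inner_self_eq_norm_sq_to_K (𝕜 := ℂ) f
    rw [L2.inner_def] at h1
    push_cast
    rw [← integral_complex_ofReal]
    refine h1.symm.trans (integral_congr_ae ?_)
    filter_upwards [hf] with x hx
    rw [hx, inner_self_eq_norm_sq_to_K]
    push_cast
    rfl
  exact_mod_cast h

theorem IsTubeWeight.norm_sq (h : IsTubeWeight ω κ β m C) {j : Option (Fin 3)}
    (f : Lp ℂ 2 (tubeMeasure ω κ β j)) {u : Plane × ℝ → ℂ} (hf : f =ᵐ[tubeMeasure ω κ β j] u) :
    ‖f‖ ^ 2 = ∫ x in straightTube ω, tubeDensity κ β j x * ‖u x‖ ^ 2 := by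
  rw [Lp_complex_norm_sq f hf, h.integral_eq]
  rfl

theorem IsTubeWeight.tubeForm_eq (h : IsTubeWeight ω κ β m C) {p q : Fin 3 → Plane × ℝ → ℂ}
    (hp : ∀ i, MemLp (p i) 2 (volume.restrict (straightTube ω)))
    (hq : ∀ i, MemLp (q i) 2 (volume.restrict (straightTube ω))) :
    ∑ i, ∫ x, inner ℂ (q i x) (p i x) ∂tubeMeasure ω κ β (some i) = tubeForm ω κ β p q := by
  have hi : ∀ i, Integrable (fun x => tubeDensity κ β (some i) x • inner ℂ (q i x) (p i x))
      (volume.restrict (straightTube ω)) := fun i => by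
    obtain ⟨a, b, ha, hab⟩ := h.density_bounds (some i)
    have h1 : Integrable (fun x => p i x * star (q i x)) (volume.restrict (straightTube ω)) :=
      integrable_mul_of_memLp (hp i) (hq i).star
    refine Integrable.bdd_smul h1 b (h.measurable_density (some i)).aestronglyMeasurable
      ((ae_restrict_iff' h.measurableSet_tube).2 (Eventually.of_forall fun x hx => ?_))
    rw [Real.norm_of_nonneg (h.density_nonneg _ hx)]
    exact (hab x hx).2
  simp only [h.integral_eq]
  rw [← integral_finsetSum _ fun i _ => hi i, tubeForm]
  congr 1 with x
  rw [Fin.sum_univ_three]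
  simp only [tubeDensity, RCLike.inner_apply, Complex.real_smul, Complex.ofReal_inv]
  simp only [RCLike.star_def]
  ring

/-- The weighted space of the operator is by definition the `none` component of the form space, so
the abstract description applies once the two expressions of the form agree. -/
theorem IsTubeWeight.tubeOperator_iff (h : IsTubeWeight ω κ β m C)
    (u f : Lp ℂ 2 (tubeMeasure ω κ β none)) :
    (u, f) ∈ tubeOperator ω γD κ β ↔
      u = formResolvent (formInclusion h.comparable ℂ (lateralDirichlet γD) tubeDir) (u + f) := by
  rw [← formOperator_iff h.comparable fun j => (h.comparable j).symm]
  refine exists_congr fun p => and_congr_right fun hp => ?_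
  refine forall_congr' fun v => forall_congr' fun q => forall_congr' fun hq => ?_
  rw [h.tubeForm_eq hp.grad_memLp hq.grad_memLp]
  rfl

instance separableSpace_Lp_tube (j : Option (Fin 3)) :
    TopologicalSpace.SeparableSpace (Lp ℂ 2 (tubeMeasure ω κ β j)) := by
  have h2 : Fact ((2 : ℝ≥0∞) ≠ ∞) := ⟨ENNReal.ofNat_ne_top⟩
  have h3 : SigmaFinite (tubeMeasure ω κ β j) := by unfold tubeMeasure; infer_instance
  infer_instance

/-- Where the axis is straight, the form has no weights. -/
theorem IsTubeWeight.restrict_eq (h : IsTubeWeight ω κ β m C) (j : Option (Fin 3)) {J : Set ℝ}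
    (hJ : MeasurableSet J) (h0 : ∀ z ∈ J, κ z = 0) :
    (tubeMeasure ω κ β j).restrict (Set.univ ×ˢ J) = volume.restrict (ω ×ˢ J) := by
  have hS : MeasurableSet ((Set.univ : Set Plane) ×ˢ J) := MeasurableSet.univ.prod hJ
  have hset : ((Set.univ : Set Plane) ×ˢ J) ∩ straightTube ω = ω ×ˢ J := by
    rw [straightTube, Set.prod_inter_prod, Set.univ_inter, Set.inter_univ]
  have hw : ∀ x : Plane × ℝ, x.2 ∈ J → weight κ β x = 1 := fun x hx => by
    simp [weight, h0 _ hx]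
  have hd : ∀ x : Plane × ℝ, x.2 ∈ J → tubeDensity κ β j x = 1 := fun x hx => by
    match j with
    | none => exact hw x hx
    | some 0 => exact hw x hx
    | some 1 => exact hw x hx
    | some 2 => simp [tubeDensity, hw x hx]
  rw [tubeMeasure, restrict_withDensity hS, Measure.restrict_restrict hS, hset,
    withDensity_congr_ae (g := 1), withDensity_one]
  refine (ae_restrict_iff' (h.measurableSet.prod hJ)).2 (Eventually.of_forall fun x hx => ?_)
  simp [hd x hx.2]

theorem IsTubeWeight.restrict_le (h : IsTubeWeight ω κ β m C) {K : Set ℝ} (hK : MeasurableSet K) :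
    (tubeMeasure ω κ β none).restrict (Set.univ ×ˢ K)
      ≤ ENNReal.ofReal C • volume.restrict (ω ×ˢ K) := by
  have hS : MeasurableSet ((Set.univ : Set Plane) ×ˢ K) := MeasurableSet.univ.prod hK
  have hset : ((Set.univ : Set Plane) ×ˢ K) ∩ straightTube ω = ω ×ˢ K := by
    rw [straightTube, Set.prod_inter_prod, Set.univ_inter, Set.inter_univ]
  rw [tubeMeasure, restrict_withDensity hS, Measure.restrict_restrict hS, hset, ← withDensity_const]
  refine withDensity_mono ?_
  refine (ae_restrict_iff' (h.measurableSet.prod hK)).2 (Eventually.of_forall fun x hx => ?_)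
  exact ENNReal.ofReal_le_ofReal (h.weight_le x ⟨hx.1, trivial⟩)

end TubeMeasure

end

/-! ### Mass and energy on the tube -/

section

open Filter Topology
open scoped ENNReal

section TubeEnergy

variable {ω γD : Set Plane} {lam : ℝ} {ψ : Plane → ℝ} {dψ : Fin 2 → Plane → ℝ} {κ β : ℝ → ℝ}
  {m C : ℝ}

theorem eLpNorm_complex_sq {α : Type*} [MeasurableSpace α] {μ : Measure α} {u : α → ℂ}
    (hu : AEStronglyMeasurable u μ) :
    eLpNorm u 2 μ ^ 2 = eLpNorm (fun x => (u x).re) 2 μ ^ 2 + eLpNorm (fun x => (u x).im) 2 μ ^ 2 := by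
  have hsq : ∀ t : ℝ, ‖t‖ₑ ^ 2 = ENNReal.ofReal (t ^ 2) := fun t => by
    rw [← sq_abs, ENNReal.ofReal_pow (abs_nonneg _), ← Real.norm_eq_abs, ofReal_norm]
  have hre : AEStronglyMeasurable (fun x => (u x).re) μ :=
    Complex.continuous_re.comp_aestronglyMeasurable hu
  rw [eLpNorm_two_sq, eLpNorm_two_sq, eLpNorm_two_sq, ← lintegral_add_left' (hre.enorm.pow_const 2)]
  refine lintegral_congr fun x => ?_
  rw [hsq, hsq, ← ENNReal.ofReal_add (sq_nonneg _) (sq_nonneg _), ← ofReal_norm,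
    ← ENNReal.ofReal_pow (norm_nonneg _), Complex.sq_norm, Complex.normSq_apply]
  congr 1
  ring

theorem IsTransverseGroundState.tube_eLpNorm_le_complex (hω : IsCrossSection ω)
    (hψ : IsTransverseGroundState ω γD lam ψ dψ) {u : Plane × ℝ → ℂ} {p : Fin 3 → Plane × ℝ → ℂ}
    (hu : MemSobolevZero (straightTube ω) (lateralDirichlet γD) tubeDir u p) {J : Set ℝ}
    (hJ : IsOpen J) :
    ENNReal.ofReal lam * eLpNorm u 2 (volume.restrict (ω ×ˢ J)) ^ 2
      ≤ ∑ i : Fin 2, eLpNorm (p i.castSucc) 2 (volume.restrict (ω ×ˢ J)) ^ 2 := by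
  have hsub : volume.restrict (ω ×ˢ J) ≤ (volume : Measure (Plane × ℝ)).restrict (straightTube ω) :=
    Measure.restrict_mono (Set.prod_mono subset_rfl (Set.subset_univ _)) le_rfl
  have hre := hψ.tube_eLpNorm_le hω (hu.map Complex.reCLM) hJ
  have him := hψ.tube_eLpNorm_le hω (hu.map Complex.imCLM) hJ
  rw [eLpNorm_complex_sq (hu.memLp.mono_measure hsub).1, mul_add]
  simp only [eLpNorm_complex_sq ((hu.grad_memLp _).mono_measure hsub).1]
  rw [Finset.sum_add_distrib]
  exact add_le_add hre him

/-- The mass of a function on the part of the tube over `K`. -/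
def massOver (ω : Set Plane) (K : Set ℝ) (u : Plane × ℝ → ℂ) : ℝ :=
  (eLpNorm u 2 (volume.restrict (ω ×ˢ K))).toReal ^ 2

theorem ofReal_Lp_norm_sq {α : Type*} [MeasurableSpace α] {μ : Measure α} (f : Lp ℂ 2 μ) :
    ENNReal.ofReal (‖f‖ ^ 2) = eLpNorm f 2 μ ^ 2 := by
  rw [Lp.norm_def, ENNReal.ofReal_pow ENNReal.toReal_nonneg, ENNReal.ofReal_toReal (Lp.memLp f).2.ne]

theorem eLpNorm_sq_mono {α : Type*} [MeasurableSpace α] {μ ν : Measure α} (h : μ ≤ ν) (u : α → ℂ) :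
    eLpNorm u 2 μ ^ 2 ≤ eLpNorm u 2 ν ^ 2 := by
  gcongr

/-- Outside the bent part of the tube the mass is controlled by the energy. -/
theorem IsTubeWeight.mass_le (h : IsTubeWeight ω κ β m C) (hω : IsCrossSection ω)
    (hψ : IsTransverseGroundState ω γD lam ψ dψ) {K : Set ℝ} (hK : IsClosed K)
    (h0 : ∀ z ∉ K, κ z = 0)
    {k : ∀ j, Lp ℂ 2 (tubeMeasure ω κ β j)}
    (hk : MemSobolevZero (straightTube ω) (lateralDirichlet γD) tubeDir (k none : Plane × ℝ → ℂ)
      fun i => (k (some i) : Plane × ℝ → ℂ)) :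
    lam * ‖k none‖ ^ 2 ≤ (∑ i, ‖k (some i)‖ ^ 2) + lam * (max C 0 * massOver ω K (k none)) := by
  have hlam : 0 ≤ lam := hψ.toIsTransverseEigenpair.nonneg
  have hsub : volume.restrict (ω ×ˢ K) ≤ (volume : Measure (Plane × ℝ)).restrict (straightTube ω) :=
    Measure.restrict_mono (Set.prod_mono subset_rfl (Set.subset_univ _)) le_rfl
  have hfin := (hk.memLp.mono_measure hsub).2.ne
  have hS : MeasurableSet ((Set.univ : Set Plane) ×ˢ K) := MeasurableSet.univ.prod hK.measurableSet
  have hSc : ((Set.univ : Set Plane) ×ˢ K)ᶜ = Set.univ ×ˢ Kᶜ := by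
    ext x; simp
  have hsplit : eLpNorm (k none) 2 (tubeMeasure ω κ β none) ^ 2
      ≤ ENNReal.ofReal C * eLpNorm (k none) 2 (volume.restrict (ω ×ˢ K)) ^ 2
        + eLpNorm (k none) 2 (volume.restrict (ω ×ˢ Kᶜ)) ^ 2 := by
    rw [eLpNorm_two_sq, eLpNorm_two_sq, eLpNorm_two_sq, ← lintegral_add_compl _ hS, hSc,
      h.restrict_eq none hK.measurableSet.compl h0, ← smul_eq_mul (ENNReal.ofReal C),
      ← lintegral_smul_measure]
    gcongr
    exact h.restrict_le hK.measurableSet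
  have hslice := hψ.tube_eLpNorm_le_complex hω hk hK.isOpen_compl
  -- Off `K` all weights are `1`, so the unweighted transverse energy there is part of the weighted
  -- energy; the longitudinal term is dropped.
  have hgrad : ∑ i : Fin 2, eLpNorm (k (some i.castSucc)) 2 (volume.restrict (ω ×ˢ Kᶜ)) ^ 2
      ≤ ∑ i, ENNReal.ofReal (‖k (some i)‖ ^ 2) := by
    rw [Fin.sum_univ_castSucc (n := 2)]
    refine le_trans (Finset.sum_le_sum fun i _ => ?_) le_self_add
    rw [ofReal_Lp_norm_sq, ← h.restrict_eq (some i.castSucc) hK.measurableSet.compl h0]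
    exact eLpNorm_sq_mono Measure.restrict_le_self _
  -- `ENNReal.ofReal` truncates at zero, hence `max C 0` on the real side.
  have hmass : ENNReal.ofReal (max C 0 * massOver ω K (k none))
      = ENNReal.ofReal C * eLpNorm (k none) 2 (volume.restrict (ω ×ˢ K)) ^ 2 := by
    rw [massOver, ENNReal.ofReal_mul (le_max_right _ _), ENNReal.ofReal_pow ENNReal.toReal_nonneg,
      ENNReal.ofReal_toReal hfin]
    simp [ENNReal.ofReal_max]
  have hm0 : 0 ≤ max C 0 * massOver ω K (k none) :=
    mul_nonneg (le_max_right _ _) (sq_nonneg _)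
  have hs0 : 0 ≤ ∑ i, ‖k (some i)‖ ^ 2 := Finset.sum_nonneg fun i _ => sq_nonneg _
  rw [← ENNReal.ofReal_le_ofReal_iff (by positivity), ENNReal.ofReal_add hs0 (by positivity),
    ENNReal.ofReal_mul hlam, ENNReal.ofReal_mul hlam, hmass, ofReal_Lp_norm_sq,
    ENNReal.ofReal_sum_of_nonneg fun i _ => sq_nonneg _]
  calc _ ≤ ENNReal.ofReal lam * (ENNReal.ofReal C * eLpNorm (k none) 2 (volume.restrict (ω ×ˢ K)) ^ 2
        + eLpNorm (k none) 2 (volume.restrict (ω ×ˢ Kᶜ)) ^ 2) := by gcongr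
    _ = ENNReal.ofReal lam * eLpNorm (k none) 2 (volume.restrict (ω ×ˢ Kᶜ)) ^ 2
        + ENNReal.ofReal lam
          * (ENNReal.ofReal C * eLpNorm (k none) 2 (volume.restrict (ω ×ˢ K)) ^ 2) := by ring
    _ ≤ _ := by gcongr; exact hslice.trans hgrad

theorem exists_tube_coords {S : Set (Plane × ℝ)} (hS : Bornology.IsBounded S) :
    ∃ c : ℝ≥0∞, c ≠ ∞ ∧ ∀ h ∈ S, ∃ a : Fin 3 → ℝ,
      h = ∑ i, a i • tubeDir i ∧ ∀ i, ‖a i‖ₑ ≤ c := by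
  obtain ⟨R, hR⟩ := hS.exists_norm_le
  refine ⟨ENNReal.ofReal R, ENNReal.ofReal_ne_top, fun h hh => ⟨![h.1 0, h.1 1, h.2], ?_, fun i => ?_⟩⟩
  · rw [Fin.sum_univ_three]
    ext j
    · fin_cases j <;> simp [tubeDir, planeDir]
    · simp [tubeDir]
  · rw [← ofReal_norm]
    refine ENNReal.ofReal_le_ofReal (le_trans ?_ (hR h hh))
    fin_cases i
    · exact (PiLp.norm_apply_le h.1 0).trans (norm_fst_le h)
    · exact (PiLp.norm_apply_le h.1 1).trans (norm_fst_le h)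
    · exact norm_snd_le h

/-- Cones for the tube are products of the cones of `ω` with an interval, as the tube is unbounded
in the longitudinal direction. Boundedness of `K` provides the finite volume that local compactness
requires. -/
theorem IsTubeWeight.tendsto_massOver (h : IsTubeWeight ω κ β m C) (hω : IsCrossSection ω) {K : Set ℝ}
    (hK : Bornology.IsBounded K)
    (U : ℕ → formSpace ℂ (straightTube ω) (lateralDirichlet γD) tubeDir h.comparable) {B : ℝ}
    (hU : ∀ n, ‖U n‖ ≤ B) (hw : WeaklyNull ℂ U) :
    Tendsto (fun n => massOver ω K
      (formInclusion h.comparable ℂ (lateralDirichlet γD) tubeDir (U n))) atTop (𝓝 0) := by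
  obtain ⟨T, V, S, hT, hcov⟩ := hω.exists_cones
  obtain ⟨R, hR⟩ := hK.subset_ball 0
  have h1 := tendsto_eLpNorm_biUnion (μ := volume) (f := fun n =>
    (formInclusion h.comparable ℂ (lateralDirichlet γD) tubeDir (U n) : Plane × ℝ → ℂ)) T
    (fun p => (ω ∩ V p) ×ˢ Metric.ball (0 : ℝ) R) fun p hp => by
      obtain ⟨hV, hS, hS0, hSb, hseg⟩ := hT p hp
      have hb := (hω.isBounded.subset (Set.inter_subset_left (t := V p))).prod
        (Metric.isBounded_ball (x := (0 : ℝ)) (r := R))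
      refine formSpace_tendsto_eLpNorm (S := S p ×ˢ Metric.ball (0 : ℝ) 1) _
        (hω.isOpen.prod isOpen_univ) ((hω.isOpen.inter hV).prod Metric.isOpen_ball)
        hb.measure_lt_top.ne (hS.prod Metric.isOpen_ball)
        (hS0.prod ⟨0, Metric.mem_ball_self one_pos⟩) (hSb.prod Metric.isBounded_ball) ?_
        (exists_tube_coords (hSb.prod Metric.isBounded_ball)) U hU hw
      intro x hx v hv s hs
      exact ⟨hseg x.1 hx.1 v.1 hv.1 s hs, trivial⟩
  have hset : ω ×ˢ K ⊆ ⋃ p ∈ T, (ω ∩ V p) ×ˢ Metric.ball (0 : ℝ) R := fun x hx => by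
    obtain ⟨p, hp, hxp⟩ := Set.mem_iUnion₂.1 (hcov hx.1)
    exact Set.mem_iUnion₂.2 ⟨p, hp, ⟨hx.1, hxp⟩, hR hx.2⟩
  have h2 := tendsto_of_tendsto_of_tendsto_of_le_of_le tendsto_const_nhds h1 (fun _ => bot_le)
    fun n => eLpNorm_mono_measure (formInclusion h.comparable ℂ (lateralDirichlet γD) tubeDir (U n))
      (Measure.restrict_mono_set volume hset)
  have h3 := ((ENNReal.tendsto_toReal ENNReal.zero_ne_top).comp h2).pow 2
  rw [ENNReal.toReal_zero, zero_pow two_ne_zero] at h3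
  exact h3

end TubeEnergy

end

/-! ### Spectrum of the tube operator -/

section

open Filter Topology
open scoped ENNReal

section TubeSpectrum

variable {ω γD : Set Plane} {lam : ℝ} {ψ : Plane → ℝ} {dψ : Fin 2 → Plane → ℝ} {κ β : ℝ → ℝ}
  {m C : ℝ}

theorem IsTubeWeight.norm_sq_ofReal (h : IsTubeWeight ω κ β m C) {j : Option (Fin 3)}
    {f : Lp ℂ 2 (tubeMeasure ω κ β j)} {u : Plane × ℝ → ℝ}
    (hf : f =ᵐ[tubeMeasure ω κ β j] fun x => Complex.ofRealCLM (u x)) :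
    ‖f‖ ^ 2 = ∫ x in straightTube ω, tubeDensity κ β j x * u x ^ 2 := by
  rw [h.norm_sq f hf]
  simp

/-- The energy of the product of the transverse ground state with a longitudinal cutoff. -/
theorem IsTubeWeight.exists_trial (h : IsTubeWeight ω κ β m C) (hω : IsCrossSection ω)
    (hψ : IsTransverseEigenpair ω γD lam ψ dψ) {φ : ℝ → ℝ} (hφ : IsTestFunction Set.univ φ)
    (hneg : (∫ z, φ z ^ 2 * bendingDensity ω ψ dψ κ β z) + m⁻¹ * ∫ z, deriv φ z ^ 2 < 0) :
    ∃ U : formSpace ℂ (straightTube ω) (lateralDirichlet γD) tubeDir h.comparable,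
      ‖U‖ ^ 2 < (1 + lam) * ‖formInclusion h.comparable ℂ (lateralDirichlet γD) tubeDir U‖ ^ 2 := by
  obtain ⟨U, hU, hU'⟩ := exists_formSpace_of_memSobolevZero h.comparable
    (fun j => (h.comparable j).symm) ((hψ.mem.mul_prod hφ).map Complex.ofRealCLM)
  refine ⟨U, ?_⟩
  have hE := trial_energy_le hω.isOpen hω.isBounded h.continuous_curvature h.continuous_angle h.pos
    h.le_weight h.weight_le hψ hφ
  have e0 := h.norm_sq_ofReal hU
  have e1 := fun i => h.norm_sq_ofReal (hU' i)
  have e2 : ∀ i : Fin 2, ‖U.1 (some i.castSucc)‖ ^ 2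
      = ∫ x in straightTube ω, weight κ β x * (productGradient ψ dψ φ i.castSucc x) ^ 2 := fun i => by
    rw [e1, tubeDensity_castSucc]
  have e3 : ‖U.1 (some (Fin.last 2))‖ ^ 2
      = ∫ x in straightTube ω, (weight κ β x)⁻¹ * (productGradient ψ dψ φ (Fin.last 2) x) ^ 2 := by
    rw [e1, tubeDensity_last]
  have e4 : ‖formInclusion h.comparable ℂ (lateralDirichlet γD) tubeDir U‖ ^ 2
      = ∫ x in straightTube ω, weight κ β x * (ψ x.1 * φ x.2) ^ 2 := e0
  rw [formSpace_norm_sq_eq, Fin.sum_univ_castSucc (n := 2), e3, e4]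
  simp only [e2]
  linarith

/-- One strict inequality, `(1 + lam) ‖R‖ > 1`, serves both claims: it puts the bottom of the
spectrum below `lam`, and for compactly supported curvature `lam` is a threshold below which the
spectrum is discrete. -/
theorem IsTubeWeight.tube_spectrum (h : IsTubeWeight ω κ β m C) (hω : IsCrossSection ω)
    (hψ : IsTransverseGroundState ω γD lam ψ dψ) {c d : ℝ}
    (hI : ∫ z in Set.Icc c d, bendingDensity ω ψ dψ κ β z < 0)
    (hout : ∀ z, z ∉ Set.Icc c d → bendingDensity ω ψ dψ κ β z ≤ 0) :
    (∃ μ : ℝ, IsGLB {s : ℝ | (s : ℂ) ∈ spectrum (tubeOperator ω γD κ β)} μ ∧ μ < lam) ∧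
      (HasCompactSupport κ → (discreteSpectrum (tubeOperator ω γD κ β)).Nonempty) := by
  obtain ⟨φ, hφ, hneg⟩ := exists_cutoff
    (continuous_bendingDensity h.continuous_curvature h.continuous_angle) m hI hout
  have hlam : 0 ≤ lam := hψ.toIsTransverseEigenpair.nonneg
  obtain ⟨U, hU⟩ := h.exists_trial hω hψ.toIsTransverseEigenpair hφ hneg
  obtain ⟨h1, h2⟩ := exists_isGLB_spectrum_lt _ (h.tubeOperator_iff (γD := γD)) hlam hU
  refine ⟨h2, fun hκ => ?_⟩
  have hsep : TopologicalSpace.SeparableSpace (WeightedL2 ω κ β) :=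
    separableSpace_Lp_tube (ω := ω) (κ := κ) (β := β) none
  -- `Λ` is `1 + lam` rather than `lam` because the form norm includes the `L²` norm; the remainder
  -- is the mass over the bent part.
  refine discreteSpectrum_nonempty _ (h.tubeOperator_iff (γD := γD)) (Λ := 1 + lam) ?_ h1
    (fun W => lam * (max C 0 * massOver ω (tsupport κ)
      (formInclusion h.comparable ℂ (lateralDirichlet γD) tubeDir W))) (fun W B hW hw => ?_)
    fun W => ?_
  · refine pos_of_mul_pos_right (one_pos.trans h1) (by linarith)
  · have h3 := ((h.tendsto_massOver hω hκ.isCompact.isBounded W hW hw).const_mul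
      (max C 0)).const_mul lam
    simpa only [mul_zero] using h3
  · have h3 := h.mass_le hω hψ (isClosed_tsupport κ)
      (fun z hz => image_eq_zero_of_notMem_tsupport hz) (k := W.1) W.2
    rw [formSpace_norm_sq_eq]
    have h4 : (1 + lam) * ‖W.1 none‖ ^ 2 ≤ ‖W.1 none‖ ^ 2 + ∑ i, ‖W.1 (some i)‖ ^ 2
        + lam * (max C 0 * massOver ω (tsupport κ) (W.1 none)) := by linarith
    exact h4

end TubeSpectrum

/-! ### Bounds for the weight of a thin tube -/

section Weight

variable {ω : Set Plane} {ℓ n b : ℝ → Space} {β : ℝ → ℝ}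

theorem IsAxis.continuous_curvature (hℓ : IsAxis ℓ) : Continuous (curvature ℓ) := by
  have h : ContDiff ℝ 1 (deriv^[2] ℓ) := ContDiff.iterate_deriv' 1 2 (by
    have := hℓ.contDiff
    norm_num
    exact this)
  exact h.continuous.norm

theorem abs_mul_cos_add_mul_sin_le (x : Plane) (t : ℝ) :
    |x 0 * Real.cos t + x 1 * Real.sin t| ≤ ‖x‖ := by
  refine abs_le_of_sq_le_sq ?_ (norm_nonneg x)
  rw [EuclideanSpace.real_norm_sq_eq, Fin.sum_univ_two]
  nlinarith [sq_nonneg (x 0 * Real.sin t - x 1 * Real.cos t), Real.sin_sq_add_cos_sq t]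

/-- By Cauchy–Schwarz the weight differs from `1` by at most `a ‖κ‖_∞`, which is less than `1` by
thinness. -/
theorem IsBentUntwistedTube.isTubeWeight (hω : IsCrossSection ω)
    (h : IsBentUntwistedTube ω ℓ n b β) :
    ∃ m C : ℝ, IsTubeWeight ω (curvature ℓ) β m C := by
  set a := crossRadius ω
  set K := ⨆ z, curvature ℓ z
  have hle : ∀ x ∈ straightTube ω, |(x.1 0 * Real.cos (β x.2) + x.1 1 * Real.sin (β x.2))
      * curvature ℓ x.2| ≤ a * K := fun x hx => by
    obtain ⟨R, hR⟩ := hω.isBounded.exists_norm_le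
    have hx1 : ‖x.1‖ ≤ a := le_csSup ⟨R, by rintro _ ⟨y, hy, rfl⟩; exact hR y hy⟩ ⟨x.1, hx.1, rfl⟩
    have h0 : 0 ≤ curvature ℓ x.2 := norm_nonneg _
    rw [abs_mul, abs_of_nonneg h0]
    exact mul_le_mul ((abs_mul_cos_add_mul_sin_le _ _).trans hx1) (le_ciSup h.curvature_bdd x.2) h0
      ((norm_nonneg _).trans hx1)
  refine ⟨1 - a * K, 1 + a * K, hω.isOpen.measurableSet, h.axis.continuous_curvature,
    h.contDiff_angle.continuous, sub_pos.2 h.thin, fun x hx => ?_, fun x hx => ?_⟩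
  · have := (abs_le.1 (hle x hx)).2
    unfold weight; linarith
  · have := (abs_le.1 (hle x hx)).1
    unfold weight; linarith

end Weight

end

end BentTube

end

theorem mainTheorem1
    (ω γD : Set BentTube.Plane) (hω : BentTube.IsCrossSection ω)
    (hγ : BentTube.IsDirichletPart ω γD)
    (ℓ n b : ℝ → BentTube.Space) (β : ℝ → ℝ)
    (htube : BentTube.IsBentUntwistedTube ω ℓ n b β)
    (lam₁ : ℝ) (ψ₁ : BentTube.Plane → ℝ) (dψ₁ : Fin 2 → BentTube.Plane → ℝ)
    (hψ : BentTube.IsTransverseGroundState ω γD lam₁ ψ₁ dψ₁)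
    (hI : ∃ c d : ℝ, c ≤ d ∧
      ∫ z in Set.Icc c d, BentTube.curvature ℓ z *
        (BentTube.transverseMean ω ψ₁ dψ₁ 0 * Real.cos (β z)
          + BentTube.transverseMean ω ψ₁ dψ₁ 1 * Real.sin (β z)) < 0 ∧
      ∀ z, z ∉ Set.Icc c d → BentTube.curvature ℓ z *
        (BentTube.transverseMean ω ψ₁ dψ₁ 0 * Real.cos (β z)
          + BentTube.transverseMean ω ψ₁ dψ₁ 1 * Real.sin (β z)) ≤ 0) :
    (∃ m : ℝ, IsGLB {s : ℝ | (s : ℂ) ∈ BentTube.spectrum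
        (BentTube.tubeOperator ω γD (BentTube.curvature ℓ) β)} m ∧ m < lam₁) ∧
    (HasCompactSupport (BentTube.curvature ℓ) →
      (BentTube.discreteSpectrum
        (BentTube.tubeOperator ω γD (BentTube.curvature ℓ) β)).Nonempty) := by
  obtain ⟨c, d, -, hneg, hout⟩ := hI
  obtain ⟨m, C, h⟩ := htube.isTubeWeight hω
  exact h.tube_spectrum hω hψ hneg hout
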